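/- **Setting.** Let $p,d\ge 1$, let $G=([p],E)$ be a graph whose vertices all have degree at most $d$, and let $\Sigma$ be a symmetric positive definite $p\times p$ matrix with $\Theta=\Sigma^{-1}$ such that, for $i\ne j$, $\{i,j\}\in E\iff\Theta_{ij}\neq0$. Put $\beta_{ij}=-\Theta_{ij}/\Theta_{ii}$. Assume, for given $\sigma_{\min},\sigma_{\max}>0$ and $0<\beta_{\min}\le\beta_{\max}$: (1) $\beta_{\min}\le|\beta_{ij}|\le\beta_{\max}$ whenever $\{i,j\}\in E$ (in both orders of $i,j$); (2) for all $i$, $\Sigma_{ii}\le\sigma_{\max}^2$, and the conditional variance $1/\Theta_{ii}$ of coordinate $i$ given the others under $N(0,\Sigma)$ is at least $\sigma_{\min}^2$; (3) $d\beta_{\max}\le\gamma$, where $\gamma\in(0,1)$. *Glauber dynamics.* Let $S_0=0$, and let the holding times $S_{n+1}-S_n$ be exponential with rate $p$. At time $S_n$ ($n\ge1$) a node $I^{(n)}$ uniform in $[p]$ is chosen; if $I^{(n)}=i$, then $X^{(n)}_i=\sum_{j\in N(i)}\beta_{ij}X^{(n-1)}_j+\epsilon^{(n)}$ with $\epsilon^{(n)}\sim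 N(0,1/\Theta_{ii})$, and the other coordinates do not change. The holding times, the nodes, the standardized noises and the initial state $X^{(0)}$ are independent. Let $Y^{(t)}=X^{(n)}$ for $S_n\le t<S_{n+1}$. The data observed up to time $T$ are the triples $(X^{(n)},S_n,I^{(n)})$ with $S_n\le T$. *Algorithm 1.* Its parameters are $T,\tau,\rho,\sigma_{\min},y_{\max}$. Let $k_{\max}=\lfloor T/\tau\rfloor$. For $1\le k\le k_{\max}$ split $[(k-1)\tau,k\tau)$ into three consecutive half-open intervals $W_1,W_2,W_3$ of length $\tau/3$. Let $A_{ij}^k$ be the event that $i$ is updated at least once and $j$ never in $W_1$, $j$ at least once and $i$ never in $W_2$, and $i$ at least once and $j$ never in $W_3$. Let $\Delta Y_i^k=Y_i^{k\tau-}-Y_i^{(k-2/3)\tau-}$, $\Delta Y_j^k=Y_j^{(k-1/3)\tau}-Y_j^{(k-1)\tau}$, $B_j^k=\{|\Delta Y_j^k|\ge\sigma_{\min}\}$ and $T_{ij}^{(k)}=\mathbf 1_{A_{ij}^k\cap B_j^k}\,\Delta Y_i^k/\Delta Y_j^k$. If some observed state has a coordinate exceeding $y_{\max}$ in absolute value,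 the algorithm returns $\hat E=\emptyset$; otherwise it returns $\hat E=\{\{i,j\}:i<j,\ |\frac1{k_{\max}}\sum_{k=1}^{k_{\max}}T^{(k)}_{ij}|\ge\rho\}$. **Theorem.** Let $\sigma_{\max}>0$, $\gamma\in(0,1)$, $C_0,C_1',C_1''>0$. There are constants $C_1,C_2,C_3,C_4>0$, depending only on these numbers, such that the following holds for all $\delta\in(0,1/2)$ and all $p,d,\beta_{\min},\beta_{\max},\sigma_{\min},G,\Sigma$ as above (in particular for all sufficiently large $p$), and for Glauber dynamics whose initial state satisfies $\max_i|X^{(0)}_i|\le C_0\sigma_{\max}\sqrt{\log(p/\delta)}$ with probability at least $1-\delta/4$. Put $T_{\max}=C_1'p^{C_1''}$ and $y_{\max}=C_1\sigma_{\max}\sqrt{\log(p/\delta)}$. Then $$\mathbb P\Big[\max_{i\in[p],\,0\le t<T_{\max}}|Y_i^{(t)}|\le y_{\max}\Big]\ge1-\delta/2,$$ and if $$T_{\max}\ge T\ge\frac{C_2}{(\beta_{\min}\sigma_{\min})^4}\,d^2\log(p/\delta)^3,$$ $$\tau=d^{-1}\Big[\frac{C_3\sqrt{\log(p/\delta)}}{\sigma_{\min}\beta_{\min}}+1\Big]^{-1},\qquad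 \rho=C_4\,q\,\tau d\,\frac{\sqrt{\log(p/\delta)}}{\sigma_{\min}},\qquad q=\big[(1-e^{-\tau/3})e^{-\tau/3}\big]^3,$$ then Algorithm 1, run on the data observed up to time $T$ with these parameters, returns $\hat E=E$ with probability at least $1-\delta$. -/

import Mathlib

open MeasureTheory ProbabilityTheory

noncomputable section

namespace GaussGlauber

/-! ### Gaussian graphical models -/

/-- `(G, N(0, Cov))` is a (faithful) Gaussian graphical model: `Cov` is symmetric positive definite
and the edges of `G` are exactly the nonzero off-diagonal entries of the precision matrix. -/
structure IsGGM {p : ℕ} (G : SimpleGraph (Fin p)) (Cov : Matrix (Fin p) (Fin p) ℝ) : Prop where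
  posDef : Cov.PosDef
  adj_iff : ∀ i j, i ≠ j → (G.Adj i j ↔ Cov⁻¹ i j ≠ 0)

/-- Partial regression coefficient `β_ij = - θ_ij / θ_ii`, with `θ = Cov⁻¹`. -/
def beta {p : ℕ} (Cov : Matrix (Fin p) (Fin p) ℝ) (i j : Fin p) : ℝ :=
  -(Cov⁻¹ i j) / Cov⁻¹ i i

/-- Conditional variance of `X_i` given all the other coordinates: the conditional law has
precision `θ_ii`. -/
def condVar {p : ℕ} (Cov : Matrix (Fin p) (Fin p) ℝ) (i : Fin p) : ℝ :=
  (Cov⁻¹ i i)⁻¹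

/-- Bounded edge strength: `β_min ≤ |β_ij| ≤ β_max` for every edge, in both orientations. -/
def BoundedEdgeStrength {p : ℕ} (G : SimpleGraph (Fin p)) (Cov : Matrix (Fin p) (Fin p) ℝ)
    (βmin βmax : ℝ) : Prop :=
  ∀ i j, G.Adj i j → βmin ≤ |beta Cov i j| ∧ |beta Cov i j| ≤ βmax

/-- Bounded variance: marginal variances are at most `σ_max²`, conditional variances of a
coordinate given the others are at least `σ_min²`. -/
def BoundedVariance {p : ℕ} (Cov : Matrix (Fin p) (Fin p) ℝ) (σmin σmax : ℝ) : Prop :=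
  ∀ i, Cov i i ≤ σmax ^ 2 ∧ σmin ^ 2 ≤ condVar Cov i

/-- All degrees are at most `d`. -/
def DegreeBound {p : ℕ} (G : SimpleGraph (Fin p)) (d : ℕ) : Prop :=
  ∀ i, (G.neighborSet i).ncard ≤ d

/-! ### Continuous-time Glauber dynamics -/

open Classical in
/-- The new value of coordinate `i` at an update of `i` from the state `x` with standard normal
input `z`: `∑_{j ∈ N(i)} β_ij x_j + ε`, where `ε` is `z` times the conditional standard deviation. -/
def updateValue {p : ℕ} (G : SimpleGraph (Fin p)) (Cov : Matrix (Fin p) (Fin p) ℝ)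
    (x : Fin p → ℝ) (i : Fin p) (z : ℝ) : ℝ :=
  (∑ j with G.Adj i j, beta Cov i j * x j) + √(condVar Cov i) * z

/-- `X n` is the state after `n` updates, `S n` the time of the `n`-th update (`S 0 = 0`),
`I n` (`1 ≤ n`) the node updated at time `S n`, and `Z n` (`1 ≤ n`) the standardized Gaussian
innovation used there. The holding times are exponential with rate `p`, the nodes are uniform, the
innovations are standard normal; all of them and the initial state are independent. The initial
state is arbitrary, possibly random. `I 0` and `Z 0` play no role. -/
structure IsGlauberDynamics {p : ℕ} (G : SimpleGraph (Fin p)) (Cov : Matrix (Fin p) (Fin p) ℝ)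
    {Ω : Type*} [MeasurableSpace Ω] (P : Measure Ω)
    (X : ℕ → Ω → Fin p → ℝ) (S : ℕ → Ω → ℝ) (I : ℕ → Ω → Fin p) (Z : ℕ → Ω → ℝ) : Prop where
  measurable_X : ∀ n, Measurable (X n)
  measurable_S : ∀ n, Measurable (S n)
  measurable_I : ∀ n, Measurable (I n)
  measurable_Z : ∀ n, Measurable (Z n)
  start : ∀ᵐ ω ∂P, S 0 ω = 0
  law : ∀ n, P.map (fun ω => (S (n + 1) ω - S n ω, I (n + 1) ω, Z (n + 1) ω)) =
    (expMeasure (p : ℝ)).prod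
      ((uniformOn (Set.univ : Set (Fin p))).prod (gaussianReal 0 1))
  indep : iIndepFun (fun n ω => (S (n + 1) ω - S n ω, I (n + 1) ω, Z (n + 1) ω)) P
  indep_init : IndepFun (X 0)
    (fun ω (n : ℕ) => (S (n + 1) ω - S n ω, I (n + 1) ω, Z (n + 1) ω)) P
  step : ∀ᵐ ω ∂P, ∀ n, X (n + 1) ω = Function.update (X n ω) (I (n + 1) ω)
    (updateValue G Cov (X n ω) (I (n + 1) ω) (Z (n + 1) ω))

/-- Number of updates in `(0, t]`. -/
def numUpdates {Ω : Type*} (S : ℕ → Ω → ℝ) (t : ℝ) (ω : Ω) : ℕ :=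
  {n : ℕ | S (n + 1) ω ≤ t}.ncard

/-- The continuous-time process `Y^(t)`, equal to `X n` for `S n ≤ t < S (n + 1)`. -/
def path {p : ℕ} {Ω : Type*} (X : ℕ → Ω → Fin p → ℝ) (S : ℕ → Ω → ℝ) (t : ℝ) (ω : Ω) :
    Fin p → ℝ :=
  X (numUpdates S t ω) ω

/-! ### The observed data -/

/-- A recorded data set: the states, times and updated nodes of the rounds `0, …, N`. -/
structure Dataset (p : ℕ) where
  N : ℕ
  state : Fin (N + 1) → Fin p → ℝ
  time : Fin (N + 1) → ℝ
  node : Fin (N + 1) → Fin p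

/-- The data obtained by observing the dynamics during `[0, T]`. -/
def observe {p : ℕ} {Ω : Type*} (X : ℕ → Ω → Fin p → ℝ) (S : ℕ → Ω → ℝ) (I : ℕ → Ω → Fin p)
    (T : ℝ) (ω : Ω) : Dataset p where
  N := numUpdates S T ω
  state n := X n ω
  time n := S n ω
  node n := I n ω

namespace Dataset

variable {p : ℕ} (D : Dataset p)

open Classical in
/-- `Y^(t)` read off from the data. -/
def valueAt (t : ℝ) : Fin p → ℝ :=
  D.state ⟨(Finset.univ.filter fun n : Fin D.N => D.time n.succ ≤ t).card,
    Nat.lt_succ_of_le ((Finset.card_filter_le _ _).trans_eq (Finset.card_fin D.N))⟩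

open Classical in
/-- The left limit `Y^(t)-` read off from the data. -/
def valueBefore (t : ℝ) : Fin p → ℝ :=
  D.state ⟨(Finset.univ.filter fun n : Fin D.N => D.time n.succ < t).card,
    Nat.lt_succ_of_le ((Finset.card_filter_le _ _).trans_eq (Finset.card_fin D.N))⟩

/-- Node `i` is updated at some time in `[a, b)`. -/
def UpdatedIn (i : Fin p) (a b : ℝ) : Prop :=
  ∃ n : Fin D.N, D.node n.succ = i ∧ a ≤ D.time n.succ ∧ D.time n.succ < b

/-- The event `A_ij^k`: in the three thirds of `[(k-1)τ, kτ)`, the nodes of the pair that are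
updated are `i` only, `j` only, and `i` only, respectively. -/
def EventA (τ : ℝ) (k : ℕ) (i j : Fin p) : Prop :=
  (D.UpdatedIn i (((k : ℝ) - 1) * τ) (((k : ℝ) - 2 / 3) * τ) ∧
    ¬ D.UpdatedIn j (((k : ℝ) - 1) * τ) (((k : ℝ) - 2 / 3) * τ)) ∧
  (D.UpdatedIn j (((k : ℝ) - 2 / 3) * τ) (((k : ℝ) - 1 / 3) * τ) ∧
    ¬ D.UpdatedIn i (((k : ℝ) - 2 / 3) * τ) (((k : ℝ) - 1 / 3) * τ)) ∧
  (D.UpdatedIn i (((k : ℝ) - 1 / 3) * τ) ((k : ℝ) * τ) ∧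
    ¬ D.UpdatedIn j (((k : ℝ) - 1 / 3) * τ) ((k : ℝ) * τ))

/-- `ΔY_i^k = Y_i^{(kτ)-} - Y_i^{((k-2/3)τ)-}`. -/
def numer (τ : ℝ) (k : ℕ) (i : Fin p) : ℝ :=
  D.valueBefore ((k : ℝ) * τ) i - D.valueBefore (((k : ℝ) - 2 / 3) * τ) i

/-- `ΔY_j^k = Y_j^{((k-1/3)τ)} - Y_j^{((k-1)τ)}`. -/
def denom (τ : ℝ) (k : ℕ) (j : Fin p) : ℝ :=
  D.valueAt (((k : ℝ) - 1 / 3) * τ) j - D.valueAt (((k : ℝ) - 1) * τ) j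

/-- The event `B_j^k`: the change of `Y_j` is at least `σ_min` in absolute value. -/
def EventB (σmin τ : ℝ) (k : ℕ) (j : Fin p) : Prop :=
  σmin ≤ |D.denom τ k j|

open Classical in
/-- The `k`-th term `T_ij^(k)` of the test statistic. -/
def testTerm (σmin τ : ℝ) (k : ℕ) (i j : Fin p) : ℝ :=
  if D.EventA τ k i j ∧ D.EventB σmin τ k j then D.numer τ k i / D.denom τ k j else 0

/-- The average `(1 / k_max) ∑_{k = 1}^{k_max} T_ij^(k)` with `k_max = ⌊T / τ⌋`. -/
def avgStat (σmin T τ : ℝ) (i j : Fin p) : ℝ :=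
  (1 / (⌊T / τ⌋₊ : ℝ)) * ∑ k ∈ Finset.Icc 1 ⌊T / τ⌋₊, D.testTerm σmin τ k i j

/-- All recorded values are at most `ymax` in absolute value. -/
def Bounded (ymax : ℝ) : Prop :=
  ∀ n i, |D.state n i| ≤ ymax

open Classical in
/-- The structure learning algorithm, run on the data of the observation window `[0, T]`: it
returns the empty edge set if a recorded value exceeds `ymax`, and otherwise the pairs whose
averaged test statistic is at least `ρ` in absolute value. -/
def algorithm (σmin ymax T τ ρ : ℝ) : Set (Sym2 (Fin p)) :=
  if D.Bounded ymax then
    {e | ∃ i j : Fin p, i < j ∧ e = s(i, j) ∧ ρ ≤ |D.avgStat σmin T τ i j|}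
  else ∅

end Dataset

/-! ### The parameters -/

/-- `y_max = C₁ σ_max √(log (p / δ))`. -/
def yMax (C₁ σmax : ℝ) (p : ℕ) (δ : ℝ) : ℝ :=
  C₁ * σmax * √(Real.log (p / δ))

/-- The interval length `τ = d⁻¹ [C₃ √(log (p / δ)) / (σ_min β_min) + 1]⁻¹`. -/
def tauOf (C₃ βmin σmin : ℝ) (p d : ℕ) (δ : ℝ) : ℝ :=
  (d : ℝ)⁻¹ * (C₃ * √(Real.log (p / δ)) / (σmin * βmin) + 1)⁻¹

/-- `q = [(1 - e^{-τ/3}) e^{-τ/3}]³`. -/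
def qOf (τ : ℝ) : ℝ :=
  ((1 - Real.exp (-τ / 3)) * Real.exp (-τ / 3)) ^ 3

/-- The threshold `ρ = C₄ q τ d √(log (p / δ)) / σ_min`. -/
def rhoOf (C₄ τ σmin : ℝ) (p d : ℕ) (δ : ℝ) : ℝ :=
  C₄ * qOf τ * τ * d * (√(Real.log (p / δ)) / σmin)

end GaussGlauber

end

open scoped ENNReal

set_option linter.unusedSectionVars false

namespace GaussGlauber

section

variable {p : ℕ}

/-! ### The canonical driving sequence -/

/-! The path is a deterministic function of the initial state and of an i.i.d. sequence of rounds
(holding time, node, noise). All estimates are made under the product law `driveLaw`, uniformly in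
the initial state, and transferred to the dynamics at the end. Two invariances of this law carry the
probability: restart (`lintegral_stitch`), by which the rounds after a fixed time may be replaced by
an independent copy, and resampling (`lintegral_renoise`), by which the last noise of a node before
a fixed time may be replaced by a fresh normal variable.

Fix i ≠ j and a window of length τ starting from x. Call the window ideal if A_ij occurs and no
other neighbour of i or j is updated. On an ideal window the change of Y_j is W = a + b_ji s_i z₁ +
s_j z₂ with a = `drift b i j x`, and the change of Y_i is b_ij W + s_i (z₃ - z₁), with independent
standard normal z₁, z₂, z₃. In the mean of the ratio on |W| ≥ σ, the variable z₃ averages out, and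
so does the part of z₁ uncorrelated with W, leaving a multiple of W - a. With the symmetry b_ji s_i²
= b_ij s_j², the mean is b_ij / (1 + b_ij b_ji) times b_ij b_ji P(|W| ≥ σ) + E[a / W; |W| ≥ σ]
(`integral_idealStat`). Both summands are nonnegative. So the mean vanishes for a non-edge; for an
edge it has the sign of b_ij, and it is at least of order |b_ij| as soon as |a| is comparable to s_j
(`le_meanRatio`). That may fail for the given x, but the drift is affine in the last noise of j with
slope at least (1 - γ²) s_j. Hence it is large with probability at least 1/4 at any time at least 1
later (`driveLaw_le_abs_drift`), and so at the start of a positive proportion of the windows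
(`driveLaw_visits_le`).

Windows in A_ij that are not ideal have relative probability at most 2D with D = dτ. While the
states are bounded by Y, the ratio there is at most M = 2Y/σ. In units of M such a window
contributes a bias of at most 2Dq, against a signal of order qβ/M; τ is chosen so that D is a small
multiple of β/M. Over K windows the level 8KqD then separates edges from non-edges. Chernoff's bound
with parameter of order D gives errors exp(-4KqD²/C) for an absolute constant C, besides the event
of too few visits. Since q is at least of order τ³, KqD² is at least of order TD⁴/d², and the
assumption on T makes the errors small enough for a union bound over pairs.

Boundedness is a contraction argument: an update has size at most γ times the current maximum plus
σ_max |z|, so a cube of radius of order √log(p/δ) is preserved as long as the noises are of this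
order, which is likely over a polynomially long time. -/

/-- The law of one round: holding time, node, standardized noise. -/
noncomputable def stepLaw (p : ℕ) : Measure (ℝ × Fin p × ℝ) :=
  (expMeasure (p : ℝ)).prod ((uniformOn (Set.univ : Set (Fin p))).prod (gaussianReal 0 1))

/-- The law of the driving sequence: independent rounds. -/
noncomputable def driveLaw (p : ℕ) : Measure (ℕ → ℝ × Fin p × ℝ) :=
  Measure.infinitePi fun _ => stepLaw p

instance instIsProbabilityMeasureExp (p : ℕ) [NeZero p] :
    IsProbabilityMeasure (expMeasure (p : ℝ)) :=
  isProbabilityMeasure_expMeasure (Nat.cast_pos.2 (NeZero.pos p))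

instance instIsProbabilityMeasureUniform (p : ℕ) [NeZero p] :
    IsProbabilityMeasure (uniformOn (Set.univ : Set (Fin p))) :=
  isProbabilityMeasure_uniformOn Set.finite_univ Set.univ_nonempty

instance instIsProbabilityMeasureStepLaw (p : ℕ) [NeZero p] :
    IsProbabilityMeasure (stepLaw p) := by
  unfold stepLaw; infer_instance

instance instIsProbabilityMeasureDriveLaw (p : ℕ) [NeZero p] :
    IsProbabilityMeasure (driveLaw p) := by
  unfold driveLaw; infer_instance

/-! ### Product measures on sequences: prepending a term. -/

section Sequences

variable {E : Type*} [MeasurableSpace E]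

/-- A measure on sequences with the right mass on all boxes is the product measure. -/
theorem eq_infinitePi_of_box (ν : Measure E) [IsProbabilityMeasure ν] (μ : Measure (ℕ → E))
    (h : ∀ (n : ℕ) (A : ℕ → Set E), (∀ i, MeasurableSet (A i)) →
      μ {ω | ∀ i < n, ω i ∈ A i} = ∏ i ∈ Finset.range n, ν (A i)) :
    μ = Measure.infinitePi fun _ => ν := by
  classical
  refine Measure.eq_infinitePi _ fun s t ht => ?_
  have hn : ∀ i ∈ s, i < s.sup id + 1 := fun i hi =>
    Nat.lt_succ_of_le (Finset.le_sup (f := id) hi)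
  -- A cylinder over a finite index set is a box over an initial segment, with unconstrained sides
  -- outside the set.
  have := h (s.sup id + 1) (fun i => if i ∈ s then t i else Set.univ)
    (fun i => by split_ifs; exacts [ht i, MeasurableSet.univ])
  convert this using 1
  · congr 1
    ext ω
    simp only [Set.mem_pi, Finset.mem_coe, Set.mem_ofPred_eq]
    refine ⟨fun h i _ => ?_, fun h i hi => ?_⟩
    · split_ifs with hi
      exacts [h i hi, trivial]
    · simpa [hi] using h i (hn i hi)
  · rw [← Finset.prod_subset (s₁ := s) (fun i hi => Finset.mem_range.2 (hn i hi))]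
    · exact Finset.prod_congr rfl fun i hi => by simp [hi]
    · intro i _ hi
      simp [hi]

theorem infinitePi_box (ν : Measure E) [IsProbabilityMeasure ν] (n : ℕ) (A : ℕ → Set E)
    (hA : ∀ i, MeasurableSet (A i)) :
    Measure.infinitePi (fun _ : ℕ => ν) {ω | ∀ i < n, ω i ∈ A i} =
      ∏ i ∈ Finset.range n, ν (A i) := by
  rw [← Measure.infinitePi_pi (fun _ : ℕ => ν) (fun i _ => hA i)]
  congr 1
  ext ω
  simp

/-- A sequence with a new first term. -/
def consSeq (e : E) (ω : ℕ → E) : ℕ → E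
  | 0 => e
  | n + 1 => ω n

/-- A sequence without its first term. -/
def tailSeq (ω : ℕ → E) : ℕ → E := fun n => ω (n + 1)

@[simp] theorem consSeq_zero (e : E) (ω : ℕ → E) : consSeq e ω 0 = e := rfl

@[simp] theorem tailSeq_apply (ω : ℕ → E) (n : ℕ) : tailSeq ω n = ω (n + 1) := rfl

@[simp] theorem tailSeq_consSeq (e : E) (ω : ℕ → E) : tailSeq (consSeq e ω) = ω := rfl

@[fun_prop] theorem measurable_tailSeq : Measurable (tailSeq : (ℕ → E) → ℕ → E) := by
  unfold tailSeq; fun_prop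

@[fun_prop] theorem measurable_consSeq : Measurable fun x : E × (ℕ → E) => consSeq x.1 x.2 := by
  refine measurable_pi_lambda _ fun n => ?_
  cases n with
  | zero => exact measurable_fst
  | succ n => exact (measurable_pi_apply n).comp measurable_snd

theorem measurableSet_box {F : Type*} [MeasurableSpace F] {f : ℕ → F → E}
    (hf : ∀ i, Measurable (f i)) (n : ℕ) (A : ℕ → Set E) (hA : ∀ i, MeasurableSet (A i)) :
    MeasurableSet {x | ∀ i < n, f i x ∈ A i} := by
  simp only [Set.ofPred_forall]
  exact MeasurableSet.iInter fun i => MeasurableSet.iInter fun _ => hf i (hA i)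

/-- A box splits into its first side and a box for the tail. This is the source of all inductions
over the first round. -/
theorem map_consSeq (ν : Measure E) [IsProbabilityMeasure ν] :
    (ν.prod (Measure.infinitePi fun _ : ℕ => ν)).map (fun x => consSeq x.1 x.2) =
      Measure.infinitePi fun _ => ν := by
  refine eq_infinitePi_of_box ν _ fun n A hA => ?_
  have hm := measurableSet_box (E := E) (fun i => measurable_pi_apply i) n A hA
  rw [Measure.map_apply measurable_consSeq hm]
  cases n with
  | zero => simp
  | succ n =>
    have : (fun x : E × (ℕ → E) => consSeq x.1 x.2) ⁻¹' {ω | ∀ i < n + 1, ω i ∈ A i} =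
        A 0 ×ˢ {ω | ∀ i < n, ω i ∈ A (i + 1)} := by
      ext ⟨e, ω⟩
      simp only [Set.mem_preimage, Set.mem_ofPred_eq, Set.mem_prod]
      refine ⟨fun h => ⟨h 0 n.succ_pos, fun i hi => h (i + 1) (Nat.succ_lt_succ hi)⟩, ?_⟩
      rintro ⟨h0, h1⟩ (_ | i) hi
      exacts [h0, h1 i (Nat.lt_of_succ_lt_succ hi)]
    rw [this, Measure.prod_prod, infinitePi_box ν n _ fun i => hA (i + 1),
      Finset.prod_range_succ', mul_comm]

/-- Integrating over the first term and the other terms separately. -/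
theorem lintegral_infinitePi_split (ν : Measure E) [IsProbabilityMeasure ν]
    {F : (ℕ → E) → ℝ≥0∞} (hF : Measurable F) :
    ∫⁻ ω, F ω ∂(Measure.infinitePi fun _ : ℕ => ν) =
      ∫⁻ e, ∫⁻ ω, F (consSeq e ω) ∂(Measure.infinitePi fun _ : ℕ => ν) ∂ν := by
  conv_lhs => rw [← map_consSeq ν]
  rw [lintegral_map hF measurable_consSeq, lintegral_prod _ (by fun_prop)]

end Sequences

/-! ### Memorylessness and restart at a fixed time. -/

/-- Memorylessness: after translation by t the density r e^{-r(t+x)} factors as e^{-rt} times the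
density at x. -/
theorem expMeasure_inter_Ici {r t : ℝ} (ht : 0 ≤ t) {B : Set ℝ} (hB : MeasurableSet B) :
    expMeasure r (B ∩ Set.Ici t) =
      ENNReal.ofReal (Real.exp (-(r * t))) * expMeasure r ((fun x => t + x) ⁻¹' B) := by
  have hd : expMeasure r = volume.withDensity (exponentialPDF r) := rfl
  have hm : Measurable (exponentialPDF r) := (measurable_exponentialPDFReal r).ennreal_ofReal
  have hB' : MeasurableSet ((fun x => t + x) ⁻¹' B) := measurable_const_add t hB
  rw [hd, withDensity_apply _ (hB.inter measurableSet_Ici), withDensity_apply _ hB',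
    ← lintegral_indicator (hB.inter measurableSet_Ici), ← lintegral_indicator hB',
    ← lintegral_const_mul _ (hm.indicator hB'), ← lintegral_add_left_eq_self _ t]
  refine lintegral_congr fun x => ?_
  by_cases hx : t + x ∈ B
  · rw [Set.indicator_of_mem (s := (fun x => t + x) ⁻¹' B) (by exact hx)]
    by_cases h0 : 0 ≤ x
    · rw [Set.indicator_of_mem (by exact ⟨hx, by simpa using h0⟩), exponentialPDF_of_nonneg h0,
        exponentialPDF_of_nonneg (add_nonneg ht h0), ← ENNReal.ofReal_mul (Real.exp_nonneg _)]
      congr 1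
      rw [show -(r * (t + x)) = -(r * t) + -(r * x) by ring, Real.exp_add]
      ring
    · rw [Set.indicator_of_notMem (by rintro ⟨_, h⟩; exact h0 (by simpa using h)),
        exponentialPDF_of_neg (not_le.1 h0), mul_zero]
  · rw [Set.indicator_of_notMem (by rintro ⟨h, _⟩; exact hx h),
      Set.indicator_of_notMem (by exact hx), mul_zero]


/-- Memorylessness of the holding time of a round. -/
theorem stepLaw_inter_le [NeZero p] {t : ℝ} (ht : 0 ≤ t) {A : Set (ℝ × Fin p × ℝ)}
    (hA : MeasurableSet A) :
    stepLaw p (A ∩ {e | t ≤ e.1}) =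
      ENNReal.ofReal (Real.exp (-(p * t))) * stepLaw p {e | (t + e.1, e.2) ∈ A} := by
  have h1 : MeasurableSet {e : ℝ × Fin p × ℝ | t ≤ e.1} := measurableSet_le (by fun_prop) (by fun_prop)
  have hf : Measurable fun e : ℝ × Fin p × ℝ => (t + e.1, e.2) := by fun_prop
  have h2 : MeasurableSet {e : ℝ × Fin p × ℝ | (t + e.1, e.2) ∈ A} := hf hA
  unfold stepLaw
  rw [Measure.prod_apply_symm (hA.inter h1), Measure.prod_apply_symm h2,
    ← lintegral_const_mul _ (measurable_measure_prodMk_right h2)]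
  refine lintegral_congr fun y => ?_
  exact expMeasure_inter_Ici ht (measurable_prodMk_right hA)

/-- The driving sequence that follows `ω` up to time `t` and then restarts with `ω'`. -/
noncomputable def stitch : ℕ → ℝ → (ℕ → ℝ × Fin p × ℝ) → (ℕ → ℝ × Fin p × ℝ) → ℝ × Fin p × ℝ
  -- `t` is the time left. The round in progress when it runs out is prolonged by the first holding
  -- time of `ω'` and takes its node and noise from `ω'`.
  | 0, t, ω, ω' => if (ω 0).1 < t then ω 0 else (t + (ω' 0).1, (ω' 0).2)
  | n + 1, t, ω, ω' => if (ω 0).1 < t then stitch n (t - (ω 0).1) (tailSeq ω) ω' else ω' (n + 1)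

theorem measurable_stitch_aux (n : ℕ) :
    Measurable fun x : ℝ × (ℕ → ℝ × Fin p × ℝ) × (ℕ → ℝ × Fin p × ℝ) =>
      stitch n x.1 x.2.1 x.2.2 := by
  induction n with
  | zero =>
    exact Measurable.ite (measurableSet_lt (by fun_prop) (by fun_prop)) (by fun_prop) (by fun_prop)
  | succ n ih =>
    refine Measurable.ite (measurableSet_lt (by fun_prop) (by fun_prop)) ?_ (by fun_prop)
    exact ih.comp (f := fun x : ℝ × (ℕ → ℝ × Fin p × ℝ) × (ℕ → ℝ × Fin p × ℝ) =>
      (x.1 - (x.2.1 0).1, tailSeq x.2.1, x.2.2)) (by fun_prop)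

@[fun_prop] theorem measurable_stitch {F : Type*} [MeasurableSpace F] (n : ℕ) {t : F → ℝ}
    {f g : F → ℕ → ℝ × Fin p × ℝ} (ht : Measurable t) (hf : Measurable f) (hg : Measurable g) :
    Measurable fun x => stitch n (t x) (f x) (g x) :=
  (measurable_stitch_aux n).comp (f := fun x => (t x, f x, g x)) (by fun_prop)

/-- Condition on the first round of `ω`. If it ends before `t`, what remains is the same statement
with less time left. Otherwise everything comes from `ω'`, with the first holding time shifted by
`t`, and memorylessness accounts for the shift. -/
theorem lintegral_stitch_box [NeZero p] (n : ℕ) (A : ℕ → Set (ℝ × Fin p × ℝ))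
    (hA : ∀ i, MeasurableSet (A i)) {t : ℝ} (ht : 0 ≤ t) :
    ∫⁻ ω, driveLaw p {ω' | ∀ i < n, stitch i t ω ω' ∈ A i} ∂driveLaw p =
      ∏ i ∈ Finset.range n, stepLaw p (A i) := by
  induction n generalizing A t with
  | zero => simp
  | succ n ih =>
    have hms : ∀ (n : ℕ) (A : ℕ → Set (ℝ × Fin p × ℝ)), (∀ i, MeasurableSet (A i)) → ∀ t : ℝ,
        MeasurableSet {x : (ℕ → ℝ × Fin p × ℝ) × (ℕ → ℝ × Fin p × ℝ) |
          ∀ i < n, stitch i t x.1 x.2 ∈ A i} := fun n A hA t =>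
      measurableSet_box (fun i => by fun_prop) n A hA
    have hmeas : Measurable fun ω => driveLaw p {ω' | ∀ i < n + 1, stitch i t ω ω' ∈ A i} :=
      measurable_measure_prodMk_left (ν := driveLaw p) (hms (n + 1) A hA t)
    have hshift : Measurable fun e : ℝ × Fin p × ℝ => (t + e.1, e.2) := by fun_prop
    set c := ∏ i ∈ Finset.range n, stepLaw p (A (i + 1)) with hc
    have hlt : MeasurableSet {e : ℝ × Fin p × ℝ | e.1 < t} :=
      measurableSet_lt (by fun_prop) (by fun_prop)
    have key : ∀ e : ℝ × Fin p × ℝ,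
        ∫⁻ ω, driveLaw p {ω' | ∀ i < n + 1, stitch i t (consSeq e ω) ω' ∈ A i} ∂driveLaw p =
          (A 0 ∩ {e | e.1 < t}).indicator (fun _ => c) e +
          {e : ℝ × Fin p × ℝ | e.1 < t}ᶜ.indicator
            (fun _ => stepLaw p {e | (t + e.1, e.2) ∈ A 0} * c) e := by
      intro e
      by_cases he : e.1 < t
      · rw [Set.indicator_of_notMem (s := {e : ℝ × Fin p × ℝ | e.1 < t}ᶜ) (by simpa using he),
          add_zero]
        by_cases hA0 : e ∈ A 0
        · rw [Set.indicator_of_mem (by exact ⟨hA0, he⟩), hc,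
            ← ih (fun i => A (i + 1)) (fun i => hA _) (sub_nonneg.2 he.le)]
          refine lintegral_congr fun ω => congrArg _ ?_
          ext ω'
          simp only [Set.mem_ofPred_eq]
          refine ⟨fun h i hi => ?_, fun h i hi => ?_⟩
          · simpa [stitch, he] using h (i + 1) (Nat.succ_lt_succ hi)
          · cases i with
            | zero => simpa [stitch, he] using hA0
            | succ i => simpa [stitch, he] using h i (Nat.lt_of_succ_lt_succ hi)
        · rw [Set.indicator_of_notMem (by exact fun h => hA0 h.1)]
          refine (lintegral_congr fun ω => ?_).trans lintegral_zero
          convert measure_empty (μ := driveLaw p)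
          refine Set.eq_empty_of_forall_notMem fun ω' h => hA0 ?_
          simpa [stitch, he] using h 0 n.succ_pos
      · rw [Set.indicator_of_notMem (s := A 0 ∩ _) (by exact fun h => he h.2), zero_add,
          Set.indicator_of_mem (by exact he)]
        have : ∀ ω : ℕ → ℝ × Fin p × ℝ,
            driveLaw p {ω' | ∀ i < n + 1, stitch i t (consSeq e ω) ω' ∈ A i} =
              stepLaw p {e | (t + e.1, e.2) ∈ A 0} * c := by
          intro ω
          have := infinitePi_box (stepLaw p) (n + 1)
            (fun i => if i = 0 then {e | (t + e.1, e.2) ∈ A 0} else A i)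
            (fun i => by split_ifs; exacts [hshift (hA 0), hA i])
          rw [Finset.prod_range_succ'] at this
          simp only [Nat.add_eq_zero_iff, one_ne_zero, and_false, ite_false, ite_true] at this
          rw [mul_comm, hc, ← this]
          unfold driveLaw
          congr 1
          ext ω'
          simp only [Set.mem_ofPred_eq]
          refine forall_congr' fun i => imp_congr_right fun hi => ?_
          cases i <;> simp [stitch, he]
        rw [lintegral_congr this]; simp
    unfold driveLaw at hmeas key ⊢
    rw [lintegral_infinitePi_split _ hmeas]
    rw [lintegral_congr key, lintegral_add_left (measurable_const.indicator ((hA 0).inter hlt)),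
      lintegral_indicator ((hA 0).inter hlt), lintegral_indicator hlt.compl,
      lintegral_const, lintegral_const, Finset.prod_range_succ']
    simp only [Measure.restrict_apply MeasurableSet.univ, Set.univ_inter]
    have hge : {e : ℝ × Fin p × ℝ | e.1 < t}ᶜ = {e | t ≤ e.1} := by
      ext e; simp
    -- The probability e^{-pt} of no round ending before `t`, times the mass of the shifted side, is
    -- the mass of the part of `A 0` with holding time at least `t`. Together with the part below
    -- `t` it gives all of `A 0`.
    have h1 := stepLaw_inter_le ht (hA 0)
    have h2 := stepLaw_inter_le (p := p) ht MeasurableSet.univ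
    simp only [Set.univ_inter, Set.mem_univ, Set.ofPred_true, measure_univ, mul_one] at h2
    rw [hge, h2, mul_comm (_ * c), ← mul_assoc, ← h1, ← hc, mul_comm c, ← add_mul, mul_comm c,
      ← measure_inter_add_sdiff (A 0) hlt]
    congr 3
    ext e; simp

/-- **Restart.** Following one driving sequence up to a fixed time and an independent copy
afterwards gives the same law. -/
theorem map_stitch [NeZero p] {t : ℝ} (ht : 0 ≤ t) :
    ((driveLaw p).prod (driveLaw p)).map (fun x n => stitch n t x.1 x.2) = driveLaw p := by
  refine eq_infinitePi_of_box _ _ fun n A hA => ?_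
  have hm : Measurable fun x : (ℕ → ℝ × Fin p × ℝ) × (ℕ → ℝ × Fin p × ℝ) =>
    fun n => stitch n t x.1 x.2 := by fun_prop
  have hb := measurableSet_box (E := ℝ × Fin p × ℝ) (fun i => measurable_pi_apply i) n A hA
  rw [Measure.map_apply hm hb, Measure.prod_apply (hm hb)]
  exact lintegral_stitch_box n A hA ht

theorem lintegral_stitch [NeZero p] {t : ℝ} (ht : 0 ≤ t) {F : (ℕ → ℝ × Fin p × ℝ) → ℝ≥0∞}
    (hF : Measurable F) :
    ∫⁻ ω, F ω ∂driveLaw p =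
      ∫⁻ ω, ∫⁻ ω', F (fun n => stitch n t ω ω') ∂driveLaw p ∂driveLaw p := by
  conv_lhs => rw [← map_stitch ht]
  rw [lintegral_map hF (by fun_prop), lintegral_prod _ (by fun_prop)]

/-! ### Resampling the noise of one round. -/

/-- The driving sequence with the noise of one round replaced. -/
def renoise (k : ℕ) (ω : ℕ → ℝ × Fin p × ℝ) (z : ℝ) : ℕ → ℝ × Fin p × ℝ :=
  fun n => if n = k then ((ω n).1, (ω n).2.1, z) else ω n

@[fun_prop] theorem measurable_renoise (k : ℕ) :
    Measurable fun x : (ℕ → ℝ × Fin p × ℝ) × ℝ => renoise k x.1 x.2 := by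
  refine measurable_pi_lambda _ fun n => ?_
  unfold renoise
  split_ifs <;> fun_prop

theorem lintegral_stepLaw_renoise [NeZero p] {A : Set (ℝ × Fin p × ℝ)} (hA : MeasurableSet A) :
    ∫⁻ z, stepLaw p {e | (e.1, e.2.1, z) ∈ A} ∂gaussianReal 0 1 = stepLaw p A := by
  have hm : Measurable fun x : ℝ × ℝ × Fin p × ℝ => (x.2.1, x.2.2.1, x.1) := by fun_prop
  have hm2 : Measurable fun x : (ℝ × Fin p × ℝ) × ℝ => (x.1.1, x.1.2.1, x.2) := by fun_prop
  have : ∀ z, MeasurableSet {e : ℝ × Fin p × ℝ | (e.1, e.2.1, z) ∈ A} := fun z =>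
    (hm.comp (measurable_prodMk_left (x := z))) hA
  have h1 := lintegral_lintegral_swap (μ := gaussianReal 0 1) (ν := stepLaw p)
    (f := fun z e => A.indicator 1 (e.1, e.2.1, z))
    (((measurable_one.indicator hA).comp hm).aemeasurable)
  have h2 : ∀ z, stepLaw p {e | (e.1, e.2.1, z) ∈ A} =
      ∫⁻ e, A.indicator 1 (e.1, e.2.1, z) ∂stepLaw p := fun z => by
    rw [← lintegral_indicator_one (this z)]; rfl
  rw [lintegral_congr h2, h1, ← lintegral_indicator_one hA]
  have hind : Measurable (A.indicator (1 : ℝ × Fin p × ℝ → ℝ≥0∞)) := measurable_one.indicator hA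
  unfold stepLaw
  have hm3 : Measurable fun e : ℝ × Fin p × ℝ =>
      ∫⁻ z, A.indicator (1 : ℝ × Fin p × ℝ → ℝ≥0∞) (e.1, e.2.1, z) ∂gaussianReal 0 1 :=
    Measurable.lintegral_prod_right' (hind.comp hm2)
  rw [lintegral_prod _ hm3.aemeasurable, lintegral_prod _ hind.aemeasurable]
  refine lintegral_congr fun h => ?_
  have e1 := lintegral_prod (μ := uniformOn (Set.univ : Set (Fin p))) (ν := gaussianReal 0 1)
    (fun y => ∫⁻ z, A.indicator (1 : ℝ × Fin p × ℝ → ℝ≥0∞) (h, y.1, z) ∂gaussianReal 0 1)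
    (hm3.comp measurable_prodMk_left).aemeasurable
  have e2 := lintegral_prod (μ := uniformOn (Set.univ : Set (Fin p))) (ν := gaussianReal 0 1)
    (fun y => A.indicator (1 : ℝ × Fin p × ℝ → ℝ≥0∞) (h, y))
    (hind.comp measurable_prodMk_left).aemeasurable
  refine e1.trans (Eq.trans ?_ e2.symm)
  simp

/-- On a box only side `k` is affected, and averaging it over a fresh noise restores its mass by
Fubini. -/
theorem map_renoise [NeZero p] (k : ℕ) :
    ((driveLaw p).prod (gaussianReal 0 1)).map (fun x => renoise k x.1 x.2) = driveLaw p := by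
  refine eq_infinitePi_of_box _ _ fun n A hA => ?_
  have hb := measurableSet_box (E := ℝ × Fin p × ℝ) (fun i => measurable_pi_apply i) n A hA
  rw [Measure.map_apply (measurable_renoise k) hb,
    Measure.prod_apply_symm (measurable_renoise k hb)]
  have hz : ∀ z : ℝ, Measurable fun e : ℝ × Fin p × ℝ => (e.1, e.2.1, z) := fun z => by fun_prop
  have : ∀ z, driveLaw p ((fun x => (x, z)) ⁻¹' ((fun x : (ℕ → ℝ × Fin p × ℝ) × ℝ =>
      renoise k x.1 x.2) ⁻¹' {ω | ∀ i < n, ω i ∈ A i})) =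
      ∏ i ∈ Finset.range n, stepLaw p (if i = k then {e | (e.1, e.2.1, z) ∈ A k} else A i) := by
    intro z
    unfold driveLaw
    rw [← infinitePi_box (stepLaw p) n _
      fun i => by split_ifs; exacts [hz z (hA k), hA i]]
    congr 1
    ext ω
    simp only [Set.mem_preimage, Set.mem_ofPred_eq, renoise]
    refine forall_congr' fun i => imp_congr_right fun _ => ?_
    by_cases h : i = k <;> simp [h]
  rw [lintegral_congr this]
  by_cases hk : k ∈ Finset.range n
  · rw [← Finset.mul_prod_erase _ _ hk]
    have h3 : ∀ z : ℝ, (∏ i ∈ Finset.range n,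
        stepLaw p (if i = k then {e | (e.1, e.2.1, z) ∈ A k} else A i)) =
        stepLaw p {e | (e.1, e.2.1, z) ∈ A k} *
          ∏ i ∈ (Finset.range n).erase k, stepLaw p (A i) := fun z => by
      rw [← Finset.mul_prod_erase _ _ hk, if_pos rfl]
      congr 1
      exact Finset.prod_congr rfl fun i hi => by rw [if_neg (Finset.ne_of_mem_erase hi)]
    rw [lintegral_congr h3, lintegral_mul_const', lintegral_stepLaw_renoise (hA k)]
    exact ENNReal.prod_ne_top fun i _ => measure_ne_top _ _
  · have h3 : ∀ z : ℝ, (∏ i ∈ Finset.range n,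
        stepLaw p (if i = k then {e | (e.1, e.2.1, z) ∈ A k} else A i)) =
        ∏ i ∈ Finset.range n, stepLaw p (A i) := fun z =>
      Finset.prod_congr rfl fun i hi => by rw [if_neg (by rintro rfl; exact hk hi)]
    rw [lintegral_congr h3]
    simp

/-- **Resampling.** Replacing the noise of a round, whose index does not depend on that noise, by an
independent copy preserves the law of the driving sequence. -/
theorem lintegral_renoise [NeZero p] {κ : (ℕ → ℝ × Fin p × ℝ) → ℕ} (hκ : Measurable κ)
    (hinv : ∀ ω k z, κ (renoise k ω z) = κ ω) {F : (ℕ → ℝ × Fin p × ℝ) → ℝ≥0∞}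
    (hF : Measurable F) :
    ∫⁻ ω, F ω ∂driveLaw p =
      ∫⁻ ω, ∫⁻ z, F (renoise (κ ω) ω z) ∂gaussianReal 0 1 ∂driveLaw p := by
  have hs : ∀ k, MeasurableSet (κ ⁻¹' {k}) := fun k => hκ (measurableSet_singleton k)
  have hdisj : Pairwise (Function.onFun Disjoint fun k => κ ⁻¹' {k}) := fun i j hij =>
    Disjoint.preimage _ (by simpa using hij)
  have hU : ⋃ k, κ ⁻¹' {k} = Set.univ := by ext; simp
  -- Partition by the value of `κ`. On each piece the index is fixed, and the piece itself is
  -- unchanged by the replacement because `κ` ignores it.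
  have split : ∀ g : (ℕ → ℝ × Fin p × ℝ) → ℝ≥0∞, ∫⁻ ω, g ω ∂driveLaw p =
      ∑' k, ∫⁻ ω in κ ⁻¹' {k}, g ω ∂driveLaw p := fun g => by
    rw [← lintegral_iUnion hs hdisj, hU, Measure.restrict_univ]
  rw [split, split]
  refine tsum_congr fun k => ?_
  rw [← lintegral_indicator (hs k), ← lintegral_indicator (hs k)]
  conv_lhs => rw [← map_renoise k]
  rw [lintegral_map (hF.indicator (hs k)) (measurable_renoise k),
    lintegral_prod (fun x => (κ ⁻¹' {k}).indicator F (renoise k x.1 x.2))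
      ((hF.indicator (hs k)).comp (measurable_renoise k)).aemeasurable]
  refine lintegral_congr fun ω => ?_
  by_cases h : κ ω = k
  · rw [Set.indicator_of_mem (by exact h), h]
    exact lintegral_congr fun z => Set.indicator_of_mem (by simpa [hinv] using h) _
  · rw [Set.indicator_of_notMem (by exact h)]
    refine (lintegral_congr fun z => ?_).trans lintegral_zero
    exact Set.indicator_of_notMem (by simpa [hinv] using h) _

end

section

variable {p : ℕ}

/-! ### Arrival times and numbers of updates -/

/-- The time of the `n`-th update. -/
noncomputable def arr (ω : ℕ → ℝ × Fin p × ℝ) (n : ℕ) : ℝ := ∑ i ∈ Finset.range n, (ω i).1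

/-- The number of updates strictly before time `t`. -/
noncomputable def cnt (t : ℝ) (ω : ℕ → ℝ × Fin p × ℝ) : ℕ := sInf {n | t ≤ arr ω (n + 1)}

/-- Positive holding times with infinite sum. -/
def Regular (ω : ℕ → ℝ × Fin p × ℝ) : Prop :=
  (∀ n, 0 < (ω n).1) ∧ ∀ t : ℝ, ∃ n, t ≤ arr ω n

@[simp] theorem arr_zero (ω : ℕ → ℝ × Fin p × ℝ) : arr ω 0 = 0 := by simp [arr]

theorem arr_succ (ω : ℕ → ℝ × Fin p × ℝ) (n : ℕ) : arr ω (n + 1) = arr ω n + (ω n).1 :=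
  Finset.sum_range_succ _ _

theorem arr_succ_tailSeq (ω : ℕ → ℝ × Fin p × ℝ) (n : ℕ) :
    arr ω (n + 1) = (ω 0).1 + arr (tailSeq ω) n := by
  simp [arr, Finset.sum_range_succ', add_comm]

@[fun_prop] theorem measurable_arr (n : ℕ) :
    Measurable fun ω : ℕ → ℝ × Fin p × ℝ => arr ω n := by
  unfold arr; fun_prop

theorem Regular.strictMono_arr {ω : ℕ → ℝ × Fin p × ℝ} (h : Regular ω) : StrictMono (arr ω) :=
  strictMono_nat_of_lt_succ fun n => by rw [arr_succ]; linarith [h.1 n]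

/-- The working characterization of `cnt`. Regularity makes the set under the infimum nonempty;
without it the infimum could be the default value 0. -/
theorem Regular.lt_cnt_iff {ω : ℕ → ℝ × Fin p × ℝ} (h : Regular ω) {t : ℝ} {n : ℕ} :
    n < cnt t ω ↔ arr ω (n + 1) < t := by
  have hne : {n | t ≤ arr ω (n + 1)}.Nonempty := by
    obtain ⟨m, hm⟩ := h.2 t
    exact ⟨m, hm.trans (h.strictMono_arr m.lt_succ_self).le⟩
  refine ⟨fun hn => not_le.1 fun hle => (Nat.sInf_le hle).not_gt hn, fun hn => ?_⟩
  by_contra hle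
  have h1 : t ≤ arr ω (cnt t ω + 1) := Nat.sInf_mem hne
  exact absurd hn (not_lt.2 (h1.trans (h.strictMono_arr.monotone (by omega))))

theorem Regular.cnt_mono {ω : ℕ → ℝ × Fin p × ℝ} (h : Regular ω) {a c : ℝ} (hac : a ≤ c) :
    cnt a ω ≤ cnt c ω :=
  le_of_forall_lt fun _ hn => h.lt_cnt_iff.2 ((h.lt_cnt_iff.1 hn).trans_le hac)

theorem Regular.tailSeq {ω : ℕ → ℝ × Fin p × ℝ} (h : Regular ω) : Regular (tailSeq ω) := by
  refine ⟨fun n => h.1 _, fun t => ?_⟩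
  obtain ⟨n, hn⟩ := h.2 ((ω 0).1 + t)
  refine ⟨n, ?_⟩
  have := h.strictMono_arr n.lt_succ_self
  rw [arr_succ_tailSeq] at this
  linarith

theorem Regular.cnt_eq_zero {ω : ℕ → ℝ × Fin p × ℝ} (h : Regular ω) {t : ℝ} (ht : t ≤ (ω 0).1) :
    cnt t ω = 0 :=
  Nat.eq_zero_of_not_pos fun hc => by
    have := h.lt_cnt_iff.1 hc
    rw [arr_succ, arr_zero, zero_add] at this
    linarith

theorem Regular.cnt_eq_succ {ω : ℕ → ℝ × Fin p × ℝ} (h : Regular ω) {t : ℝ} (ht : (ω 0).1 < t) :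
    cnt t ω = cnt (t - (ω 0).1) (GaussGlauber.tailSeq ω) + 1 := by
  refine eq_of_forall_lt_iff fun n => ?_
  rw [h.lt_cnt_iff, arr_succ_tailSeq]
  cases n with
  | zero => simpa using ht
  | succ n =>
    rw [Nat.succ_lt_succ_iff, h.tailSeq.lt_cnt_iff]
    constructor <;> intro <;> linarith

theorem Regular.arr_cnt_le {ω : ℕ → ℝ × Fin p × ℝ} (h : Regular ω) {t : ℝ} (ht : 0 ≤ t) :
    arr ω (cnt t ω) ≤ t := by
  rcases Nat.eq_zero_or_pos (cnt t ω) with h0 | h0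
  · rw [h0, arr_zero]; exact ht
  · have := h.lt_cnt_iff.1 (Nat.sub_lt h0 one_pos)
    rw [show cnt t ω - 1 + 1 = cnt t ω by omega] at this
    exact this.le

theorem measurable_cnt (t : ℝ) : Measurable fun ω : ℕ → ℝ × Fin p × ℝ => cnt t ω := by
  refine measurable_to_countable' fun n => ?_
  have hE : ∀ m, MeasurableSet {ω : ℕ → ℝ × Fin p × ℝ | t ≤ arr ω (m + 1)} := fun m =>
    measurableSet_le (by fun_prop) (by fun_prop)
  -- The second alternative is the default: the infimum of the empty set is 0.
  have : (fun ω : ℕ → ℝ × Fin p × ℝ => cnt t ω) ⁻¹' {n} =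
      ({ω | t ≤ arr ω (n + 1)} ∩ ⋂ m, ⋂ (_ : m < n), {ω | t ≤ arr ω (m + 1)}ᶜ) ∪
      ({ω | n = 0} ∩ ⋂ m, {ω | t ≤ arr ω (m + 1)}ᶜ) := by
    ext ω
    simp only [Set.mem_preimage, Set.mem_singleton_iff, cnt, Set.mem_union, Set.mem_inter_iff,
      Set.mem_iInter, Set.mem_compl_iff, Set.mem_ofPred_eq]
    constructor
    · rintro rfl
      by_cases hne : {n | t ≤ arr ω (n + 1)}.Nonempty
      · exact Or.inl ⟨Nat.sInf_mem hne, fun m hm => Nat.notMem_of_lt_sInf hm⟩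
      · rw [Set.not_nonempty_iff_eq_empty] at hne
        refine Or.inr ⟨by rw [hne, Nat.sInf_empty], fun m hm => ?_⟩
        have : m ∈ {n | t ≤ arr ω (n + 1)} := hm
        rw [hne] at this
        exact this
    · rintro (⟨h1, h2⟩ | ⟨h0, h2⟩)
      · refine le_antisymm (Nat.sInf_le h1) (not_lt.1 fun hlt => ?_)
        exact h2 _ hlt (Nat.sInf_mem (s := {n | t ≤ arr ω (n + 1)}) ⟨n, h1⟩)
      · have : {n | t ≤ arr ω (n + 1)} = ∅ := Set.eq_empty_of_forall_notMem h2
        rw [this, Nat.sInf_empty, h0]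
  rw [this]
  exact ((hE n).inter (MeasurableSet.iInter fun m => MeasurableSet.iInter fun _ =>
    (hE m).compl)).union ((MeasurableSet.const _).inter (MeasurableSet.iInter fun m => (hE m).compl))

/-! ### Regularity of the driving sequence -/

/-- The exponential density of rate `r` times e^{-rx} is half the density of rate 2r. -/
theorem lintegral_expMeasure_exp {r : ℝ} (hr : 0 < r) :
    ∫⁻ x, ENNReal.ofReal (Real.exp (-(r * x))) ∂expMeasure r = 2⁻¹ := by
  have hd : expMeasure r = volume.withDensity (exponentialPDF r) := rfl
  have hm : Measurable (exponentialPDF r) := (measurable_exponentialPDFReal r).ennreal_ofReal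
  have hm2 : Measurable (exponentialPDF (2 * r)) :=
    (measurable_exponentialPDFReal _).ennreal_ofReal
  rw [hd, lintegral_withDensity_eq_lintegral_mul _ hm (by fun_prop)]
  have : ∀ x, (exponentialPDF r * fun x => ENNReal.ofReal (Real.exp (-(r * x)))) x =
      2⁻¹ * exponentialPDF (2 * r) x := by
    intro x
    rw [Pi.mul_apply]
    by_cases hx : 0 ≤ x
    · rw [exponentialPDF_of_nonneg hx, exponentialPDF_of_nonneg hx, ← ENNReal.ofReal_mul
        (by positivity), show (2⁻¹ : ℝ≥0∞) = ENNReal.ofReal 2⁻¹ by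
          rw [ENNReal.ofReal_inv_of_pos two_pos]; simp, ← ENNReal.ofReal_mul (by positivity)]
      congr 1
      rw [show -(2 * r * x) = -(r * x) + -(r * x) by ring, Real.exp_add]
      ring
    · rw [exponentialPDF_of_neg (not_le.1 hx), exponentialPDF_of_neg (not_le.1 hx)]
      simp
  rw [lintegral_congr this, lintegral_const_mul _ hm2, lintegral_exponentialPDF_eq_one (by linarith),
    mul_one]

theorem lintegral_stepLaw_fst [NeZero p] {f : ℝ → ℝ≥0∞} (hf : Measurable f) :
    ∫⁻ e, f e.1 ∂stepLaw p = ∫⁻ x, f x ∂expMeasure (p : ℝ) := by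
  unfold stepLaw
  rw [lintegral_prod _ (by fun_prop)]
  simp

theorem lintegral_exp_arr [NeZero p] (n : ℕ) :
    ∫⁻ ω, ENNReal.ofReal (Real.exp (-(p * arr ω n))) ∂driveLaw p = 2⁻¹ ^ n := by
  have hp : (0 : ℝ) < p := Nat.cast_pos.2 (NeZero.pos p)
  induction n with
  | zero => simp
  | succ n ih =>
    unfold driveLaw at ih ⊢
    rw [lintegral_infinitePi_split _ (by fun_prop)]
    have : ∀ (e : ℝ × Fin p × ℝ) ω, ENNReal.ofReal (Real.exp (-(p * arr (consSeq e ω) (n + 1)))) =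
        ENNReal.ofReal (Real.exp (-(p * e.1))) * ENNReal.ofReal (Real.exp (-(p * arr ω n))) := by
      intro e ω
      rw [← ENNReal.ofReal_mul (Real.exp_nonneg _), ← Real.exp_add, arr_succ_tailSeq]
      congr 2
      simp; ring
    simp only [this]
    simp_rw [lintegral_const_mul' _ _ ENNReal.ofReal_ne_top, ih]
    rw [lintegral_mul_const' _ _ (by simp), lintegral_stepLaw_fst
      (f := fun x => ENNReal.ofReal (Real.exp (-(p * x)))) (by fun_prop),
      lintegral_expMeasure_exp hp, pow_succ, mul_comm]

/-- Markov's inequality for e^{-p·arr}, whose mean is 2^{-n} by independence. It excludes explosion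
here and later bounds the number of rounds up to the final time. -/
theorem driveLaw_arr_le [NeZero p] (n : ℕ) (t : ℝ) :
    driveLaw p {ω | arr ω n ≤ t} ≤ ENNReal.ofReal (Real.exp (p * t)) * 2⁻¹ ^ n := by
  have h := mul_meas_ge_le_lintegral (μ := driveLaw p)
    (f := fun ω => ENNReal.ofReal (Real.exp (-(p * arr ω n)))) (by fun_prop)
    (ENNReal.ofReal (Real.exp (-(p * t))))
  rw [lintegral_exp_arr] at h
  have hsub : {ω : ℕ → ℝ × Fin p × ℝ | arr ω n ≤ t} ⊆ {ω |
      ENNReal.ofReal (Real.exp (-(p * t))) ≤ ENNReal.ofReal (Real.exp (-(p * arr ω n)))} := by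
    intro ω hω
    refine ENNReal.ofReal_le_ofReal (Real.exp_le_exp.2 (neg_le_neg ?_))
    exact mul_le_mul_of_nonneg_left hω (Nat.cast_nonneg _)
  calc driveLaw p {ω | arr ω n ≤ t}
      = ENNReal.ofReal (Real.exp (p * t)) * (ENNReal.ofReal (Real.exp (-(p * t))) *
          driveLaw p {ω | arr ω n ≤ t}) := by
        rw [← mul_assoc, ← ENNReal.ofReal_mul (Real.exp_nonneg _), ← Real.exp_add]
        simp
    _ ≤ _ := by
        gcongr
        exact (mul_le_mul_right (measure_mono hsub) _).trans h

theorem ae_regular [NeZero p] : ∀ᵐ ω ∂driveLaw p, Regular ω := by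
  have hpos : ∀ᵐ ω ∂driveLaw p, ∀ n, 0 < (ω n).1 := by
    rw [ae_all_iff]
    intro n
    have h0 : ∀ᵐ e ∂stepLaw p, 0 < e.1 := by
      have h := lintegral_stepLaw_fst (p := p) (f := (Set.Iic (0 : ℝ)).indicator 1)
        (measurable_one.indicator measurableSet_Iic)
      have h2 : ∫⁻ x, (Set.Iic (0 : ℝ)).indicator 1 x ∂expMeasure (p : ℝ) = 0 := by
        rw [lintegral_indicator_one measurableSet_Iic]
        have hd : expMeasure (p : ℝ) = volume.withDensity (exponentialPDF p) := rfl
        rw [hd, withDensity_apply _ measurableSet_Iic,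
          setLIntegral_congr (Iio_ae_eq_Iic (a := (0 : ℝ))).symm]
        exact lintegral_exponentialPDF_of_nonpos le_rfl
      have hm : Measurable fun e : ℝ × Fin p × ℝ => (Set.Iic (0 : ℝ)).indicator (1 : ℝ → ℝ≥0∞) e.1 :=
        (measurable_one.indicator measurableSet_Iic).comp measurable_fst
      rw [h2, lintegral_eq_zero_iff hm] at h
      filter_upwards [h] with e he
      by_contra hc
      simp [Set.indicator_of_mem (show e.1 ∈ Set.Iic (0 : ℝ) from not_lt.1 hc)] at he
    exact (measurePreserving_eval_infinitePi (fun _ : ℕ => stepLaw p) n).quasiMeasurePreserving.ae h0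
  have hex : ∀ᵐ ω ∂driveLaw p, ∀ T : ℕ, ∃ n, (T : ℝ) ≤ arr ω n := by
    rw [ae_all_iff]
    intro T
    have hz : driveLaw p {ω | ∀ n, arr ω n ≤ (T : ℝ)} = 0 := by
      have hlim : Filter.Tendsto (fun n : ℕ => ENNReal.ofReal (Real.exp (p * T)) * 2⁻¹ ^ n)
          Filter.atTop (nhds (ENNReal.ofReal (Real.exp (p * T)) * 0)) :=
        ENNReal.Tendsto.const_mul (ENNReal.tendsto_pow_atTop_nhds_zero_of_lt_one (by simp))
          (Or.inr ENNReal.ofReal_ne_top)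
      rw [mul_zero] at hlim
      refine le_antisymm (ge_of_tendsto' hlim fun n => ?_) zero_le
      exact (measure_mono fun ω (hω : ∀ n, arr ω n ≤ (T : ℝ)) => hω n).trans (driveLaw_arr_le n _)
    rw [ae_iff]
    refine measure_mono_null (fun ω hω => ?_) hz
    simp only [Set.mem_ofPred_eq, not_exists, not_le] at hω ⊢
    exact fun n => (hω n).le
  filter_upwards [hpos, hex] with ω h1 h2
  refine ⟨h1, fun t => ?_⟩
  obtain ⟨T, hT⟩ := exists_nat_ge t
  obtain ⟨n, hn⟩ := h2 T
  exact ⟨n, hT.trans hn⟩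

end

section

variable {p : ℕ}

/-! ### Restarting the clock -/

/-- The recursion solved in terms of `cnt`; the properties of stitched paths are read off from this
form. -/
theorem Regular.stitch_apply {ω : ℕ → ℝ × Fin p × ℝ} (h : Regular ω) (ω' : ℕ → ℝ × Fin p × ℝ)
    (n : ℕ) (t : ℝ) :
    stitch n t ω ω' = if n < cnt t ω then ω n else
      if n = cnt t ω then (t - arr ω n + (ω' 0).1, (ω' 0).2) else ω' (n - cnt t ω) := by
  induction n generalizing t ω with
  | zero =>
    rw [stitch]
    by_cases ht : (ω 0).1 < t
    · simp [ht, h.cnt_eq_succ ht]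
    · simp [ht, h.cnt_eq_zero (not_lt.1 ht)]
  | succ n ih =>
    rw [stitch]
    by_cases ht : (ω 0).1 < t
    · rw [if_pos ht, ih h.tailSeq, h.cnt_eq_succ ht]
      simp only [tailSeq_apply, Nat.succ_lt_succ_iff, Nat.add_right_cancel_iff,
        Nat.add_sub_add_right]
      rw [arr_succ_tailSeq]
      simp only [sub_sub]
    · simp [ht, h.cnt_eq_zero (not_lt.1 ht)]

section Stitch

variable {ω ω' : ℕ → ℝ × Fin p × ℝ}

theorem stitch_of_lt (h : Regular ω) {t : ℝ} {n : ℕ} (hn : n < cnt t ω) :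
    stitch n t ω ω' = ω n := by
  rw [h.stitch_apply, if_pos hn]

theorem stitch_cnt_add_snd (h : Regular ω) (t : ℝ) (n : ℕ) :
    (stitch (cnt t ω + n) t ω ω').2 = (ω' n).2 := by
  rw [h.stitch_apply]
  cases n <;> simp

theorem arr_stitch_of_le (h : Regular ω) {t : ℝ} {n : ℕ} (hn : n ≤ cnt t ω) :
    arr (fun m => stitch m t ω ω') n = arr ω n :=
  Finset.sum_congr rfl fun _ hi =>
    congrArg Prod.fst (stitch_of_lt h ((Finset.mem_range.1 hi).trans_le hn))

theorem arr_stitch_add (h : Regular ω) (t : ℝ) (n : ℕ) :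
    arr (fun m => stitch m t ω ω') (cnt t ω + n + 1) = t + arr ω' (n + 1) := by
  induction n with
  | zero =>
    rw [add_zero, arr_succ, arr_stitch_of_le h le_rfl, h.stitch_apply]
    simp [arr_succ]
    ring
  | succ n ih =>
    rw [← add_assoc, arr_succ, ih, arr_succ ω' (n + 1), h.stitch_apply, add_assoc (cnt t ω)]
    simp [add_assoc]

theorem regular_stitch (h : Regular ω) (h' : Regular ω') {t : ℝ} (ht : 0 ≤ t) :
    Regular fun n => stitch n t ω ω' := by
  refine ⟨fun n => ?_, fun s => ?_⟩
  · simp only [h.stitch_apply]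
    split_ifs with h1 h2
    · exact h.1 n
    · have h3 := h.arr_cnt_le ht
      have h4 := h'.1 0
      rw [h2]
      simp only
      linarith
    · exact h'.1 _
  · obtain ⟨n, hn⟩ := h'.2 (s - t)
    refine ⟨cnt t ω + n + 1, ?_⟩
    rw [arr_stitch_add h]
    have := h'.strictMono_arr n.lt_succ_self
    linarith

/-- With `cnt_stitch_of_le` this transfers what happens after `t` to `ω'` and what happens before
`t` to `ω`. -/
theorem cnt_add_stitch (h : Regular ω) (h' : Regular ω') {t s : ℝ} (ht : 0 ≤ t) (hs : 0 ≤ s) :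
    cnt (t + s) (fun n => stitch n t ω ω') = cnt t ω + cnt s ω' := by
  refine eq_of_forall_lt_iff fun n => ?_
  rw [(regular_stitch h h' ht).lt_cnt_iff]
  rcases lt_or_ge n (cnt t ω) with hn | hn
  · rw [arr_stitch_of_le h hn]
    have := h.lt_cnt_iff.1 hn
    exact iff_of_true (by linarith) (by omega)
  · obtain ⟨m, rfl⟩ := Nat.exists_eq_add_of_le hn
    rw [arr_stitch_add h, Nat.add_lt_add_iff_left, h'.lt_cnt_iff]
    constructor <;> intro <;> linarith

theorem cnt_stitch_of_le (h : Regular ω) (h' : Regular ω') {t s : ℝ} (ht : 0 ≤ t) (hs : s ≤ t) :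
    cnt s (fun n => stitch n t ω ω') = cnt s ω := by
  refine eq_of_forall_lt_iff fun n => ?_
  rw [(regular_stitch h h' ht).lt_cnt_iff, h.lt_cnt_iff]
  rcases lt_or_ge n (cnt t ω) with hn | hn
  · rw [arr_stitch_of_le h hn]
  · have h2 := fun h3 => (Nat.not_lt.2 hn) (h.lt_cnt_iff.2 h3)
    obtain ⟨m, rfl⟩ := Nat.exists_eq_add_of_le hn
    rw [arr_stitch_add h]
    have h3 : 0 ≤ arr ω' (m + 1) := by
      rw [← arr_zero ω']; exact h'.strictMono_arr.monotone (Nat.zero_le _)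
    refine iff_of_false (by linarith) (fun h4 => h2 (by linarith))

end Stitch

/-! ### Nodes updated in a time interval -/

/-- Weights `g` multiplied over the nodes updated before `t`, when `n` nodes are updated. -/
noncomputable def weight (g : Fin p → ℝ) : ℕ → ℝ → (ℕ → ℝ × Fin p × ℝ) → ℝ≥0∞
  | 0, t, ω => if t ≤ (ω 0).1 then 1 else 0
  | n + 1, t, ω => if (ω 0).1 < t then
      ENNReal.ofReal (g (ω 0).2.1) * weight g n (t - (ω 0).1) (tailSeq ω) else 0

theorem measurable_weight (g : Fin p → ℝ) (n : ℕ) :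
    Measurable fun x : ℝ × (ℕ → ℝ × Fin p × ℝ) => weight g n x.1 x.2 := by
  have hg : Measurable fun i => ENNReal.ofReal (g i) := measurable_of_finite _
  induction n with
  | zero =>
    exact Measurable.ite (measurableSet_le (by fun_prop) (by fun_prop)) measurable_const
      measurable_const
  | succ n ih =>
    refine Measurable.ite (measurableSet_lt (by fun_prop) (by fun_prop)) (Measurable.mul ?_ ?_)
      measurable_const
    · exact hg.comp (by fun_prop)
    · exact ih.comp (f := fun x : ℝ × (ℕ → ℝ × Fin p × ℝ) => (x.1 - (x.2 0).1, tailSeq x.2))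
        (by fun_prop)

/-- The two exponentials multiply to the constant e^{-rt}, so only the integral of (t - x)^n over
[0, t] remains: the passage from one Poisson term to the next. -/
theorem lintegral_expMeasure_weight {r G t : ℝ} (hr : 0 < r) (hG : 0 ≤ G) (ht : 0 ≤ t) (n : ℕ) :
    ∫⁻ x, (Set.Iio t).indicator (fun x => ENNReal.ofReal
      (Real.exp (-(r * (t - x))) * ((G * (t - x)) ^ n / n.factorial))) x ∂expMeasure r =
      ENNReal.ofReal (r * (Real.exp (-(r * t)) * (G ^ n * t ^ (n + 1) / (n + 1).factorial))) := by
  have hd : expMeasure r = volume.withDensity (exponentialPDF r) := rfl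
  have hm : Measurable (exponentialPDF r) := (measurable_exponentialPDFReal r).ennreal_ofReal
  rw [hd, lintegral_withDensity_eq_lintegral_mul _ hm
    ((by fun_prop : Measurable _).indicator measurableSet_Iio)]
  have h1 : ∀ x, (exponentialPDF r * (Set.Iio t).indicator (fun x => ENNReal.ofReal
      (Real.exp (-(r * (t - x))) * ((G * (t - x)) ^ n / n.factorial)))) x =
      (Set.Ico 0 t).indicator (fun x => ENNReal.ofReal
        (r * Real.exp (-(r * t)) * G ^ n / n.factorial * (t - x) ^ n)) x := by
    intro x
    rw [Pi.mul_apply]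
    by_cases h0 : 0 ≤ x
    · by_cases hx : x < t
      · rw [Set.indicator_of_mem (by exact hx), Set.indicator_of_mem (by exact ⟨h0, hx⟩),
          exponentialPDF_of_nonneg h0, ← ENNReal.ofReal_mul (by positivity)]
        congr 1
        rw [show -(r * t) = -(r * x) + -(r * (t - x)) by ring, Real.exp_add, mul_pow]
        ring
      · rw [Set.indicator_of_notMem (by exact hx),
          Set.indicator_of_notMem (by exact fun h => hx h.2), mul_zero]
    · rw [exponentialPDF_of_neg (not_le.1 h0), zero_mul,
        Set.indicator_of_notMem (by exact fun h => h0 h.1)]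
  rw [lintegral_congr h1, lintegral_indicator measurableSet_Ico,
    setLIntegral_congr Ico_ae_eq_Ioc, ← ofReal_integral_eq_lintegral_ofReal]
  · rw [← intervalIntegral.integral_of_le ht, intervalIntegral.integral_const_mul,
      intervalIntegral.integral_comp_sub_left (fun x => x ^ n) t, integral_pow, Nat.factorial_succ]
    congr 1
    have := n.factorial_ne_zero
    push_cast
    field_simp
    simp
  · exact ((by fun_prop : Continuous _).integrableOn_Icc).mono_set Set.Ioc_subset_Icc_self
  · refine (ae_restrict_iff' measurableSet_Ioc).2 (Filter.Eventually.of_forall fun x hx => ?_)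
    have : 0 ≤ t - x := sub_nonneg.2 hx.2
    dsimp
    positivity

theorem lintegral_uniformOn [NeZero p] (f : Fin p → ℝ) (hf : ∀ i, 0 ≤ f i) :
    ∫⁻ i, ENNReal.ofReal (f i) ∂uniformOn (Set.univ : Set (Fin p)) =
      ENNReal.ofReal ((∑ i, f i) / p) := by
  have hp : (0 : ℝ) < p := Nat.cast_pos.2 (NeZero.pos p)
  rw [lintegral_fintype]
  simp only [uniformOn_univ, Measure.count_singleton, Fintype.card_fin]
  rw [← Finset.sum_mul, ← ENNReal.ofReal_sum_of_nonneg fun i _ => hf i, ENNReal.ofReal_div_of_pos hp,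
    ENNReal.ofReal_natCast, one_div, div_eq_mul_inv]

/-- Induction over the first round: its node contributes the mean weight (∑ g)/p, its time the rate
p, and p cancels. -/
theorem lintegral_weight [NeZero p] {g : Fin p → ℝ} (hg : ∀ i, 0 ≤ g i) (n : ℕ) {t : ℝ}
    (ht : 0 ≤ t) :
    ∫⁻ ω, weight g n t ω ∂driveLaw p =
      ENNReal.ofReal (Real.exp (-(p * t)) * (((∑ i, g i) * t) ^ n / n.factorial)) := by
  have hp : (0 : ℝ) < p := Nat.cast_pos.2 (NeZero.pos p)
  have hG : 0 ≤ ∑ i, g i := Finset.sum_nonneg fun i _ => hg i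
  have hmeas : ∀ n t, Measurable (weight (p := p) g n t) := fun n t =>
    (measurable_weight g n).comp measurable_prodMk_left
  induction n generalizing t with
  | zero =>
    have hS : MeasurableSet {e : ℝ × Fin p × ℝ | t ≤ e.1} :=
      measurableSet_le (by fun_prop) (by fun_prop)
    have h := hmeas 0 t
    have h2 := stepLaw_inter_le (p := p) ht MeasurableSet.univ
    simp only [Set.univ_inter, Set.mem_univ, Set.ofPred_true, measure_univ, mul_one] at h2
    unfold driveLaw
    rw [lintegral_infinitePi_split _ h]
    have : ∀ (e : ℝ × Fin p × ℝ) ω, weight g 0 t (consSeq e ω) =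
        {e : ℝ × Fin p × ℝ | t ≤ e.1}.indicator 1 e := by
      intro e ω
      by_cases he : t ≤ e.1 <;> simp [weight, he]
    simp only [this, lintegral_const, measure_univ, mul_one]
    rw [lintegral_indicator_one hS, h2]
    simp
  | succ n ih =>
    have h := hmeas (n + 1) t
    have hg' : Measurable fun i => ENNReal.ofReal (g i) := measurable_of_finite _
    set W : ℝ → ℝ≥0∞ := (Set.Iio t).indicator fun x => ENNReal.ofReal
      (Real.exp (-(p * (t - x))) * (((∑ i, g i) * (t - x)) ^ n / n.factorial)) with hW
    have hWm : Measurable W := (by fun_prop : Measurable _).indicator measurableSet_Iio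
    have key : ∀ e : ℝ × Fin p × ℝ, ∫⁻ ω, weight g (n + 1) t (consSeq e ω) ∂driveLaw p =
        W e.1 * ENNReal.ofReal (g e.2.1) := by
      intro e
      by_cases he : e.1 < t
      · have hw : ∀ ω, weight g (n + 1) t (consSeq e ω) =
            ENNReal.ofReal (g e.2.1) * weight g n (t - e.1) ω := fun ω => if_pos he
        rw [lintegral_congr hw, lintegral_const_mul _ (hmeas n _), ih (sub_nonneg.2 he.le), hW,
          Set.indicator_of_mem (by exact he), mul_comm]
      · simp [weight, he, hW]
    unfold driveLaw at key ⊢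
    rw [lintegral_infinitePi_split _ h, lintegral_congr key]
    unfold stepLaw
    have hmm : Measurable fun e : ℝ × Fin p × ℝ => W e.1 * ENNReal.ofReal (g e.2.1) :=
      (hWm.comp measurable_fst).mul (hg'.comp (by fun_prop))
    rw [lintegral_prod _ hmm.aemeasurable]
    have e1 : ∀ x : ℝ, ∫⁻ y : Fin p × ℝ, W x * ENNReal.ofReal (g y.1)
        ∂(uniformOn Set.univ).prod (gaussianReal 0 1) =
        W x * ENNReal.ofReal ((∑ i, g i) / p) := by
      intro x
      have hgf : Measurable fun y : Fin p × ℝ => ENNReal.ofReal (g y.1) :=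
        hg'.comp measurable_fst
      rw [lintegral_const_mul _ hgf, lintegral_prod _ hgf.aemeasurable]
      simp only [lintegral_const, measure_univ, mul_one, lintegral_uniformOn g hg]
    simp only [e1]
    rw [lintegral_mul_const _ hWm, hW, lintegral_expMeasure_weight hp hG ht,
      ← ENNReal.ofReal_mul (by positivity)]
    congr 1
    field_simp
    ring

theorem Regular.weight_eq {ω : ℕ → ℝ × Fin p × ℝ} (h : Regular ω) (g : Fin p → ℝ) (n : ℕ) (t : ℝ) :
    weight g n t ω = if n = cnt t ω then
      ∏ i ∈ Finset.range n, ENNReal.ofReal (g (ω i).2.1) else 0 := by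
  induction n generalizing t ω with
  | zero =>
    rw [weight]
    by_cases ht : (ω 0).1 < t
    · simp [not_le.2 ht, h.cnt_eq_succ ht]
    · simp [not_lt.1 ht, h.cnt_eq_zero (not_lt.1 ht)]
  | succ n ih =>
    rw [weight]
    by_cases ht : (ω 0).1 < t
    · rw [if_pos ht, ih h.tailSeq, h.cnt_eq_succ ht, Finset.prod_range_succ', mul_comm]
      simp only [Nat.add_right_cancel_iff, tailSeq_apply, ite_mul, zero_mul]
    · simp [ht, h.cnt_eq_zero (not_lt.1 ht)]

/-- The generating function of the marked Poisson process of updates. -/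
theorem lintegral_prod_cnt [NeZero p] {g : Fin p → ℝ} (hg : ∀ i, 0 ≤ g i) {t : ℝ} (ht : 0 ≤ t) :
    ∫⁻ ω, ∏ i ∈ Finset.range (cnt t ω), ENNReal.ofReal (g (ω i).2.1) ∂driveLaw p =
      ENNReal.ofReal (Real.exp (-(p * t) + (∑ i, g i) * t)) := by
  have hG : 0 ≤ ∑ i, g i := Finset.sum_nonneg fun i _ => hg i
  have h1 : ∫⁻ ω, ∏ i ∈ Finset.range (cnt t ω), ENNReal.ofReal (g (ω i).2.1) ∂driveLaw p =
      ∫⁻ ω, ∑' n, weight g n t ω ∂driveLaw p := by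
    refine lintegral_congr_ae ?_
    filter_upwards [ae_regular (p := p)] with ω h
    simp only [h.weight_eq]
    rw [tsum_ite_eq (cnt t ω)
      (fun n => ∏ i ∈ Finset.range n, ENNReal.ofReal (g (ω i).2.1))]
  rw [h1, lintegral_tsum (f := fun n ω => weight g n t ω) fun n =>
    ((measurable_weight g n).comp measurable_prodMk_left).aemeasurable]
  simp only [lintegral_weight hg _ ht]
  have hs := (NormedSpace.expSeries_div_hasSum_exp ((∑ i, g i) * t)).mul_left (Real.exp (-(p * t)))
  rw [← ENNReal.ofReal_tsum_of_nonneg (fun n => by positivity) hs.summable, hs.tsum_eq,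
    Real.exp_add, Real.exp_eq_exp_ℝ]

/-- Node `i` is updated in the time interval `[a, c)`. -/
def Updated (i : Fin p) (a c : ℝ) (ω : ℕ → ℝ × Fin p × ℝ) : Prop :=
  ∃ n, cnt a ω ≤ n ∧ n < cnt c ω ∧ (ω n).2.1 = i

theorem measurableSet_updated (i : Fin p) (a c : ℝ) :
    MeasurableSet {ω | Updated i a c ω} := by
  have : {ω : ℕ → ℝ × Fin p × ℝ | Updated i a c ω} = ⋃ n, ({ω | cnt a ω ≤ n} ∩
      ({ω | n < cnt c ω} ∩ {ω | (ω n).2.1 = i})) := by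
    ext ω; simp [Updated]
  rw [this]
  refine MeasurableSet.iUnion fun n => ((measurable_cnt a) (.of_discrete (s := Set.Iic n))).inter
    (((measurable_cnt c) (.of_discrete (s := Set.Ioi n))).inter ?_)
  exact (by fun_prop : Measurable fun ω : ℕ → ℝ × Fin p × ℝ => (ω n).2.1) (measurableSet_singleton i)

theorem Regular.cnt_zero {ω : ℕ → ℝ × Fin p × ℝ} (h : Regular ω) : cnt 0 ω = 0 :=
  h.cnt_eq_zero (h.1 0).le

/-- No node of `L` is updated in `[0, t)` with probability `e^{-|L| t}`. -/
theorem driveLaw_not_updated [NeZero p] (L : Finset (Fin p)) {t : ℝ} (ht : 0 ≤ t) :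
    driveLaw p {ω | ∀ l ∈ L, ¬ Updated l 0 t ω} =
      ENNReal.ofReal (Real.exp (-(L.card * t))) := by
  classical
  have hm : MeasurableSet {ω : ℕ → ℝ × Fin p × ℝ | ∀ l ∈ L, ¬ Updated l 0 t ω} := by
    simp only [Set.ofPred_forall]
    exact MeasurableSet.iInter fun i => MeasurableSet.iInter fun _ =>
      (measurableSet_updated i 0 t).compl
  -- With weights 0 on `L` and 1 elsewhere the product is the indicator that no node of `L` has been
  -- updated.
  have h := lintegral_prod_cnt (p := p) (g := fun i => if i ∈ L then 0 else 1)
    (fun i => by split_ifs <;> simp) ht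
  have hs : ∑ i : Fin p, (if i ∈ L then (0 : ℝ) else 1) = p - L.card := by
    have h1 : ∀ i : Fin p, (if i ∈ L then (0 : ℝ) else 1) = 1 - if i ∈ L then 1 else 0 := fun i => by
      split_ifs <;> simp
    rw [Finset.sum_congr rfl fun i _ => h1 i, Finset.sum_sub_distrib]
    simp
  rw [hs, show -((p : ℝ) * t) + (p - L.card) * t = -(L.card * t) by ring] at h
  rw [← h, ← lintegral_indicator_one hm]
  refine lintegral_congr_ae ?_
  filter_upwards [ae_regular (p := p)] with ω hω
  by_cases hL : ∀ l ∈ L, ¬ Updated l 0 t ω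
  · rw [Set.indicator_of_mem (by exact hL), Pi.one_apply]
    refine (Finset.prod_eq_one fun i hi => ?_).symm
    rw [if_neg, ENNReal.ofReal_one]
    intro hmem
    exact hL _ hmem ⟨i, by rw [hω.cnt_zero]; exact Nat.zero_le _, Finset.mem_range.1 hi, rfl⟩
  · rw [Set.indicator_of_notMem (by exact hL)]
    push Not at hL
    obtain ⟨l, hl, n, -, hn, rfl⟩ := hL
    refine (Finset.prod_eq_zero (Finset.mem_range.2 hn) ?_).symm
    simp [hl]

/-- `i` is updated but no node of `L`, in `[0, t)`. -/
theorem driveLaw_updated_not_updated [NeZero p] {i : Fin p} {L : Finset (Fin p)} (hi : i ∉ L) {t : ℝ}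
    (ht : 0 ≤ t) :
    driveLaw p {ω | Updated i 0 t ω ∧ ∀ l ∈ L, ¬ Updated l 0 t ω} =
      ENNReal.ofReal ((1 - Real.exp (-t)) * Real.exp (-(L.card * t))) := by
  classical
  have h1 := driveLaw_not_updated L ht
  have h2 := driveLaw_not_updated (insert i L) ht
  have hm : ∀ L : Finset (Fin p),
      MeasurableSet {ω : ℕ → ℝ × Fin p × ℝ | ∀ l ∈ L, ¬ Updated l 0 t ω} := fun L => by
    simp only [Set.ofPred_forall]
    exact MeasurableSet.iInter fun i => MeasurableSet.iInter fun _ =>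
      (measurableSet_updated i 0 t).compl
  have hsub : {ω : ℕ → ℝ × Fin p × ℝ | ∀ l ∈ insert i L, ¬ Updated l 0 t ω} ⊆
      {ω | ∀ l ∈ L, ¬ Updated l 0 t ω} := fun ω h l hl => h l (Finset.mem_insert_of_mem hl)
  have hd : {ω : ℕ → ℝ × Fin p × ℝ | Updated i 0 t ω ∧ ∀ l ∈ L, ¬ Updated l 0 t ω} =
      {ω | ∀ l ∈ L, ¬ Updated l 0 t ω} \ {ω | ∀ l ∈ insert i L, ¬ Updated l 0 t ω} := by
    ext ω
    simp only [Set.mem_ofPred_eq, Set.mem_sdiff, Finset.forall_mem_insert]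
    tauto
  rw [hd, measure_sdiff hsub (hm _).nullMeasurableSet (measure_ne_top _ _), h1, h2,
    ← ENNReal.ofReal_sub _ (Real.exp_nonneg _), Finset.card_insert_of_notMem hi]
  congr 1
  rw [show -(((L.card + 1 : ℕ) : ℝ) * t) = -t + -(L.card * t) by push_cast; ring, Real.exp_add]
  ring

theorem updated_stitch_add {ω ω' : ℕ → ℝ × Fin p × ℝ} (h : Regular ω) (h' : Regular ω') {t a c : ℝ}
    (ht : 0 ≤ t) (ha : 0 ≤ a) (hc : 0 ≤ c) (i : Fin p) :
    Updated i (t + a) (t + c) (fun n => stitch n t ω ω') ↔ Updated i a c ω' := by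
  unfold Updated
  rw [cnt_add_stitch h h' ht ha, cnt_add_stitch h h' ht hc]
  constructor
  · rintro ⟨n, h1, h2, h3⟩
    obtain ⟨m, rfl⟩ := Nat.exists_eq_add_of_le (le_of_add_le_left h1)
    rw [stitch_cnt_add_snd h] at h3
    exact ⟨m, by omega, by omega, h3⟩
  · rintro ⟨m, h1, h2, h3⟩
    exact ⟨cnt t ω + m, by omega, by omega, by rw [stitch_cnt_add_snd h]; exact h3⟩

theorem updated_stitch_of_le {ω ω' : ℕ → ℝ × Fin p × ℝ} (h : Regular ω) (h' : Regular ω')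
    {t a c : ℝ} (ht : 0 ≤ t) (ha : a ≤ t) (hc : c ≤ t) (i : Fin p) :
    Updated i a c (fun n => stitch n t ω ω') ↔ Updated i a c ω := by
  unfold Updated
  rw [cnt_stitch_of_le h h' ht ha, cnt_stitch_of_le h h' ht hc]
  refine exists_congr fun n => and_congr_right fun _ => and_congr_right fun hn => ?_
  have := stitch_of_lt (ω' := ω') h (hn.trans_le (h.cnt_mono hc))
  simp only [this]

theorem updated_renoise (i : Fin p) (a c : ℝ) (ω : ℕ → ℝ × Fin p × ℝ) (k : ℕ) (z : ℝ) :
    Updated i a c (renoise k ω z) ↔ Updated i a c ω := by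
  have h1 : ∀ n, (renoise k ω z n).1 = (ω n).1 := fun n => by
    unfold renoise; split_ifs <;> rfl
  have h2 : ∀ n, (renoise k ω z n).2.1 = (ω n).2.1 := fun n => by
    unfold renoise; split_ifs <;> rfl
  simp only [Updated, cnt, arr, h1, h2]

end

section

variable {p : ℕ}

/-! ### The chain driven by a sequence of rounds -/

/-- The states of the linear dynamics with coefficients `b` and noise levels `s`. -/
noncomputable def chain (b : Fin p → Fin p → ℝ) (s : Fin p → ℝ) (x : Fin p → ℝ)
    (ω : ℕ → ℝ × Fin p × ℝ) : ℕ → Fin p → ℝ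
  | 0 => x
  | n + 1 => Function.update (chain b s x ω n) (ω n).2.1
      ((∑ l, b (ω n).2.1 l * chain b s x ω n l) + s (ω n).2.1 * (ω n).2.2)

/-- The state at time `t` (left limit). -/
noncomputable def stateAt (b : Fin p → Fin p → ℝ) (s : Fin p → ℝ) (t : ℝ) (x : Fin p → ℝ)
    (ω : ℕ → ℝ × Fin p × ℝ) : Fin p → ℝ :=
  chain b s x ω (cnt t ω)

section Chain

variable {b : Fin p → Fin p → ℝ} {s : Fin p → ℝ}

theorem chain_congr {x : Fin p → ℝ} {ω ω' : ℕ → ℝ × Fin p × ℝ} {n : ℕ}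
    (h : ∀ m < n, (ω m).2 = (ω' m).2) : chain b s x ω n = chain b s x ω' n := by
  induction n with
  | zero => rfl
  | succ n ih =>
    rw [chain, chain, ih fun m hm => h m (hm.trans n.lt_succ_self), h n n.lt_succ_self]

theorem chain_add (x : Fin p → ℝ) (ω : ℕ → ℝ × Fin p × ℝ) (m n : ℕ) :
    chain b s x ω (m + n) = chain b s (chain b s x ω m) (fun k => ω (m + k)) n := by
  induction n with
  | zero => rfl
  | succ n ih => rw [← add_assoc, chain, chain, ih]

theorem measurable_chain_aux (n : ℕ) :
    Measurable fun y : (Fin p → ℝ) × (ℕ → ℝ × Fin p × ℝ) => chain b s y.1 y.2 n := by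
  induction n with
  | zero => exact measurable_fst
  | succ n ih =>
    refine measurable_pi_lambda _ fun l => ?_
    have hb : ∀ l, Measurable fun i => b i l := fun l => measurable_of_finite _
    have hs : Measurable s := measurable_of_finite _
    have hi : Measurable fun y : (Fin p → ℝ) × (ℕ → ℝ × Fin p × ℝ) => (y.2 n).2.1 := by fun_prop
    have hc : ∀ l, Measurable fun y : (Fin p → ℝ) × (ℕ → ℝ × Fin p × ℝ) =>
      chain b s y.1 y.2 n l := fun l => (measurable_pi_apply l).comp ih
    simp only [chain, Function.update_apply]
    refine Measurable.ite (measurableSet_eq_fun measurable_const hi) ?_ (hc l)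
    refine Measurable.add (Finset.measurable_sum _ fun l _ => ((hb l).comp hi).mul (hc l)) ?_
    exact (hs.comp hi).mul (by fun_prop)

theorem measurable_stateAt (t : ℝ) :
    Measurable fun y : (Fin p → ℝ) × (ℕ → ℝ × Fin p × ℝ) => stateAt b s t y.1 y.2 := by
  have h : Measurable fun z : ((Fin p → ℝ) × (ℕ → ℝ × Fin p × ℝ)) × ℕ =>
      chain b s z.1.1 z.1.2 z.2 :=
    measurable_from_prod_countable_left fun n => measurable_chain_aux n
  exact h.comp (measurable_id.prodMk ((measurable_cnt t).comp measurable_snd))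

@[fun_prop] theorem measurable_stateAt_comp {F : Type*} [MeasurableSpace F] (t : ℝ)
    {f : F → Fin p → ℝ} {g : F → ℕ → ℝ × Fin p × ℝ} (hf : Measurable f) (hg : Measurable g) :
    Measurable fun y => stateAt b s t (f y) (g y) :=
  (measurable_stateAt t).comp (hf.prodMk hg)

/-- With `stateAt_stitch_of_le`, a pathwise form of the Markov property at time `t`. -/
theorem stateAt_stitch_add {ω ω' : ℕ → ℝ × Fin p × ℝ} (h : Regular ω) (h' : Regular ω')
    {t a : ℝ} (ht : 0 ≤ t) (ha : 0 ≤ a) (x : Fin p → ℝ) :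
    stateAt b s (t + a) x (fun n => stitch n t ω ω') = stateAt b s a (stateAt b s t x ω) ω' := by
  unfold stateAt
  rw [cnt_add_stitch h h' ht ha, chain_add,
    chain_congr (x := x) (ω' := ω) fun m hm => congrArg Prod.snd (stitch_of_lt h hm)]
  exact chain_congr fun m _ => stitch_cnt_add_snd h t m

theorem stateAt_stitch_of_le {ω ω' : ℕ → ℝ × Fin p × ℝ} (h : Regular ω) (h' : Regular ω')
    {t a : ℝ} (ht : 0 ≤ t) (ha : a ≤ t) (x : Fin p → ℝ) :
    stateAt b s a x (fun n => stitch n t ω ω') = stateAt b s a x ω := by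
  unfold stateAt
  rw [cnt_stitch_of_le h h' ht ha]
  exact chain_congr fun m hm =>
    congrArg Prod.snd (stitch_of_lt h (hm.trans_le (h.cnt_mono ha)))

theorem chain_eq_of_ne {x : Fin p → ℝ} {ω : ℕ → ℝ × Fin p × ℝ} {l : Fin p} {a c : ℕ} (hac : a ≤ c)
    (h : ∀ n, a ≤ n → n < c → (ω n).2.1 ≠ l) : chain b s x ω c l = chain b s x ω a l := by
  induction c, hac using Nat.le_induction with
  | base => rfl
  | succ c hc ih =>
    rw [chain, Function.update_of_ne (h c hc c.lt_succ_self).symm,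
      ih fun n h1 h2 => h n h1 (h2.trans c.lt_succ_self)]

theorem Regular.stateAt_zero {ω : ℕ → ℝ × Fin p × ℝ} (h : Regular ω) (x : Fin p → ℝ) :
    stateAt b s 0 x ω = x := by
  rw [stateAt, h.cnt_zero, chain]

theorem Regular.stateAt_eq_of_not_updated {ω : ℕ → ℝ × Fin p × ℝ} (h : Regular ω) {l : Fin p}
    {a c : ℝ} (hac : a ≤ c) (hl : ¬ Updated l a c ω) (x : Fin p → ℝ) :
    stateAt b s c x ω l = stateAt b s a x ω l :=
  chain_eq_of_ne (h.cnt_mono hac) fun n h1 h2 h3 => hl ⟨n, h1, h2, h3⟩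

/-! ### The last update of a node -/

open Classical in
/-- The index of the round of the last update of `i` before time `t`. -/
noncomputable def lastIdx (i : Fin p) (t : ℝ) (ω : ℕ → ℝ × Fin p × ℝ) : ℕ :=
  -- The default is 0 if `i` has not been updated. Resampling at this index is legitimate even then,
  -- since it never depends on the noises.
  Nat.findGreatest (fun n => n < cnt t ω ∧ (ω n).2.1 = i) (cnt t ω)

/-- The standardized noise of the last update of `i` before time `t`. -/
noncomputable def lastNoise (i : Fin p) (t : ℝ) (ω : ℕ → ℝ × Fin p × ℝ) : ℝ :=
  (ω (lastIdx i t ω)).2.2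

theorem measurable_lastIdx (i : Fin p) (t : ℝ) :
    Measurable fun ω : ℕ → ℝ × Fin p × ℝ => lastIdx i t ω := by
  refine measurable_to_countable' fun k => ?_
  have hn : ∀ n, MeasurableSet {ω : ℕ → ℝ × Fin p × ℝ | n < cnt t ω} := fun n =>
    (measurable_cnt t) (.of_discrete (s := Set.Ioi n))
  have hk : MeasurableSet {ω : ℕ → ℝ × Fin p × ℝ | k ≤ cnt t ω} :=
    (measurable_cnt t) (.of_discrete (s := Set.Ici k))
  have hi : ∀ n, MeasurableSet {ω : ℕ → ℝ × Fin p × ℝ | (ω n).2.1 = i} := fun n =>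
    (by fun_prop : Measurable fun ω : ℕ → ℝ × Fin p × ℝ => (ω n).2.1) (measurableSet_singleton i)
  have hP := fun n => (hn n).inter (hi n)
  have : (fun ω : ℕ → ℝ × Fin p × ℝ => lastIdx i t ω) ⁻¹' {k} =
      {ω | k ≤ cnt t ω} ∩ (({ω | k = 0} ∪ ({ω | k < cnt t ω} ∩ {ω | (ω k).2.1 = i})) ∩
        ⋂ n, ({ω | ¬ k < n} ∪ ({ω | n < cnt t ω} ∩ {ω | (ω n).2.1 = i})ᶜ)) := by
    ext ω
    simp only [Set.mem_preimage, Set.mem_singleton_iff, lastIdx, Nat.findGreatest_eq_iff,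
      Set.mem_inter_iff, Set.mem_union, Set.mem_ofPred_eq, Set.mem_iInter, Set.mem_compl_iff]
    refine and_congr_right fun _ => and_congr (by tauto) (forall_congr' fun n => ?_)
    constructor
    · intro h
      by_cases h1 : k < n
      · exact Or.inr fun h2 => h h1 h2.1.le h2
      · exact Or.inl h1
    · rintro h h1 - h2
      exact h.elim (fun h => h h1) fun h => h h2
  rw [this]
  exact hk.inter (((MeasurableSet.const _).union (hP k)).inter
    (MeasurableSet.iInter fun n => (MeasurableSet.const _).union (hP n).compl))

theorem cnt_renoise (t : ℝ) (ω : ℕ → ℝ × Fin p × ℝ) (k : ℕ) (z : ℝ) :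
    cnt t (renoise k ω z) = cnt t ω := by
  have h1 : ∀ n, (renoise k ω z n).1 = (ω n).1 := fun n => by
    unfold renoise; split_ifs <;> rfl
  simp only [cnt, arr, h1]

theorem lastIdx_renoise (i : Fin p) (t : ℝ) (ω : ℕ → ℝ × Fin p × ℝ) (k : ℕ) (z : ℝ) :
    lastIdx i t (renoise k ω z) = lastIdx i t ω := by
  have h2 : ∀ n, (renoise k ω z n).2.1 = (ω n).2.1 := fun n => by
    unfold renoise; split_ifs <;> rfl
  simp only [lastIdx, h2, cnt_renoise]

theorem measurable_lastNoise (i : Fin p) (t : ℝ) :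
    Measurable fun ω : ℕ → ℝ × Fin p × ℝ => lastNoise i t ω := by
  have h : Measurable fun z : (ℕ → ℝ × Fin p × ℝ) × ℕ => (z.1 z.2).2.2 :=
    measurable_from_prod_countable_left fun n => by fun_prop
  exact h.comp (measurable_id.prodMk (measurable_lastIdx i t))

theorem lastNoise_renoise (i : Fin p) (t : ℝ) (ω : ℕ → ℝ × Fin p × ℝ) (z : ℝ) :
    lastNoise i t (renoise (lastIdx i t ω) ω z) = z := by
  rw [lastNoise, lastIdx_renoise]
  simp [renoise]

theorem Updated.lastIdx_spec {i : Fin p} {t : ℝ} {ω : ℕ → ℝ × Fin p × ℝ} (h : Updated i 0 t ω) :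
    lastIdx i t ω < cnt t ω ∧ (ω (lastIdx i t ω)).2.1 = i ∧
      ∀ n, lastIdx i t ω < n → n < cnt t ω → (ω n).2.1 ≠ i := by
  classical
  obtain ⟨n, -, hn, hi⟩ := h
  have h1 : lastIdx i t ω < cnt t ω ∧ (ω (lastIdx i t ω)).2.1 = i :=
    Nat.findGreatest_spec (P := fun n => n < cnt t ω ∧ (ω n).2.1 = i) hn.le ⟨hn, hi⟩
  refine ⟨h1.1, h1.2, fun m hm hmc hmi => ?_⟩
  exact Nat.findGreatest_is_greatest (P := fun n => n < cnt t ω ∧ (ω n).2.1 = i) hm hmc.le ⟨hmc, hmi⟩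

/-- The noise of the last update of `i` is standard normal, independently of which nodes are
updated. -/
theorem lintegral_lastNoise [NeZero p] (i : Fin p) (t : ℝ) {S : Set (ℕ → ℝ × Fin p × ℝ)}
    (hS : MeasurableSet S) (hinv : ∀ ω k z, renoise k ω z ∈ S ↔ ω ∈ S) {f : ℝ → ℝ≥0∞}
    (hf : Measurable f) :
    ∫⁻ ω in S, f (lastNoise i t ω) ∂driveLaw p =
      driveLaw p S * ∫⁻ z, f z ∂gaussianReal 0 1 := by
  have hm : Measurable fun ω : ℕ → ℝ × Fin p × ℝ => f (lastNoise i t ω) :=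
    hf.comp (measurable_lastNoise i t)
  rw [← lintegral_indicator hS, lintegral_renoise (measurable_lastIdx i t) (lastIdx_renoise i t)
    (hm.indicator hS), ← lintegral_indicator_one hS, ← lintegral_mul_const _
    (measurable_one.indicator hS)]
  refine lintegral_congr fun ω => ?_
  by_cases h : ω ∈ S
  · rw [Set.indicator_of_mem h, Pi.one_apply, one_mul]
    refine lintegral_congr fun z => ?_
    rw [Set.indicator_of_mem ((hinv ω _ z).2 h), lastNoise_renoise]
  · rw [Set.indicator_of_notMem h, zero_mul]
    refine (lintegral_congr fun z => ?_).trans lintegral_zero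
    rw [Set.indicator_of_notMem (fun h2 => h ((hinv ω _ z).1 h2))]

/-- The value of a node all of whose neighbours have been at rest. -/
theorem stateAt_eq_of_updated {i : Fin p} {t : ℝ} {ω : ℕ → ℝ × Fin p × ℝ} (hr : Regular ω)
    (h : Updated i 0 t ω) (hnb : ∀ l, b i l ≠ 0 → ¬ Updated l 0 t ω) (x : Fin p → ℝ) :
    stateAt b s t x ω i = (∑ l, b i l * x l) + s i * lastNoise i t ω := by
  obtain ⟨h1, h2, h3⟩ := h.lastIdx_spec
  rw [stateAt, chain_eq_of_ne (Nat.succ_le_of_lt h1) fun n hn hn2 => h3 n hn hn2, chain, h2,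
    Function.update_self, lastNoise]
  congr 1
  refine Finset.sum_congr rfl fun l _ => ?_
  by_cases hl : b i l = 0
  · rw [hl, zero_mul, zero_mul]
  · rw [chain_eq_of_ne (Nat.zero_le _) fun n _ hn hnl => hnb l hl ⟨n, by
      rw [hr.cnt_zero]; exact Nat.zero_le _, hn.trans h1, hnl⟩, chain]

/-! ### Response of the state to the last noise of a node -/

/-- The state is affine in the noise of the last update of `j`. -/
theorem exists_affine_response {γ : ℝ} (hb : ∀ i, ∑ l, |b i l| ≤ γ) (hγ : γ ≤ 1) {j : Fin p}
    (hj : 0 ≤ s j) {t : ℝ} {ω : ℕ → ℝ × Fin p × ℝ} (h : Updated j 0 t ω) (x : Fin p → ℝ) :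
    ∃ u e : Fin p → ℝ, (∀ z, stateAt b s t x (renoise (lastIdx j t ω) ω z) = u + z • e) ∧
      e j = s j ∧ ∀ l, l ≠ j → |e l| ≤ γ * s j := by
  obtain ⟨h1, h2, h3⟩ := h.lastIdx_spec
  have hγ0 : 0 ≤ γ := (Finset.sum_nonneg fun _ _ => abs_nonneg _).trans (hb j)
  set k := lastIdx j t ω with hk
  -- Invariant after round `k`: coordinate j keeps the slope `s j` because it is not updated again.
  -- An update elsewhere forms a combination, with weights of total size at most γ, of slopes of
  -- size at most `s j`.
  have key : ∀ n, k + 1 ≤ n → n ≤ cnt t ω → ∃ u e : Fin p → ℝ,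
      (∀ z, chain b s x (renoise k ω z) n = u + z • e) ∧
      e j = s j ∧ ∀ l, l ≠ j → |e l| ≤ γ * s j := by
    intro n hn
    induction n, hn using Nat.le_induction with
    | base =>
      intro _
      refine ⟨Function.update (chain b s x ω k) j (∑ l, b j l * chain b s x ω k l),
        Pi.single j (s j), fun z => ?_, by simp, fun l hl => ?_⟩
      · have : chain b s x (renoise k ω z) k = chain b s x ω k :=
          chain_congr fun m hm => by simp [renoise, hm.ne]
        rw [chain, this]
        ext l
        by_cases hl : l = j
        · subst hl; simp [renoise, h2, mul_comm]
        · simp [renoise, h2, hl]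
      · simp only [Pi.single_eq_of_ne hl, abs_zero]
        positivity
    | succ n hn ih =>
      intro hnc
      obtain ⟨u, e, hu, hej, hel⟩ := ih (by omega)
      have hne : (ω n).2.1 ≠ j := h3 n hn hnc
      have hnk : n ≠ k := by omega
      refine ⟨Function.update u (ω n).2.1 ((∑ l, b (ω n).2.1 l * u l) + s (ω n).2.1 * (ω n).2.2),
        Function.update e (ω n).2.1 (∑ l, b (ω n).2.1 l * e l), fun z => ?_, ?_, fun l hl => ?_⟩
      · rw [chain, hu z]
        ext l
        by_cases hl : l = (ω n).2.1
        · subst hl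
          simp only [renoise, hnk, if_false, Function.update_self, Pi.add_apply, Pi.smul_apply,
            smul_eq_mul, mul_add, Finset.sum_add_distrib, Finset.mul_sum]
          rw [add_right_comm]
          congr 1
          exact Finset.sum_congr rfl fun l _ => by ring
        · simp [renoise, hnk, hl]
      · rw [Function.update_of_ne hne.symm, hej]
      · by_cases hln : l = (ω n).2.1
        · subst hln
          rw [Function.update_self]
          calc |∑ l, b (ω n).2.1 l * e l| ≤ ∑ l, |b (ω n).2.1 l| * s j := by
                refine (Finset.abs_sum_le_sum_abs _ _).trans (Finset.sum_le_sum fun l _ => ?_)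
                rw [abs_mul]
                refine mul_le_mul_of_nonneg_left ?_ (abs_nonneg _)
                by_cases hlj : l = j
                · rw [hlj, hej, abs_of_nonneg hj]
                · exact (hel l hlj).trans (mul_le_of_le_one_left hj hγ)
            _ ≤ γ * s j := by
                rw [← Finset.sum_mul]
                exact mul_le_mul_of_nonneg_right (hb _) hj
        · rw [Function.update_of_ne hln]
          exact hel l hl
  obtain ⟨u, e, h4, h5⟩ := key (cnt t ω) h1 le_rfl
  exact ⟨u, e, fun z => by rw [stateAt, cnt_renoise, h4], h5⟩

/-! ### Anti-concentration of the drift. -/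

/-- The mean change of coordinate `j` when first `i` and then `j` is updated. -/
noncomputable def drift (b : Fin p → Fin p → ℝ) (i j : Fin p) (x : Fin p → ℝ) : ℝ :=
  (∑ l, b j l * x l) - b j i * x i + b j i * (∑ l, b i l * x l) - x j

theorem drift_add_smul (i j : Fin p) (u e : Fin p → ℝ) (z : ℝ) :
    drift b i j (u + z • e) = drift b i j u + drift b i j e * z := by
  have : ∀ i, ∑ l, b i l * (u + z • e) l = (∑ l, b i l * u l) + (∑ l, b i l * e l) * z := fun i => by
    rw [Finset.sum_mul, ← Finset.sum_add_distrib]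
    exact Finset.sum_congr rfl fun l _ => by simp; ring
  rw [drift, this, this]
  simp only [drift, Pi.add_apply, Pi.smul_apply, smul_eq_mul]
  ring

@[fun_prop] theorem measurable_drift (i j : Fin p) : Measurable (drift b i j) := by
  unfold drift; fun_prop

/-- The slope at j is σ rather than at most γσ, so j must not enter the sum: either it is the term
removed or its coefficient vanishes. -/
theorem abs_sum_erase_le {γ σ : ℝ} (hb : ∀ i, ∑ l, |b i l| ≤ γ) (hγ : 0 ≤ γ) (hσ : 0 ≤ σ)
    (i j : Fin p) {e : Fin p → ℝ} (he : ∀ l, l ≠ j → |e l| ≤ γ * σ) (k : Fin p)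
    (hk : k = j ∨ b i j = 0) :
    |(∑ l, b i l * e l) - b i k * e k| ≤ (γ - |b i k|) * (γ * σ) := by
  have h1 : (∑ l, b i l * e l) - b i k * e k = ∑ l ∈ Finset.univ.erase k, b i l * e l := by
    rw [← Finset.add_sum_erase _ _ (Finset.mem_univ k)]; ring
  have h2 : ∑ l ∈ Finset.univ.erase k, |b i l| ≤ γ - |b i k| := by
    have := hb i
    rw [← Finset.add_sum_erase _ _ (Finset.mem_univ k)] at this
    linarith
  rw [h1]
  calc |∑ l ∈ Finset.univ.erase k, b i l * e l|
      ≤ ∑ l ∈ Finset.univ.erase k, |b i l| * (γ * σ) := by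
        refine (Finset.abs_sum_le_sum_abs _ _).trans (Finset.sum_le_sum fun l hl => ?_)
        rw [abs_mul]
        by_cases hlj : l = j
        · rcases hk with rfl | hk
          · exact absurd hlj (Finset.ne_of_mem_erase hl)
          · rw [hlj, hk]; simp
        · exact mul_le_mul_of_nonneg_left (he l hlj) (abs_nonneg _)
    _ ≤ _ := by
        rw [← Finset.sum_mul]
        exact mul_le_mul_of_nonneg_right h2 (by positivity)

/-- The term -e_j = -σ dominates. Every other contribution carries two contraction factors, and
together they exceed -σ by at most γ²σ. -/
theorem le_abs_drift {γ : ℝ} (hb : ∀ i, ∑ l, |b i l| ≤ γ) (hγ : γ ≤ 1) (hd : ∀ i, b i i = 0)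
    {i j : Fin p} {σ : ℝ} (hσ : 0 ≤ σ) {e : Fin p → ℝ} (hj : e j = σ)
    (he : ∀ l, l ≠ j → |e l| ≤ γ * σ) : (1 - γ ^ 2) * σ ≤ |drift b i j e| := by
  have hγ0 : 0 ≤ γ := (Finset.sum_nonneg fun _ _ => abs_nonneg _).trans (hb j)
  have h1 := abs_sum_erase_le hb hγ0 hσ j j he i (Or.inr (hd j))
  have h2 := abs_sum_erase_le hb hγ0 hσ i j he j (Or.inl rfl)
  have hle : |b i j| ≤ γ := (Finset.single_le_sum (f := fun l => |b i l|)
    (fun _ _ => abs_nonneg _) (Finset.mem_univ j)).trans (hb i)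
  set A := (∑ l, b j l * e l) - b j i * e i with hA
  set B := (∑ l, b i l * e l) - b i j * e j with hB
  have h3 : drift b i j e = A + b j i * B + b j i * b i j * σ - σ := by
    rw [drift, hA, hB, hj]; ring
  have h4 : |b j i * B| ≤ |b j i| * ((γ - |b i j|) * (γ * σ)) := by
    rw [abs_mul]
    exact mul_le_mul_of_nonneg_left h2 (abs_nonneg _)
  have h5 : b j i * b i j ≤ |b j i| * |b i j| := by rw [← abs_mul]; exact le_abs_self _
  have h6 : b j i * b i j * σ ≤ |b j i| * |b i j| * σ := mul_le_mul_of_nonneg_right h5 hσ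
  refine le_trans ?_ (neg_le_abs _)
  rw [h3]
  -- This is exactly the amount by which the three bounds together stay below γ²σ.
  have h7 : 0 ≤ |b j i| * (1 - γ) * (γ - |b i j|) * σ := by
    have := abs_nonneg (b j i)
    have h8 : 0 ≤ 1 - γ := by linarith
    have h9 : 0 ≤ γ - |b i j| := by linarith
    positivity
  have := (abs_le.1 h1).2
  have := (abs_le.1 h4).2
  nlinarith

/-- The event lies in an interval of length 2c/|B|, and the standard normal density is at most 1/2.
-/
theorem gaussianReal_abs_affine_lt {A B c : ℝ} (hB : B ≠ 0) :
    gaussianReal 0 1 {z | |A + B * z| < c} ≤ ENNReal.ofReal (c / |B|) := by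
  have hB' : 0 < |B| := abs_pos.2 hB
  have hsub : {z | |A + B * z| < c} ⊆ Set.Icc (-(A / B) - c / |B|) (-(A / B) + c / |B|) := by
    intro z (hz : |A + B * z| < c)
    have : |A + B * z| = |B| * |z + A / B| := by
      rw [← abs_mul]; congr 1; field_simp; ring
    rw [this, mul_comm, ← lt_div_iff₀ hB', abs_lt] at hz
    constructor <;> linarith [hz.1, hz.2]
  refine (measure_mono hsub).trans ?_
  rw [gaussianReal_apply _ one_ne_zero]
  have hpdf : ∀ x, gaussianPDF 0 1 x ≤ ENNReal.ofReal 2⁻¹ := fun x => by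
    refine ENNReal.ofReal_le_ofReal ?_
    rw [gaussianPDFReal_def]
    have h1 : Real.exp (-(x - 0) ^ 2 / (2 * ((1 : NNReal) : ℝ))) ≤ 1 := by
      rw [Real.exp_le_one_iff]
      have := sq_nonneg (x - 0)
      simp only [NNReal.coe_one]
      linarith
    have h2 : (√(2 * Real.pi * ((1 : NNReal) : ℝ)))⁻¹ ≤ 2⁻¹ := by
      refine inv_anti₀ two_pos (Real.le_sqrt_of_sq_le ?_)
      have := Real.pi_gt_three
      simp only [NNReal.coe_one]
      linarith
    calc _ ≤ 2⁻¹ * 1 := mul_le_mul h2 h1 (Real.exp_nonneg _) (by norm_num)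
      _ = _ := mul_one _
  refine (lintegral_mono hpdf).trans ?_
  rw [setLIntegral_const, Real.volume_Icc, ← ENNReal.ofReal_mul (by norm_num)]
  refine ENNReal.ofReal_le_ofReal (le_of_eq ?_)
  ring

/-- With probability bounded below the drift at time `t` is comparable to the noise level of `j`. -/
theorem driveLaw_le_abs_drift [NeZero p] {γ : ℝ} (hb : ∀ i, ∑ l, |b i l| ≤ γ) (hγ : γ < 1)
    (hd : ∀ i, b i i = 0) {i j : Fin p} (hj : 0 < s j) {t : ℝ} (ht : 0 ≤ t) (x : Fin p → ℝ) :
    ENNReal.ofReal ((1 - Real.exp (-t)) / 2) ≤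
      driveLaw p {ω | (1 - γ ^ 2) / 2 * s j ≤ |drift b i j (stateAt b s t x ω)|} := by
  have hγ0 : 0 ≤ γ := (Finset.sum_nonneg fun _ _ => abs_nonneg _).trans (hb j)
  have hγ2 : 0 < 1 - γ ^ 2 := by nlinarith
  set c := (1 - γ ^ 2) / 2 * s j with hc
  have hc0 : 0 < c := by positivity
  have hgm : MeasurableSet {ω : ℕ → ℝ × Fin p × ℝ | c ≤ |drift b i j (stateAt b s t x ω)|} :=
    measurableSet_le measurable_const (by fun_prop)
  have hU := measurableSet_updated j 0 t
  have hP := driveLaw_updated_not_updated (i := j) (L := ∅) (by simp) ht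
  simp only [Finset.notMem_empty, IsEmpty.forall_iff, implies_true, and_true, Finset.card_empty,
    CharP.cast_eq_zero, zero_mul, neg_zero, Real.exp_zero, mul_one] at hP
  -- Resample the last noise of j. If j was updated, the drift is affine in this noise with slope at
  -- least 2c, so it is at least c in absolute value with conditional probability at least 1/2.
  rw [← lintegral_indicator_one hgm, lintegral_renoise (measurable_lastIdx j t)
    (lastIdx_renoise j t) (measurable_one.indicator hgm), div_eq_mul_inv,
    ENNReal.ofReal_mul (by simpa using ht), ← hP, ← lintegral_indicator_one hU,
    ← lintegral_mul_const _ (measurable_one.indicator hU)]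
  refine lintegral_mono fun ω => ?_
  by_cases h : Updated j 0 t ω
  · obtain ⟨u, e, h1, h2, h3⟩ := exists_affine_response hb hγ.le hj.le h x
    have h4 := le_abs_drift hb hγ.le hd (i := i) hj.le h2 h3
    have hB : 0 < |drift b i j e| := lt_of_lt_of_le (by positivity) h4
    have h5 := gaussianReal_abs_affine_lt (c := c) (A := drift b i j u) (abs_pos.1 hB)
    have hm : MeasurableSet {z : ℝ | |drift b i j u + drift b i j e * z| < c} :=
      measurableSet_lt (by fun_prop) (by fun_prop)
    have h6 : c / |drift b i j e| ≤ 2⁻¹ := by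
      rw [div_le_iff₀ hB]
      linarith
    have h7 := (h5.trans (ENNReal.ofReal_le_ofReal h6))
    rw [Set.indicator_of_mem (by exact h), Pi.one_apply, one_mul]
    have h8 : ∀ z, {ω | c ≤ |drift b i j (stateAt b s t x ω)|}.indicator (1 : (ℕ → ℝ × Fin p × ℝ) → ℝ≥0∞)
        (renoise (lastIdx j t ω) ω z) =
        {z : ℝ | |drift b i j u + drift b i j e * z| < c}ᶜ.indicator 1 z := by
      intro z
      have : (renoise (lastIdx j t ω) ω z ∈ {ω | c ≤ |drift b i j (stateAt b s t x ω)|}) ↔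
          z ∈ {z : ℝ | |drift b i j u + drift b i j e * z| < c}ᶜ := by
        simp only [Set.mem_ofPred_eq, Set.mem_compl_iff, not_lt, h1, drift_add_smul]
      by_cases hz : z ∈ {z : ℝ | |drift b i j u + drift b i j e * z| < c}ᶜ
      · rw [Set.indicator_of_mem hz, Set.indicator_of_mem (this.2 hz)]; rfl
      · rw [Set.indicator_of_notMem hz, Set.indicator_of_notMem (fun h => hz (this.1 h))]
    rw [lintegral_congr h8, lintegral_indicator_one hm.compl, prob_compl_eq_one_sub hm]
    have h9 : (1 : ℝ≥0∞) - ENNReal.ofReal 2⁻¹ = ENNReal.ofReal 2⁻¹ := by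
      rw [← ENNReal.ofReal_one, ← ENNReal.ofReal_sub _ (by norm_num)]; norm_num
    rw [← h9]
    exact tsub_le_tsub_left h7 1
  · rw [Set.indicator_of_notMem (by exact h), zero_mul]
    exact zero_le

end Chain

end

section

variable {p : ℕ}

/-! ### Gaussian computations -/

theorem integrable_exp_abs_gaussianReal (c : ℝ) :
    Integrable (fun z => Real.exp (c * |z|)) (gaussianReal 0 1) := by
  have h1 := integrable_exp_mul_gaussianReal (μ := 0) (v := 1) c
  have h2 := integrable_exp_mul_gaussianReal (μ := 0) (v := 1) (-c)
  refine (h1.add h2).mono' (by fun_prop) (Filter.Eventually.of_forall fun z => ?_)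
  rw [Real.norm_of_nonneg (Real.exp_nonneg _), Pi.add_apply]
  rcases abs_cases z with ⟨h, -⟩ | ⟨h, -⟩ <;> rw [h]
  · linarith [Real.exp_nonneg (-c * z)]
  · rw [show c * -z = -c * z by ring]; linarith [Real.exp_nonneg (c * z)]

/-- A bound for the exponential moments of the test statistic. -/
noncomputable def expConst : ℝ :=
  2 * Real.exp 2 * (∫ z, Real.exp (2 * |z|) ∂gaussianReal 0 1) ^ 2

theorem two_le_expConst : 2 ≤ expConst := by
  have h1 : 1 ≤ ∫ z, Real.exp (2 * |z|) ∂gaussianReal 0 1 := by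
    have := integral_mono (μ := gaussianReal 0 1) (integrable_const (1 : ℝ))
      (integrable_exp_abs_gaussianReal 2)
      (fun z => Real.one_le_exp (by positivity : (0 : ℝ) ≤ 2 * |z|))
    simpa using this
  have h2 : (1 : ℝ) ≤ Real.exp 2 := Real.one_le_exp (by norm_num)
  have h3 : (1 : ℝ) ≤ (∫ z, Real.exp (2 * |z|) ∂gaussianReal 0 1) ^ 2 := one_le_pow₀ h1
  unfold expConst
  nlinarith

theorem exp_le_one_add_add_sq_mul (y : ℝ) : Real.exp y ≤ 1 + y + y ^ 2 * Real.exp |y| := by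
  have h := Complex.norm_exp_sub_sum_le_norm_mul_exp (y : ℂ) 2
  have h2 : Complex.exp y - ∑ m ∈ Finset.range 2, (y : ℂ) ^ m / m.factorial =
      ((Real.exp y - (1 + y) : ℝ) : ℂ) := by
    simp [Finset.sum_range_succ]
  rw [h2, Complex.norm_real, Complex.norm_real, Real.norm_eq_abs, Real.norm_eq_abs, sq_abs] at h
  linarith [(abs_le.1 h).2]

/-- Integrate e^y ≤ 1 + y + y² e^{|y|} at y = θΨ. By linear growth, Ψ² e^{|Ψ|} ≤ 2e^{2|Ψ|} is
dominated by a fixed integrable function, whose integral is `expConst`. -/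
theorem lintegral_exp_le {Ψ : ℝ × ℝ × ℝ → ℝ} (hΨ : Measurable Ψ)
    (hb : ∀ z, |Ψ z| ≤ 1 + |z.1| + |z.2.2|) {θ : ℝ} (hθ : |θ| ≤ 1) :
    ∫⁻ z, ENNReal.ofReal (Real.exp (θ * Ψ z))
        ∂(gaussianReal 0 1).prod ((gaussianReal 0 1).prod (gaussianReal 0 1)) ≤
      ENNReal.ofReal (1 + θ * (∫ z, Ψ z
        ∂(gaussianReal 0 1).prod ((gaussianReal 0 1).prod (gaussianReal 0 1))) +
        θ ^ 2 * expConst) := by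
  set γ3 := (gaussianReal 0 1).prod ((gaussianReal 0 1).prod (gaussianReal 0 1)) with hγ
  set D : ℝ × ℝ × ℝ → ℝ := fun z =>
    2 * Real.exp 2 * (Real.exp (2 * |z.1|) * (1 * Real.exp (2 * |z.2.2|))) with hD
  have hDi : Integrable D γ3 := by
    refine Integrable.const_mul ?_ _
    exact (integrable_exp_abs_gaussianReal 2).mul_prod
      ((integrable_const (1 : ℝ)).mul_prod (integrable_exp_abs_gaussianReal 2))
  have hDint : ∫ z, D z ∂γ3 = expConst := by
    rw [hD, integral_const_mul, hγ,
      integral_prod_mul (fun x => Real.exp (2 * |x|)) (fun y : ℝ × ℝ => 1 * Real.exp (2 * |y.2|)),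
      integral_prod_mul (fun _ => (1 : ℝ)) (fun x => Real.exp (2 * |x|))]
    simp [expConst]
    ring
  have hsq : ∀ z, Ψ z ^ 2 * Real.exp |Ψ z| ≤ D z := by
    intro z
    have h1 : |Ψ z| ^ 2 ≤ 2 * Real.exp |Ψ z| := by
      have := Real.quadratic_le_exp_of_nonneg (abs_nonneg (Ψ z))
      nlinarith [abs_nonneg (Ψ z)]
    have h2 : Real.exp |Ψ z| ≤ Real.exp (1 + |z.1| + |z.2.2|) := Real.exp_le_exp.2 (hb z)
    have h3 := Real.exp_nonneg |Ψ z|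
    have h4 : D z = 2 * (Real.exp (1 + |z.1| + |z.2.2|) * Real.exp (1 + |z.1| + |z.2.2|)) := by
      rw [hD, ← Real.exp_add]
      simp only [one_mul]
      rw [mul_assoc, ← Real.exp_add, ← Real.exp_add]
      congr 2
      ring
    rw [h4, ← sq_abs]
    calc |Ψ z| ^ 2 * Real.exp |Ψ z| ≤ 2 * Real.exp |Ψ z| * Real.exp |Ψ z| := by gcongr
      _ ≤ _ := by rw [mul_assoc]; gcongr
  have hΨi : Integrable Ψ γ3 := by
    refine hDi.mono' hΨ.aestronglyMeasurable (Filter.Eventually.of_forall fun z => ?_)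
    rw [Real.norm_eq_abs]
    have h1 : |Ψ z| ≤ Real.exp (2 * (1 + |z.1| + |z.2.2|)) := by
      have h := Real.add_one_le_exp (2 * (1 + |z.1| + |z.2.2|))
      have := hb z
      have := abs_nonneg (Ψ z)
      linarith
    have h4 : D z = 2 * Real.exp (2 * (1 + |z.1| + |z.2.2|)) := by
      rw [hD]
      simp only [one_mul]
      rw [mul_assoc, ← Real.exp_add, ← Real.exp_add]
      congr 2
      ring
    rw [h4]
    linarith [Real.exp_nonneg (2 * (1 + |z.1| + |z.2.2|))]
  have hpt : ∀ z, Real.exp (θ * Ψ z) ≤ 1 + θ * Ψ z + θ ^ 2 * D z := by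
    intro z
    have h1 := exp_le_one_add_add_sq_mul (θ * Ψ z)
    have h2 : |θ * Ψ z| ≤ |Ψ z| := by
      rw [abs_mul]; exact mul_le_of_le_one_left (abs_nonneg _) hθ
    have h3 : (θ * Ψ z) ^ 2 * Real.exp |θ * Ψ z| ≤ θ ^ 2 * D z := by
      rw [mul_pow, mul_assoc]
      refine mul_le_mul_of_nonneg_left ?_ (sq_nonneg _)
      exact (mul_le_mul_of_nonneg_left (Real.exp_le_exp.2 h2) (sq_nonneg _)).trans (hsq z)
    linarith
  have hRi : Integrable (fun z => 1 + θ * Ψ z + θ ^ 2 * D z) γ3 :=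
    ((integrable_const _).add (hΨi.const_mul _)).add (hDi.const_mul _)
  calc ∫⁻ z, ENNReal.ofReal (Real.exp (θ * Ψ z)) ∂γ3
      ≤ ∫⁻ z, ENNReal.ofReal (1 + θ * Ψ z + θ ^ 2 * D z) ∂γ3 :=
        lintegral_mono fun z => ENNReal.ofReal_le_ofReal (hpt z)
    _ = ENNReal.ofReal (∫ z, (1 + θ * Ψ z + θ ^ 2 * D z) ∂γ3) :=
        (ofReal_integral_eq_lintegral_ofReal hRi
          (Filter.Eventually.of_forall fun z => (Real.exp_nonneg _).trans (hpt z))).symm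
    _ = _ := by
        have e1 : Integrable (fun z => 1 + θ * Ψ z) γ3 :=
          (integrable_const _).add (hΨi.const_mul _)
        rw [integral_add e1 (hDi.const_mul _),
          integral_add (integrable_const _) (hΨi.const_mul _), integral_const_mul,
          integral_const_mul, hDint]
        simp

/-! ### Rotation invariance and the mean of the ratio. -/

theorem exists_rotation {α β v : ℝ} (hv : 0 < v) (h : α ^ 2 + β ^ 2 = v ^ 2) :
    ∃ θ : ℝ, v * Real.cos θ = α ∧ v * Real.sin θ = β := by
  have hn : ‖(⟨α, β⟩ : ℂ)‖ = v := by
    rw [Complex.norm_def, Complex.normSq_mk, ← sq, ← sq, h, Real.sqrt_sq hv.le]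
  refine ⟨Complex.arg ⟨α, β⟩, ?_, ?_⟩
  · have := Complex.norm_mul_cos_arg ⟨α, β⟩
    rwa [hn] at this
  · have := Complex.norm_mul_sin_arg ⟨α, β⟩
    rwa [hn] at this

/-- A linear form in two normal variables and the form orthogonal to it may be replaced by two
independent normal variables of standard deviation `v`. -/
theorem integral_rotation {α β v : ℝ} (hv : 0 < v) (h : α ^ 2 + β ^ 2 = v ^ 2) {g : ℝ × ℝ → ℝ}
    (hg : Measurable g) :
    ∫ z, g (α * z.1 + β * z.2, α * z.2 - β * z.1) ∂(gaussianReal 0 1).prod (gaussianReal 0 1) =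
      ∫ z, g (v * z.1, v * z.2) ∂(gaussianReal 0 1).prod (gaussianReal 0 1) := by
  obtain ⟨θ, h1, h2⟩ := exists_rotation hv h
  have hrot := IsGaussian.map_rotation_eq_self (μ := gaussianReal 0 1) (by simp) θ
  conv_rhs => rw [← hrot]
  have hgm : Measurable fun z : ℝ × ℝ => g (v * z.1, v * z.2) := hg.comp (by fun_prop)
  rw [integral_map (by fun_prop) hgm.aestronglyMeasurable]
  refine integral_congr_ae (Filter.Eventually.of_forall fun z => ?_)
  simp only [ContinuousLinearMap.rotation_apply, smul_eq_mul, ← h1, ← h2]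
  congr 2 <;> ring

/-- `E[a / W ; |W| ≥ σ]` for `W` normal with mean `a` and standard deviation `v`. -/
noncomputable def meanRatio (σ v a : ℝ) : ℝ :=
  ∫ w, (if σ ≤ |a + v * w| then a / (a + v * w) else 0) ∂gaussianReal 0 1

theorem meanRatio_neg (σ v a : ℝ) : meanRatio σ v (-a) = meanRatio σ v a := by
  unfold meanRatio
  have h : (gaussianReal 0 1).map (fun x : ℝ => -x) = gaussianReal 0 1 := by
    rw [gaussianReal_map_neg, neg_zero]
  conv_rhs => rw [← h]
  rw [integral_map (by fun_prop)
    (Measurable.aestronglyMeasurable (Measurable.ite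
      (measurableSet_le measurable_const (by fun_prop)) (by fun_prop) measurable_const))]
  refine integral_congr_ae (Filter.Eventually.of_forall fun z => ?_)
  have h1 : -a + v * z = -(a + v * -z) := by ring
  simp only [h1, abs_neg, neg_div_neg_eq]

theorem gaussianPDFReal_sub_neg (a : ℝ) {v : ℝ} (u : ℝ) :
    gaussianPDFReal a (v.toNNReal ^ 2) u - gaussianPDFReal a (v.toNNReal ^ 2) (-u) =
      gaussianPDFReal a (v.toNNReal ^ 2) u * (1 - Real.exp (-(2 * a * u / v.toNNReal ^ 2))) := by
  have : gaussianPDFReal a (v.toNNReal ^ 2) (-u) =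
      gaussianPDFReal a (v.toNNReal ^ 2) u * Real.exp (-(2 * a * u / v.toNNReal ^ 2)) := by
    simp only [gaussianPDFReal]
    rw [mul_assoc _ (Real.exp _) (Real.exp _), ← Real.exp_add]
    congr 2
    push_cast
    by_cases hv : (v.toNNReal : ℝ) = 0
    · simp [hv]
    · field_simp
      ring
  rw [this]; ring

/-- Average over u and -u: the ratio a/u is odd, so the densities at u and -u get subtracted. For a
≥ 0 both factors of the new integrand have the sign of u, which makes positivity visible. -/
theorem meanRatio_eq {σ v a : ℝ} (hσ : 0 < σ) (hv : 0 < v) :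
    meanRatio σ v a = 2⁻¹ * ∫ u, (if σ ≤ |u| then a / u else 0) *
      (gaussianPDFReal a (v.toNNReal ^ 2) u * (1 - Real.exp (-(2 * a * u / v ^ 2)))) := by
  have hvn : v.toNNReal ^ 2 ≠ 0 := by simpa using hv
  have hgm : Measurable fun u : ℝ => if σ ≤ |u| then a / u else 0 :=
    Measurable.ite (measurableSet_le measurable_const (by fun_prop)) (by fun_prop) measurable_const
  set g : ℝ → ℝ := fun u => if σ ≤ |u| then a / u else 0 with hg
  set f := gaussianPDFReal a (v.toNNReal ^ 2) with hf
  have hlaw : (gaussianReal 0 1).map (fun w => a + v * w) = gaussianReal a (v.toNNReal ^ 2) := by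
    have h1 : (fun w : ℝ => a + v * w) = (fun w => a + w) ∘ fun w => v * w := rfl
    rw [h1, ← Measure.map_map (by fun_prop) (by fun_prop), gaussianReal_map_const_mul,
      gaussianReal_map_const_add]
    congr 1
    · simp
    · ext; simp [max_eq_left hv.le]
  have h1 : meanRatio σ v a = ∫ u, f u * g u := by
    have h2 : meanRatio σ v a = ∫ u, g u ∂gaussianReal a (v.toNNReal ^ 2) := by
      rw [← hlaw, integral_map (by fun_prop) hgm.aestronglyMeasurable]
      rfl
    rw [h2, integral_gaussianReal_eq_integral_smul hvn]
    rfl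
  have hgb : ∀ u, |g u| ≤ |a| / σ := by
    intro u
    simp only [hg]
    split_ifs with h
    · rw [abs_div]; gcongr
    · rw [abs_zero]; positivity
  have hi : Integrable (fun u => f u * g u) :=
    (integrable_gaussianPDFReal _ _).mul_bdd (c := |a| / σ) hgm.aestronglyMeasurable
      (Filter.Eventually.of_forall hgb)
  have hi' : Integrable fun u => f (-u) * g (-u) := hi.comp_neg
  have h3 : ∫ u, f (-u) * g (-u) = ∫ u, f u * g u :=
    integral_neg_eq_self (fun u => f u * g u) volume
  have h4 : meanRatio σ v a = 2⁻¹ * ∫ u, (f u * g u + f (-u) * g (-u)) := by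
    rw [integral_add hi hi', h3, ← h1]; ring
  rw [h4]
  congr 1
  refine integral_congr_ae (Filter.Eventually.of_forall fun u => ?_)
  have h5 : g (-u) = -g u := by
    simp only [hg, abs_neg]
    split_ifs <;> simp [div_neg]
  have h6 := gaussianPDFReal_sub_neg a (v := v) u
  have h7 : ((v.toNNReal : ℝ)) = v := Real.coe_toNNReal v hv.le
  rw [h7] at h6
  dsimp only
  rw [h5, ← h6]
  ring

theorem meanRatio_integrand_nonneg {σ v a : ℝ} (ha : 0 ≤ a) (u : ℝ) :
    0 ≤ (if σ ≤ |u| then a / u else 0) *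
      (gaussianPDFReal a (v.toNNReal ^ 2) u * (1 - Real.exp (-(2 * a * u / v ^ 2)))) := by
  have hf := gaussianPDFReal_nonneg a (v.toNNReal ^ 2) u
  split_ifs
  · rcases le_total 0 u with hu | hu
    · refine mul_nonneg (by positivity) (mul_nonneg hf (sub_nonneg.2 (Real.exp_le_one_iff.2 ?_)))
      have : 0 ≤ 2 * a * u / v ^ 2 := by positivity
      linarith
    · refine mul_nonneg_of_nonpos_of_nonpos (div_nonpos_of_nonneg_of_nonpos ha hu)
        (mul_nonpos_of_nonneg_of_nonpos hf (sub_nonpos.2 (Real.one_le_exp ?_)))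
      have : 2 * a * u / v ^ 2 ≤ 0 := by
        refine div_nonpos_of_nonpos_of_nonneg (mul_nonpos_of_nonneg_of_nonpos (by positivity) hu)
          (by positivity)
      linarith
  · simp

theorem meanRatio_nonneg {σ v : ℝ} (hσ : 0 < σ) (hv : 0 < v) (a : ℝ) : 0 ≤ meanRatio σ v a := by
  rcases le_total 0 a with ha | ha
  · rw [meanRatio_eq hσ hv]
    exact mul_nonneg (by norm_num) (integral_nonneg (meanRatio_integrand_nonneg ha))
  · rw [← meanRatio_neg, meanRatio_eq hσ hv]
    exact mul_nonneg (by norm_num) (integral_nonneg (meanRatio_integrand_nonneg (by linarith)))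

/-- A lower bound for the mean ratio of a state whose drift is at least `c` noise levels. -/
noncomputable def ratioConst (c : ℝ) : ℝ :=
  c * (1 - Real.exp (-c)) * Real.exp (-2) / (8 * √Real.pi)

theorem ratioConst_pos {c : ℝ} (hc : 0 < c) : 0 < ratioConst c := by
  have h1 : 0 < 1 - Real.exp (-c) := sub_pos.2 (Real.exp_lt_one_iff.2 (by linarith))
  have := Real.pi_pos
  unfold ratioConst
  positivity

/-- The integrand is nonnegative, so it suffices to integrate over an interval of length s starting
at max(a, s). There a/u ≥ c/2, the density is at least of order 1/s because u is within 2s of a, and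
the exponential factor is at least 1 - e^{-c}; s cancels. -/
theorem le_meanRatio_of_pos {σ v a s c : ℝ} (hσ : 0 < σ) (hs : σ ≤ s) (hv : 0 < v)
    (hvs : s ^ 2 ≤ v ^ 2) (hvs' : v ^ 2 ≤ 2 * s ^ 2) (hc : 0 < c) (hc1 : c ≤ 1) (ha : c * s ≤ a) :
    ratioConst c ≤ meanRatio σ v a := by
  have hs0 : 0 < s := hσ.trans_le hs
  have ha0 : 0 < a := lt_of_lt_of_le (by positivity) ha
  have hvn : v.toNNReal ^ 2 ≠ 0 := by simpa using hv
  have h7 : ((v.toNNReal : ℝ)) = v := Real.coe_toNNReal v hv.le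
  rw [meanRatio_eq hσ hv]
  set F : ℝ → ℝ := fun u => (if σ ≤ |u| then a / u else 0) *
      (gaussianPDFReal a (v.toNNReal ^ 2) u * (1 - Real.exp (-(2 * a * u / v ^ 2)))) with hF
  set w := max a s with hw
  set K := c / 2 * (Real.exp (-2) / (2 * √Real.pi * s) * (1 - Real.exp (-c))) with hK
  have hec : 0 < 1 - Real.exp (-c) := sub_pos.2 (Real.exp_lt_one_iff.2 (by linarith))
  have hlow : ∀ u ∈ Set.Icc w (w + s), K ≤ F u := by
    rintro u ⟨h1, h2⟩
    have hau : a ≤ u := (le_max_left _ _).trans h1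
    have hsu : s ≤ u := (le_max_right _ _).trans h1
    have hu0 : 0 < u := hs0.trans_le hsu
    have hsa : s ≤ a / c := by rw [le_div_iff₀ hc]; linarith
    have hwa : w ≤ a / c := max_le (by rw [le_div_iff₀ hc]; nlinarith) hsa
    have hratio : c / 2 ≤ a / u := by
      rw [div_le_div_iff₀ two_pos hu0]
      have : u ≤ 2 * (a / c) := by linarith
      calc c * u ≤ c * (2 * (a / c)) := by gcongr
        _ = a * 2 := by field_simp
    have hexp : 1 - Real.exp (-c) ≤ 1 - Real.exp (-(2 * a * u / v ^ 2)) := by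
      have : c ≤ 2 * a * u / v ^ 2 := by
        rw [le_div_iff₀ (by positivity)]
        calc c * v ^ 2 ≤ c * (2 * s ^ 2) := by gcongr
          _ = 2 * (c * s) * s := by ring
          _ ≤ 2 * a * u := by gcongr
      have := Real.exp_le_exp.2 (neg_le_neg this)
      linarith
    have hdist : (u - a) ^ 2 ≤ 4 * s ^ 2 := by
      have : u - a ≤ 2 * s := by
        rcases le_total a s with h | h
        · rw [hw, max_eq_right h] at h2; linarith
        · rw [hw, max_eq_left h] at h2; linarith
      nlinarith
    have hpdf : Real.exp (-2) / (2 * √Real.pi * s) ≤ gaussianPDFReal a (v.toNNReal ^ 2) u := by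
      rw [gaussianPDFReal]
      push_cast
      rw [h7, div_eq_inv_mul]
      have hpi := Real.pi_pos
      have e1 : (2 * √Real.pi * s)⁻¹ ≤ (√(2 * Real.pi * v ^ 2))⁻¹ := by
        refine inv_anti₀ (by positivity) (Real.sqrt_le_iff.2 ⟨by positivity, ?_⟩)
        rw [mul_pow, mul_pow, Real.sq_sqrt hpi.le]
        nlinarith
      have e2 : Real.exp (-2) ≤ Real.exp (-(u - a) ^ 2 / (2 * v ^ 2)) := by
        refine Real.exp_le_exp.2 ?_
        rw [le_div_iff₀ (by positivity)]
        nlinarith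
      exact mul_le_mul e1 e2 (Real.exp_nonneg _) (by positivity)
    have hσu : σ ≤ |u| := by rw [abs_of_pos hu0]; linarith
    simp only [hF, if_pos hσu, hK]
    have hpi := Real.pi_pos
    have hp0 : 0 ≤ gaussianPDFReal a (v.toNNReal ^ 2) u := gaussianPDFReal_nonneg _ _ _
    refine mul_le_mul hratio (mul_le_mul hpdf hexp hec.le hp0) (by positivity) (by positivity)
  have hFi : Integrable F := by
    have hgm : Measurable fun u : ℝ => if σ ≤ |u| then a / u else 0 :=
      Measurable.ite (measurableSet_le measurable_const (by fun_prop)) (by fun_prop)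
        measurable_const
    have hb : ∀ u, ‖if σ ≤ |u| then a / u else 0‖ ≤ |a| / σ := by
      intro u
      rw [Real.norm_eq_abs]
      split_ifs with h
      · rw [abs_div]; gcongr
      · rw [abs_zero]; positivity
    refine Integrable.bdd_mul (c := |a| / σ) ?_ hgm.aestronglyMeasurable
      (Filter.Eventually.of_forall hb)
    have e : (fun u => gaussianPDFReal a (v.toNNReal ^ 2) u *
        (1 - Real.exp (-(2 * a * u / v ^ 2)))) = fun u =>
        gaussianPDFReal a (v.toNNReal ^ 2) u - gaussianPDFReal a (v.toNNReal ^ 2) (-u) := by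
      funext u
      rw [gaussianPDFReal_sub_neg, h7]
    rw [e]
    exact (integrable_gaussianPDFReal _ _).sub (integrable_gaussianPDFReal _ _).comp_neg
  have h1 : s * K ≤ ∫ u, F u := by
    calc s * K = ∫ u in Set.Icc w (w + s), K := by
          rw [setIntegral_const, measureReal_def, Real.volume_Icc]
          simp [hs0.le]
      _ ≤ ∫ u in Set.Icc w (w + s), F u :=
          setIntegral_mono_on (integrableOn_const (by simp)) hFi.integrableOn measurableSet_Icc hlow
      _ ≤ ∫ u, F u := setIntegral_le_integral hFi
          (Filter.Eventually.of_forall (meanRatio_integrand_nonneg ha0.le))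
  calc ratioConst c ≤ 2⁻¹ * (s * K) := by
        rw [hK, ratioConst]
        have hpi : 0 < √Real.pi := Real.sqrt_pos.2 Real.pi_pos
        refine le_of_eq ?_
        field_simp
        norm_num
    _ ≤ _ := by gcongr

theorem le_meanRatio {σ v a s c : ℝ} (hσ : 0 < σ) (hs : σ ≤ s) (hv : 0 < v)
    (hvs : s ^ 2 ≤ v ^ 2) (hvs' : v ^ 2 ≤ 2 * s ^ 2) (hc : 0 < c) (hc1 : c ≤ 1)
    (ha : c * s ≤ |a|) : ratioConst c ≤ meanRatio σ v a := by
  rcases abs_cases a with ⟨h, -⟩ | ⟨h, -⟩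
  · exact le_meanRatio_of_pos hσ hs hv hvs hvs' hc hc1 (h ▸ ha)
  · rw [← meanRatio_neg]
    exact le_meanRatio_of_pos hσ hs hv hvs hvs' hc hc1 (h ▸ ha)

/-- The test statistic as a function of the three relevant noises, when only `i`, then only `j`, then
only `i` is updated among `i`, `j` and their neighbours. -/
noncomputable def idealStat (bij bji si sj a σ : ℝ) (z : ℝ × ℝ × ℝ) : ℝ :=
  if σ ≤ |a + bji * si * z.1 + sj * z.2.1| then
    bij + si * (z.2.2 - z.1) / (a + bji * si * z.1 + sj * z.2.1) else 0

theorem measurable_idealStat (bij bji si sj a σ : ℝ) :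
    Measurable (idealStat bij bji si sj a σ) := by
  unfold idealStat
  exact Measurable.ite (measurableSet_le measurable_const (by fun_prop)) (by fun_prop)
    measurable_const

theorem abs_idealStat_le {bij bji si sj a σ : ℝ} (hσ : 0 < σ) (hsi : 0 ≤ si) (z : ℝ × ℝ × ℝ) :
    |idealStat bij bji si sj a σ z| ≤ |bij| + si / σ * (|z.1| + |z.2.2|) := by
  unfold idealStat
  split_ifs with h
  · refine (abs_add_le _ _).trans (add_le_add_right ?_ _)
    rw [abs_div, abs_mul, abs_of_nonneg hsi, mul_div_assoc, div_mul_eq_mul_div, mul_div_assoc]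
    refine mul_le_mul_of_nonneg_left ?_ hsi
    refine div_le_div₀ (by positivity) ?_ hσ h
    rw [add_comm]
    exact abs_sub _ _
  · rw [abs_zero]; positivity

/-- The noise z₃ is centred and independent of the denominator W, so it drops out. The noise z₁ is a
multiple of W - a plus a centred variable independent of W, which drops out too. `P` is the
probability of |W| ≥ σ; only its sign is used later. -/
theorem integral_idealStat {bij bji si sj a σ : ℝ} (hσ : 0 < σ) (hsj : 0 < sj)
    (hsymm : bji * si ^ 2 = bij * sj ^ 2) :
    ∃ P : ℝ, 0 ≤ P ∧ ∫ z, idealStat bij bji si sj a σ z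
      ∂(gaussianReal 0 1).prod ((gaussianReal 0 1).prod (gaussianReal 0 1)) =
      bij / (1 + bij * bji) * (bij * bji * P +
        meanRatio σ (sj * √(1 + bij * bji)) a) := by
  set γ := gaussianReal 0 1 with hγ
  have hb : bji * bji * si ^ 2 = bij * bji * sj ^ 2 := by rw [mul_assoc, hsymm]; ring
  have hb0 : 0 ≤ bij * bji := by
    have h1 : 0 ≤ bji * bji * si ^ 2 := mul_nonneg (mul_self_nonneg _) (sq_nonneg _)
    rw [hb] at h1
    exact nonneg_of_mul_nonneg_left h1 (by positivity)
  -- The standard deviation of W, because the symmetry gives (bji si)² = bij bji sj².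
  set v := sj * √(1 + bij * bji) with hv
  have hv0 : 0 < v := by positivity
  have hv2 : v ^ 2 = sj ^ 2 * (1 + bij * bji) := by
    rw [hv, mul_pow, Real.sq_sqrt (by positivity)]
  have hrot : (bji * si) ^ 2 + sj ^ 2 = v ^ 2 := by rw [hv2]; nlinarith
  set f : ℝ → ℝ := fun u => if σ ≤ |u| then u⁻¹ else 0 with hf
  set B : ℝ → ℝ := fun u => if σ ≤ |u| then 1 else 0 with hB
  have hset : MeasurableSet {u : ℝ | σ ≤ |u|} := measurableSet_le measurable_const (by fun_prop)
  have hfm : Measurable f := Measurable.ite hset (by fun_prop) measurable_const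
  have hBm : Measurable B := Measurable.ite hset measurable_const measurable_const
  have hfb : ∀ u, ‖f u‖ ≤ σ⁻¹ := by
    intro u
    rw [Real.norm_eq_abs]
    simp only [hf]
    split_ifs with h
    · rw [abs_inv]; exact inv_anti₀ hσ h
    · rw [abs_zero]; positivity
  have hBb : ∀ u, ‖B u‖ ≤ 1 := by
    intro u
    simp only [hB]
    split_ifs <;> simp
  set W : ℝ × ℝ → ℝ := fun z => a + (bji * si * z.1 + sj * z.2) with hW
  have hWm : Measurable W := by fun_prop
  have hidint : Integrable (fun z : ℝ => z) γ := by
    have := (memLp_id_gaussianReal (μ := 0) (v := 1) 1).integrable le_rfl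
    exact this
  have hid0 : ∫ z, z ∂γ = 0 := integral_id_gaussianReal
  have hfst : Integrable (fun z : ℝ × ℝ => z.1) (γ.prod γ) := hidint.comp_fst γ
  have hsnd : Integrable (fun z : ℝ × ℝ => z.2) (γ.prod γ) := hidint.comp_snd γ
  have hi1 : Integrable (fun z => B (W z)) (γ.prod γ) :=
    Integrable.of_bound (hBm.comp hWm).aestronglyMeasurable 1
      (Filter.Eventually.of_forall fun z => hBb _)
  have hi2 : Integrable (fun z => f (W z)) (γ.prod γ) :=
    Integrable.of_bound (hfm.comp hWm).aestronglyMeasurable σ⁻¹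
      (Filter.Eventually.of_forall fun z => hfb _)
  have hi3 : Integrable (fun z => f (W z) * (sj * z.1 - bji * si * z.2)) (γ.prod γ) :=
    ((hfst.const_mul _).sub (hsnd.const_mul _)).bdd_mul (c := σ⁻¹)
      (hfm.comp hWm).aestronglyMeasurable (Filter.Eventually.of_forall fun z => hfb _)
  have hi4 : Integrable (fun z : ℝ × ℝ => f (W z) * z.1) (γ.prod γ) :=
    hfst.bdd_mul (c := σ⁻¹) (hfm.comp hWm).aestronglyMeasurable
      (Filter.Eventually.of_forall fun z => hfb _)
  -- After rotation the first factor depends on one coordinate and the second is, up to sign, a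
  -- multiple of the other, centred coordinate.
  have horth : ∫ z, f (W z) * (sj * z.1 - bji * si * z.2) ∂γ.prod γ = 0 := by
    have h1 := integral_rotation hv0 hrot (g := fun w => f (a + w.1) * -w.2)
      ((hfm.comp (by fun_prop)).mul (by fun_prop))
    have h2 : ∫ z : ℝ × ℝ, f (a + v * z.1) * -(v * z.2) ∂γ.prod γ = 0 := by
      rw [integral_prod_mul (fun x => f (a + v * x)) (fun y => -(v * y)), integral_neg,
        integral_const_mul, hid0]
      simp
    rw [← h2, ← h1]
    refine integral_congr_ae (Filter.Eventually.of_forall fun z => ?_)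
    simp only [hW]
    ring
  have hmean : a * ∫ z, f (W z) ∂γ.prod γ = meanRatio σ v a := by
    have h1 := integral_rotation hv0 hrot (g := fun w => f (a + w.1)) (hfm.comp (by fun_prop))
    have h2 : ∫ z, f (W z) ∂γ.prod γ = ∫ z : ℝ × ℝ, f (a + v * z.1) ∂γ.prod γ := h1
    have h3 : ∫ z : ℝ × ℝ, f (a + v * z.1) ∂γ.prod γ = ∫ x, f (a + v * x) ∂γ := by
      rw [integral_fun_fst (fun x => f (a + v * x))]; simp
    rw [h2, h3, ← integral_const_mul, meanRatio]
    refine integral_congr_ae (Filter.Eventually.of_forall fun z => ?_)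
    simp only [hf]
    split_ifs <;> simp [div_eq_mul_inv]
  have hΨi : Integrable (idealStat bij bji si sj a σ) (γ.prod (γ.prod γ)) := by
    have g1 : Integrable (fun z : ℝ × ℝ × ℝ => z.1) (γ.prod (γ.prod γ)) := hidint.comp_fst _
    have g2 : Integrable (fun z : ℝ × ℝ × ℝ => z.2.2) (γ.prod (γ.prod γ)) := hsnd.comp_snd γ
    have hm : Measurable fun z : ℝ × ℝ × ℝ => W (z.1, z.2.1) := by fun_prop
    have g3 : Integrable (fun z : ℝ × ℝ × ℝ => bij * B (W (z.1, z.2.1)) +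
        f (W (z.1, z.2.1)) * (si * (z.2.2 - z.1))) (γ.prod (γ.prod γ)) := by
      refine Integrable.add (Integrable.const_mul (Integrable.of_bound
        (hBm.comp hm).aestronglyMeasurable 1 (Filter.Eventually.of_forall fun z => hBb _)) _) ?_
      exact ((g2.sub g1).const_mul _).bdd_mul (c := σ⁻¹) (hfm.comp hm).aestronglyMeasurable
        (Filter.Eventually.of_forall fun z => hfb _)
    refine g3.congr (Filter.Eventually.of_forall fun z => ?_)
    simp only [idealStat, hB, hf, hW, ← add_assoc]
    split_ifs
    · rw [div_eq_mul_inv]; ring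
    · ring
  have hstep : ∫ z, idealStat bij bji si sj a σ z ∂γ.prod (γ.prod γ) =
      ∫ z : ℝ × ℝ, (bij * B (W z) - si * (f (W z) * z.1)) ∂γ.prod γ := by
    have hi5 : Integrable (fun z : ℝ × ℝ => bij * B (W z) - si * (f (W z) * z.1)) (γ.prod γ) :=
      (hi1.const_mul _).sub (hi4.const_mul _)
    rw [integral_prod _ hΨi, integral_prod _ hi5]
    refine integral_congr_ae ?_
    filter_upwards [hΨi.prod_right_ae] with x hx
    rw [integral_prod _ hx]
    refine integral_congr_ae (Filter.Eventually.of_forall fun y => ?_)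
    have e : ∀ z, idealStat bij bji si sj a σ (x, y, z) =
        (bij * B (W (x, y)) - si * (f (W (x, y)) * x)) + si * f (W (x, y)) * z := by
      intro z
      simp only [idealStat, hB, hf, hW, ← add_assoc]
      split_ifs
      · rw [div_eq_mul_inv]; ring
      · ring
    simp only [e]
    rw [integral_add (integrable_const _) (hidint.const_mul _), integral_const_mul, hid0]
    simp
  have hb1 : 0 < 1 + bij * bji := by linarith
  -- Insert v² z₁ = bji si (W - a) + sj (sj z₁ - bji si z₂) and f(W) W = B(W).
  have hdec : ∀ z : ℝ × ℝ, bij * B (W z) - si * (f (W z) * z.1) =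
      bij / (1 + bij * bji) * (bij * bji * B (W z) + a * f (W z)) -
        si * sj / v ^ 2 * (f (W z) * (sj * z.1 - bji * si * z.2)) := by
    intro z
    have e1 : f (W z) * W z = B (W z) := by
      simp only [hf, hB]
      split_ifs with h
      · have : W z ≠ 0 := by
          intro h0; rw [h0, abs_zero] at h; linarith
        exact inv_mul_cancel₀ this
      · simp
    have e2 : bij / (1 + bij * bji) = bji * si ^ 2 / v ^ 2 := by
      rw [hv2, hsymm]; field_simp
    have e3 : W z = a + (bji * si * z.1 + sj * z.2) := rfl
    have e4 : bij * B (W z) = bij / (1 + bij * bji) * (bij * bji * B (W z) + B (W z)) := by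
      field_simp
      ring
    rw [e4]
    have e5 : bij / (1 + bij * bji) * (bij * bji * B (W z) + B (W z)) =
        bij / (1 + bij * bji) * (bij * bji * B (W z) + a * f (W z)) +
        bij / (1 + bij * bji) * (f (W z) * (bji * si * z.1 + sj * z.2)) := by
      rw [← mul_add, add_assoc, ← e1, e3]
      ring
    rw [e5, e2]
    field_simp
    rw [← hrot]
    ring
  refine ⟨∫ z, B (W z) ∂γ.prod γ, integral_nonneg fun z => ?_, ?_⟩
  · simp only [hB, Pi.zero_apply]
    split_ifs <;> norm_num
  · have hi6 : Integrable (fun z => bij * bji * B (W z) + a * f (W z)) (γ.prod γ) :=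
      (hi1.const_mul _).add (hi2.const_mul _)
    rw [hstep, integral_congr_ae (Filter.Eventually.of_forall hdec),
      integral_sub (hi6.const_mul _) (hi3.const_mul _),
      integral_const_mul, integral_const_mul, integral_add (hi1.const_mul _) (hi2.const_mul _),
      integral_const_mul, integral_const_mul, horth, hmean]
    ring

end

section

variable {p : ℕ}

/-! ### The test statistic of one window -/

/-- In `[a, c)` node `i` is updated but no node of `L` is. -/
def Solo (i : Fin p) (L : Finset (Fin p)) (a c : ℝ) (ω : ℕ → ℝ × Fin p × ℝ) : Prop :=
  Updated i a c ω ∧ ∀ l ∈ L, ¬ Updated l a c ω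

/-- In the three consecutive intervals of length `r` from time `t` on, the nodes of `{i, j} ∪ V` that
are updated are `i` only, `j` only, and `i` only. -/
def Pattern (i j : Fin p) (V : Finset (Fin p)) (r t : ℝ) (ω : ℕ → ℝ × Fin p × ℝ) : Prop :=
  Solo i (insert j V) t (t + r) ω ∧ Solo j (insert i V) (t + r) (t + 2 * r) ω ∧
    Solo i (insert j V) (t + 2 * r) (t + 3 * r) ω

theorem measurableSet_solo (i : Fin p) (L : Finset (Fin p)) (a c : ℝ) :
    MeasurableSet {ω | Solo i L a c ω} := by
  have : {ω : ℕ → ℝ × Fin p × ℝ | Solo i L a c ω} =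
      {ω | Updated i a c ω} ∩ ⋂ l, ⋂ (_ : l ∈ L), {ω | Updated l a c ω}ᶜ := by
    ext ω; simp [Solo]
  rw [this]
  exact (measurableSet_updated i a c).inter (MeasurableSet.iInter fun l =>
    MeasurableSet.iInter fun _ => (measurableSet_updated l a c).compl)

theorem measurableSet_pattern (i j : Fin p) (V : Finset (Fin p)) (r t : ℝ) :
    MeasurableSet {ω | Pattern i j V r t ω} :=
  (measurableSet_solo _ _ _ _).inter ((measurableSet_solo _ _ _ _).inter
    (measurableSet_solo _ _ _ _))

theorem Pattern.mono {i j : Fin p} {V V' : Finset (Fin p)} {r t : ℝ} {ω : ℕ → ℝ × Fin p × ℝ}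
    (h : Pattern i j V r t ω) (hV : V' ⊆ V) : Pattern i j V' r t ω :=
  ⟨⟨h.1.1, fun l hl => h.1.2 l (Finset.insert_subset_insert _ hV hl)⟩,
    ⟨h.2.1.1, fun l hl => h.2.1.2 l (Finset.insert_subset_insert _ hV hl)⟩,
    ⟨h.2.2.1, fun l hl => h.2.2.2 l (Finset.insert_subset_insert _ hV hl)⟩⟩

theorem solo_renoise (i : Fin p) (L : Finset (Fin p)) (a c : ℝ) (ω : ℕ → ℝ × Fin p × ℝ) (k : ℕ)
    (z : ℝ) : Solo i L a c (renoise k ω z) ↔ Solo i L a c ω := by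
  simp only [Solo, updated_renoise]

section Stitch

variable {ω ω' : ℕ → ℝ × Fin p × ℝ}

theorem solo_stitch_add (h : Regular ω) (h' : Regular ω') {t a c : ℝ}
    (ht : 0 ≤ t) (ha : 0 ≤ a) (hc : 0 ≤ c) (i : Fin p) (L : Finset (Fin p)) :
    Solo i L (t + a) (t + c) (fun n => stitch n t ω ω') ↔ Solo i L a c ω' := by
  simp only [Solo, updated_stitch_add h h' ht ha hc]

theorem solo_stitch_of_le (h : Regular ω) (h' : Regular ω') {t a c : ℝ}
    (ht : 0 ≤ t) (ha : a ≤ t) (hc : c ≤ t) (i : Fin p) (L : Finset (Fin p)) :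
    Solo i L a c (fun n => stitch n t ω ω') ↔ Solo i L a c ω := by
  simp only [Solo, updated_stitch_of_le h h' ht ha hc]

theorem pattern_stitch_add (h : Regular ω) (h' : Regular ω') {t a r : ℝ}
    (ht : 0 ≤ t) (ha : 0 ≤ a) (hr : 0 ≤ r) (i j : Fin p) (V : Finset (Fin p)) :
    Pattern i j V r (t + a) (fun n => stitch n t ω ω') ↔ Pattern i j V r a ω' := by
  simp only [Pattern, add_assoc t]
  rw [solo_stitch_add h h' ht ha (by positivity), solo_stitch_add h h' ht (by positivity)
    (by positivity), solo_stitch_add h h' ht (by positivity) (by positivity)]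

theorem pattern_stitch_of_le (h : Regular ω) (h' : Regular ω') {t a r : ℝ}
    (ht : 0 ≤ t) (hr : 0 ≤ r) (ha : a + 3 * r ≤ t) (i j : Fin p) (V : Finset (Fin p)) :
    Pattern i j V r a (fun n => stitch n t ω ω') ↔ Pattern i j V r a ω := by
  simp only [Pattern]
  rw [solo_stitch_of_le h h' ht (by linarith) (by linarith),
    solo_stitch_of_le h h' ht (by linarith) (by linarith),
    solo_stitch_of_le h h' ht (by linarith) (by linarith)]

/-- Restarting at both inner boundaries gives each third its own independent driving sequence, and
the three conditions separate. -/
theorem pattern_stitch_stitch {ω'' : ℕ → ℝ × Fin p × ℝ} (h : Regular ω) (h' : Regular ω')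
    (h'' : Regular ω'') {r : ℝ} (hr : 0 ≤ r) (i j : Fin p) (V : Finset (Fin p)) :
    Pattern i j V r 0 (fun n => stitch n r ω fun m => stitch m r ω' ω'') ↔
      Solo i (insert j V) 0 r ω ∧ Solo j (insert i V) 0 r ω' ∧ Solo i (insert j V) 0 r ω'' := by
  have h2 := regular_stitch h' h'' hr
  have e1 : (0 : ℝ) + 2 * r = r + r := by ring
  have e2 : (0 : ℝ) + 3 * r = r + (r + r) := by ring
  rw [Pattern, e1, e2, zero_add, solo_stitch_of_le h h2 hr hr le_rfl]
  have h3 := solo_stitch_add h h2 hr le_rfl hr j (insert i V)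
  have h4 := solo_stitch_add h h2 hr hr (add_nonneg hr hr) i (insert j V)
  have h5 := solo_stitch_add h' h'' hr le_rfl hr i (insert j V)
  rw [add_zero] at h3 h5
  rw [h3, h4, h5, solo_stitch_of_le h' h'' hr hr le_rfl]

end Stitch

theorem driveLaw_solo [NeZero p] {i : Fin p} {L : Finset (Fin p)} (hi : i ∉ L) {r : ℝ} (hr : 0 ≤ r) :
    driveLaw p {ω | Solo i L 0 r ω} =
      ENNReal.ofReal ((1 - Real.exp (-r)) * Real.exp (-(L.card * r))) :=
  driveLaw_updated_not_updated hi hr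

/-- The probability of a pattern with `m` further nodes at rest. -/
noncomputable def patternProb (r : ℝ) (m : ℕ) : ℝ :=
  ((1 - Real.exp (-r)) * Real.exp (-((m + 1 : ℕ) * r))) ^ 3

theorem patternProb_nonneg {r : ℝ} (hr : 0 ≤ r) (m : ℕ) : 0 ≤ patternProb r m := by
  have : 0 ≤ 1 - Real.exp (-r) := sub_nonneg.2 (Real.exp_le_one_iff.2 (by linarith))
  unfold patternProb
  positivity

/-- The thirds become independent after two restarts. Within each, the condition on updated nodes
ignores the noises, so the last noise is standard normal independently of it
(`lintegral_lastNoise`). Given the pattern, the three noises are therefore i.i.d. standard normal.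
-/
theorem lintegral_pattern [NeZero p] {i j : Fin p} (hij : i ≠ j) {V : Finset (Fin p)} (hi : i ∉ V)
    (hj : j ∉ V) {r : ℝ} (hr : 0 ≤ r) {F : (ℕ → ℝ × Fin p × ℝ) → ℝ≥0∞} (hF : Measurable F)
    {f : ℝ × ℝ × ℝ → ℝ≥0∞} (hf : Measurable f)
    (hFf : ∀ ω ω' ω'', Regular ω → Regular ω' → Regular ω'' → Solo i (insert j V) 0 r ω →
      Solo j (insert i V) 0 r ω' → Solo i (insert j V) 0 r ω'' →
      F (fun n => stitch n r ω fun m => stitch m r ω' ω'') =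
        f (lastNoise i r ω, lastNoise j r ω', lastNoise i r ω'')) :
    ∫⁻ ω in {ω | Pattern i j V r 0 ω}, F ω ∂driveLaw p =
      ENNReal.ofReal (patternProb r V.card) * ∫⁻ z, f z
        ∂(gaussianReal 0 1).prod ((gaussianReal 0 1).prod (gaussianReal 0 1)) := by
  set γ := gaussianReal 0 1
  have hP := measurableSet_pattern i j V r 0
  set S := {ω : ℕ → ℝ × Fin p × ℝ | Solo i (insert j V) 0 r ω} with hSdef
  set S' := {ω : ℕ → ℝ × Fin p × ℝ | Solo j (insert i V) 0 r ω} with hSdef'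
  have hS : MeasurableSet S := measurableSet_solo _ _ _ _
  have hS' : MeasurableSet S' := measurableSet_solo _ _ _ _
  have hPF := hF.indicator hP
  rw [← lintegral_indicator hP, lintegral_stitch hr hPF]
  have h1 : ∀ ω, ∫⁻ ω', {ω | Pattern i j V r 0 ω}.indicator F (fun n => stitch n r ω ω')
      ∂driveLaw p = ∫⁻ ω', ∫⁻ ω'', {ω | Pattern i j V r 0 ω}.indicator F
        (fun n => stitch n r ω fun m => stitch m r ω' ω'') ∂driveLaw p ∂driveLaw p := fun ω =>
    lintegral_stitch hr (F := fun ω' => {ω | Pattern i j V r 0 ω}.indicator F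
      (fun n => stitch n r ω ω')) (hPF.comp (by fun_prop))
  rw [lintegral_congr h1]
  have hin : ∀ z, Measurable fun y : ℝ => ∫⁻ z', f (z, y, z') ∂γ := fun z =>
    Measurable.lintegral_prod_right' (f := fun q : ℝ × ℝ => f (z, q.1, q.2)) (hf.comp (by fun_prop))
  have hout : Measurable fun z : ℝ => ∫⁻ y, ∫⁻ z', f (z, y, z') ∂γ ∂γ := by
    refine Measurable.lintegral_prod_right' (f := fun q : ℝ × ℝ => ∫⁻ z', f (q.1, q.2, z') ∂γ) ?_
    exact Measurable.lintegral_prod_right' (f := fun q : (ℝ × ℝ) × ℝ => f (q.1.1, q.1.2, q.2))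
      (hf.comp (by fun_prop))
  have h2 : ∀ᵐ ω ∂driveLaw p, ∫⁻ ω', ∫⁻ ω'', {ω | Pattern i j V r 0 ω}.indicator F
        (fun n => stitch n r ω fun m => stitch m r ω' ω'') ∂driveLaw p ∂driveLaw p =
      S.indicator (fun ω => driveLaw p S' * (driveLaw p S *
        ∫⁻ y, ∫⁻ z', f (lastNoise i r ω, y, z') ∂γ ∂γ)) ω := by
    filter_upwards [ae_regular (p := p)] with ω hω
    by_cases hωS : ω ∈ S
    · rw [Set.indicator_of_mem hωS]
      have h3 : ∀ᵐ ω' ∂driveLaw p, ∫⁻ ω'', {ω | Pattern i j V r 0 ω}.indicator F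
          (fun n => stitch n r ω fun m => stitch m r ω' ω'') ∂driveLaw p =
          S'.indicator (fun ω' => driveLaw p S *
            ∫⁻ z', f (lastNoise i r ω, lastNoise j r ω', z') ∂γ) ω' := by
        filter_upwards [ae_regular (p := p)] with ω' hω'
        by_cases hωS' : ω' ∈ S'
        · rw [Set.indicator_of_mem hωS', ← lintegral_lastNoise i r hS
            (fun ω k z => solo_renoise _ _ _ _ ω k z)
            (f := fun z' => f (lastNoise i r ω, lastNoise j r ω', z')) (hf.comp (by fun_prop)),
            ← lintegral_indicator hS]
          refine lintegral_congr_ae ?_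
          filter_upwards [ae_regular (p := p)] with ω'' hω''
          have hiff := pattern_stitch_stitch hω hω' hω'' hr i j V
          by_cases hωS'' : ω'' ∈ S
          · rw [Set.indicator_of_mem hωS'', Set.indicator_of_mem
              (by exact hiff.2 ⟨hωS, hωS', hωS''⟩)]
            exact hFf ω ω' ω'' hω hω' hω'' hωS hωS' hωS''
          · rw [Set.indicator_of_notMem hωS'', Set.indicator_of_notMem
              (by exact fun h => hωS'' (hiff.1 h).2.2)]
        · rw [Set.indicator_of_notMem hωS']
          refine (lintegral_congr_ae ?_).trans lintegral_zero
          filter_upwards [ae_regular (p := p)] with ω'' hω''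
          rw [Set.indicator_of_notMem
            (by exact fun h => hωS' ((pattern_stitch_stitch hω hω' hω'' hr i j V).1 h).2.1)]
      rw [lintegral_congr_ae h3, lintegral_indicator hS', lintegral_const_mul,
        lintegral_lastNoise j r hS' (fun ω k z => solo_renoise _ _ _ _ ω k z)
          (f := fun y => ∫⁻ z', f (lastNoise i r ω, y, z') ∂γ) (hin _)]
      · ring
      · exact (hin _).comp (measurable_lastNoise j r)
    · rw [Set.indicator_of_notMem hωS]
      refine (lintegral_congr_ae ?_).trans lintegral_zero
      filter_upwards [ae_regular (p := p)] with ω' hω'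
      refine (lintegral_congr_ae ?_).trans lintegral_zero
      filter_upwards [ae_regular (p := p)] with ω'' hω''
      rw [Set.indicator_of_notMem
        (by exact fun h => hωS ((pattern_stitch_stitch hω hω' hω'' hr i j V).1 h).1)]
  have hc1 : i ∉ insert j V := by simp [hij, hi]
  have hc2 : j ∉ insert i V := by simp [hij.symm, hj]
  have h0 : 0 ≤ 1 - Real.exp (-r) := sub_nonneg.2 (Real.exp_le_one_iff.2 (by linarith))
  rw [lintegral_congr_ae h2, lintegral_indicator hS, lintegral_const_mul, lintegral_const_mul,
    lintegral_lastNoise i r hS (fun ω k z => solo_renoise _ _ _ _ ω k z)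
      (f := fun z => ∫⁻ y, ∫⁻ z', f (z, y, z') ∂γ ∂γ) hout, hSdef, hSdef', driveLaw_solo hc1 hr,
    driveLaw_solo hc2 hr, Finset.card_insert_of_notMem hj, Finset.card_insert_of_notMem hi,
    lintegral_prod _ hf.aemeasurable]
  · have h5 : ∀ x, ∫⁻ y, f (x, y) ∂γ.prod γ = ∫⁻ y, ∫⁻ z', f (x, y, z') ∂γ ∂γ := fun x =>
      lintegral_prod _ (hf.comp (by fun_prop)).aemeasurable
    rw [lintegral_congr h5, patternProb, ENNReal.ofReal_pow (by positivity)]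
    ring
  · exact hout.comp (measurable_lastNoise i r)
  · exact (hout.comp (measurable_lastNoise i r)).const_mul _

theorem driveLaw_pattern [NeZero p] {i j : Fin p} (hij : i ≠ j) {V : Finset (Fin p)} (hi : i ∉ V)
    (hj : j ∉ V) {r : ℝ} (hr : 0 ≤ r) :
    driveLaw p {ω | Pattern i j V r 0 ω} = ENNReal.ofReal (patternProb r V.card) := by
  have := lintegral_pattern hij hi hj hr (F := fun _ => 1) measurable_const (f := fun _ => 1)
    measurable_const (fun _ _ _ _ _ _ _ _ _ => rfl)
  simpa using this

section Stat

variable (b : Fin p → Fin p → ℝ) (s : Fin p → ℝ) (i j : Fin p) (V : Finset (Fin p)) (σ M r : ℝ)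

/-- The change of `j` over the first two thirds of the window. -/
noncomputable def jumpDenom (t : ℝ) (x : Fin p → ℝ) (ω : ℕ → ℝ × Fin p × ℝ) : ℝ :=
  stateAt b s (t + 2 * r) x ω j - stateAt b s t x ω j

/-- The change of `i` over the last two thirds of the window. -/
noncomputable def jumpNumer (t : ℝ) (x : Fin p → ℝ) (ω : ℕ → ℝ × Fin p × ℝ) : ℝ :=
  stateAt b s (t + 3 * r) x ω i - stateAt b s (t + r) x ω i

/-- The ratio of the two changes, when the change of `j` is at least `σ`. -/
noncomputable def jumpRatio (t : ℝ) (x : Fin p → ℝ) (ω : ℕ → ℝ × Fin p × ℝ) : ℝ :=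
  if σ ≤ |jumpDenom b s j r t x ω| then jumpNumer b s i r t x ω / jumpDenom b s j r t x ω else 0

open Classical in
/-- The test statistic of the window starting at `t`, in units of `M`, and truncated at `1` unless
the neighbours `V` are at rest. -/
noncomputable def windowStat (t : ℝ) (x : Fin p → ℝ) (ω : ℕ → ℝ × Fin p × ℝ) : ℝ :=
  -- No truncation on ideal windows, so that the mean can be computed exactly. The truncation
  -- elsewhere makes the exponential moment bounded uniformly in `x`, and it has no effect on
  -- bounded paths.
  if Pattern i j V r t ω then jumpRatio b s i j σ r t x ω / M else
    if Pattern i j ∅ r t ω then max (-1) (min 1 (jumpRatio b s i j σ r t x ω / M)) else 0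

variable {b s i j V σ M r}

theorem measurable_jumpRatio (t : ℝ) :
    Measurable fun y : (Fin p → ℝ) × (ℕ → ℝ × Fin p × ℝ) => jumpRatio b s i j σ r t y.1 y.2 := by
  have h : ∀ (a : ℝ) (l : Fin p), Measurable fun y : (Fin p → ℝ) × (ℕ → ℝ × Fin p × ℝ) =>
      stateAt b s a y.1 y.2 l := fun a l =>
    (measurable_pi_apply l).comp (measurable_stateAt a)
  have h1 : Measurable fun y : (Fin p → ℝ) × (ℕ → ℝ × Fin p × ℝ) => jumpDenom b s j r t y.1 y.2 :=
    (h _ _).sub (h _ _)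
  have h2 : Measurable fun y : (Fin p → ℝ) × (ℕ → ℝ × Fin p × ℝ) => jumpNumer b s i r t y.1 y.2 :=
    (h _ _).sub (h _ _)
  exact Measurable.ite (measurableSet_le measurable_const (by fun_prop)) (h2.div h1)
    measurable_const

theorem measurable_windowStat (t : ℝ) :
    Measurable fun y : (Fin p → ℝ) × (ℕ → ℝ × Fin p × ℝ) =>
      windowStat b s i j V σ M r t y.1 y.2 := by
  have h := (measurable_jumpRatio (b := b) (s := s) (i := i) (j := j) (σ := σ) (r := r) t).div_const M
  refine Measurable.ite (measurable_snd (measurableSet_pattern i j V r t)) h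
    (Measurable.ite (measurable_snd (measurableSet_pattern i j ∅ r t)) ?_ measurable_const)
  exact measurable_const.max (measurable_const.min h)

theorem windowStat_stitch_add {ω ω' : ℕ → ℝ × Fin p × ℝ} (h : Regular ω) (h' : Regular ω')
    {t a : ℝ} (ht : 0 ≤ t) (ha : 0 ≤ a) (hr : 0 ≤ r) (x : Fin p → ℝ) :
    windowStat b s i j V σ M r (t + a) x (fun n => stitch n t ω ω') =
      windowStat b s i j V σ M r a (stateAt b s t x ω) ω' := by
  have hst := fun {a : ℝ} (ha : 0 ≤ a) => stateAt_stitch_add (b := b) (s := s) h h' ht ha x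
  have h1 : jumpRatio b s i j σ r (t + a) x (fun n => stitch n t ω ω') =
      jumpRatio b s i j σ r a (stateAt b s t x ω) ω' := by
    have h2 : jumpDenom b s j r (t + a) x (fun n => stitch n t ω ω') =
        jumpDenom b s j r a (stateAt b s t x ω) ω' := by
      rw [jumpDenom, add_assoc, hst ha, hst (by positivity), jumpDenom]
    have h3 : jumpNumer b s i r (t + a) x (fun n => stitch n t ω ω') =
        jumpNumer b s i r a (stateAt b s t x ω) ω' := by
      rw [jumpNumer, add_assoc, add_assoc, hst (by positivity), hst (by positivity), jumpNumer]
    unfold jumpRatio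
    rw [h2, h3]
  unfold windowStat
  rw [h1]
  classical
  exact if_congr (pattern_stitch_add h h' ht ha hr i j V) rfl
    (if_congr (pattern_stitch_add h h' ht ha hr i j ∅) rfl rfl)

theorem windowStat_stitch_of_le {ω ω' : ℕ → ℝ × Fin p × ℝ} (h : Regular ω) (h' : Regular ω')
    {t a : ℝ} (ht : 0 ≤ t) (hr : 0 ≤ r) (ha : a + 3 * r ≤ t) (x : Fin p → ℝ) :
    windowStat b s i j V σ M r a x (fun n => stitch n t ω ω') =
      windowStat b s i j V σ M r a x ω := by
  have hst := fun {a : ℝ} (ha : a ≤ t) => stateAt_stitch_of_le (b := b) (s := s) h h' ht ha x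
  have h1 : jumpRatio b s i j σ r a x (fun n => stitch n t ω ω') =
      jumpRatio b s i j σ r a x ω := by
    have h2 : jumpDenom b s j r a x (fun n => stitch n t ω ω') = jumpDenom b s j r a x ω := by
      rw [jumpDenom, hst (by linarith : a ≤ t), hst (by linarith : a + 2 * r ≤ t), jumpDenom]
    have h3 : jumpNumer b s i r a x (fun n => stitch n t ω ω') = jumpNumer b s i r a x ω := by
      rw [jumpNumer, hst (by linarith : a + r ≤ t), hst ha, jumpNumer]
    unfold jumpRatio
    rw [h2, h3]
  unfold windowStat
  rw [h1]
  classical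
  exact if_congr (pattern_stitch_of_le h h' ht hr ha i j V) rfl
    (if_congr (pattern_stitch_of_le h h' ht hr ha i j ∅) rfl rfl)

/-- In each third the updated node sees its neighbours at rest, so its final value is a regression
on the state at the start of the third plus its last noise. Between the two regressions of i only j
has moved, whence the coefficient `b i j` of the change of j. -/
theorem jumpRatio_eq_idealStat
    (hVi : ∀ l, b i l ≠ 0 → l ∈ insert j V) (hVj : ∀ l, b j l ≠ 0 → l ∈ insert i V)
    (hσ : 0 < σ) (hr : 0 ≤ r) (x : Fin p → ℝ)
    {ω ω' ω'' : ℕ → ℝ × Fin p × ℝ} (h : Regular ω) (h' : Regular ω') (h'' : Regular ω'')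
    (hS : Solo i (insert j V) 0 r ω) (hS' : Solo j (insert i V) 0 r ω')
    (hS'' : Solo i (insert j V) 0 r ω'') :
    jumpRatio b s i j σ r 0 x (fun n => stitch n r ω fun m => stitch m r ω' ω'') =
      idealStat (b i j) (b j i) (s i) (s j) (drift b i j x) σ
        (lastNoise i r ω, lastNoise j r ω', lastNoise i r ω'') := by
  have h2 := regular_stitch h' h'' hr
  set x1 := stateAt b s r x ω with hx1
  set x2 := stateAt b s r x1 ω' with hx2
  set x3 := stateAt b s r x2 ω'' with hx3
  have e0 : stateAt b s 0 x (fun n => stitch n r ω fun m => stitch m r ω' ω'') = x :=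
    (regular_stitch h h2 hr).stateAt_zero x
  have e1 : stateAt b s (0 + r) x (fun n => stitch n r ω fun m => stitch m r ω' ω'') = x1 := by
    rw [zero_add, stateAt_stitch_of_le h h2 hr le_rfl]
  have e2 : stateAt b s (0 + 2 * r) x (fun n => stitch n r ω fun m => stitch m r ω' ω'') = x2 := by
    rw [show (0 : ℝ) + 2 * r = r + r by ring, stateAt_stitch_add h h2 hr hr,
      stateAt_stitch_of_le h' h'' hr le_rfl]
  have e3 : stateAt b s (0 + 3 * r) x (fun n => stitch n r ω fun m => stitch m r ω' ω'') = x3 := by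
    rw [show (0 : ℝ) + 3 * r = r + (r + r) by ring, stateAt_stitch_add h h2 hr (add_nonneg hr hr),
      stateAt_stitch_add h' h'' hr hr]
  have g1 : x1 i = (∑ l, b i l * x l) + s i * lastNoise i r ω :=
    stateAt_eq_of_updated h hS.1 (fun l hl => hS.2 l (hVi l hl)) x
  have g2 : x2 j = (∑ l, b j l * x1 l) + s j * lastNoise j r ω' :=
    stateAt_eq_of_updated h' hS'.1 (fun l hl => hS'.2 l (hVj l hl)) x1
  have g3 : x3 i = (∑ l, b i l * x2 l) + s i * lastNoise i r ω'' :=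
    stateAt_eq_of_updated h'' hS''.1 (fun l hl => hS''.2 l (hVi l hl)) x2
  have k1 : ∀ l ∈ insert j V, x1 l = x l := fun l hl => by
    rw [hx1, h.stateAt_eq_of_not_updated hr (hS.2 l hl), h.stateAt_zero]
  have k2 : ∀ l ∈ insert i V, x2 l = x1 l := fun l hl => by
    rw [hx2, h'.stateAt_eq_of_not_updated hr (hS'.2 l hl), h'.stateAt_zero]
  -- Of the coordinates entering the regression of j, only i has moved in the first third.
  have m1 : ∑ l, b j l * x1 l = (∑ l, b j l * x l) + b j i * (x1 i - x i) := by
    rw [← Finset.add_sum_erase _ _ (Finset.mem_univ i),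
      ← Finset.add_sum_erase _ (fun l => b j l * x l) (Finset.mem_univ i)]
    have : ∑ l ∈ Finset.univ.erase i, b j l * x1 l = ∑ l ∈ Finset.univ.erase i, b j l * x l := by
      refine Finset.sum_congr rfl fun l hl => ?_
      by_cases hb : b j l = 0
      · rw [hb, zero_mul, zero_mul]
      · rw [k1 l (Finset.mem_insert_of_mem
          (Finset.mem_of_mem_insert_of_ne (hVj l hb) (Finset.ne_of_mem_erase hl)))]
    rw [this]; ring
  have m2 : ∑ l, b i l * x2 l = (∑ l, b i l * x l) + b i j * (x2 j - x j) := by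
    rw [← Finset.add_sum_erase _ _ (Finset.mem_univ j),
      ← Finset.add_sum_erase _ (fun l => b i l * x l) (Finset.mem_univ j)]
    have : ∑ l ∈ Finset.univ.erase j, b i l * x2 l = ∑ l ∈ Finset.univ.erase j, b i l * x l := by
      refine Finset.sum_congr rfl fun l hl => ?_
      by_cases hb : b i l = 0
      · rw [hb, zero_mul, zero_mul]
      · have hlV := Finset.mem_of_mem_insert_of_ne (hVi l hb) (Finset.ne_of_mem_erase hl)
        rw [k2 l (Finset.mem_insert_of_mem hlV), k1 l (Finset.mem_insert_of_mem hlV)]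
    rw [this]; ring
  have hden : x2 j - x j = drift b i j x + b j i * s i * lastNoise i r ω +
      s j * lastNoise j r ω' := by
    rw [g2, m1, g1, drift]; ring
  have hnum : x3 i - x1 i = b i j * (x2 j - x j) +
      s i * (lastNoise i r ω'' - lastNoise i r ω) := by
    rw [g3, m2, g1]; ring
  rw [jumpRatio, jumpNumer, jumpDenom, e0, e1, e2, e3, idealStat, hnum, hden]
  split_ifs with hc
  · have hne : drift b i j x + b j i * s i * lastNoise i r ω + s j * lastNoise j r ω' ≠ 0 := by
      intro h0
      rw [h0, abs_zero] at hc
      linarith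
    rw [add_div, mul_div_assoc, div_self hne, mul_one]
  · rfl

/-- The exponential moment of the test statistic of one window. -/
theorem lintegral_exp_windowStat_le [NeZero p] (hij : i ≠ j)
    (hVi : ∀ l, b i l ≠ 0 → l ∈ insert j V) (hVj : ∀ l, b j l ≠ 0 → l ∈ insert i V)
    (hi : i ∉ V) (hj : j ∉ V) (hσ : 0 < σ) (hr : 0 ≤ r) (hM : 0 < M) (hsi : 0 ≤ s i)
    (hbM : |b i j| ≤ M) (hsM : s i / σ ≤ M) {θ : ℝ} (hθ : |θ| ≤ 1) (x : Fin p → ℝ) :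
    ∫⁻ ω, ENNReal.ofReal (Real.exp (θ * windowStat b s i j V σ M r 0 x ω)) ∂driveLaw p ≤
      ENNReal.ofReal (1 + θ / M * (patternProb r V.card * ∫ z,
        idealStat (b i j) (b j i) (s i) (s j) (drift b i j x) σ z
          ∂(gaussianReal 0 1).prod ((gaussianReal 0 1).prod (gaussianReal 0 1))) +
        θ ^ 2 * expConst * patternProb r 0 +
        2 * |θ| * (patternProb r 0 - patternProb r V.card)) := by
  set Q := driveLaw p
  set q := patternProb r 0
  set q' := patternProb r V.card
  set Ψ : ℝ × ℝ × ℝ → ℝ := fun z =>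
    idealStat (b i j) (b j i) (s i) (s j) (drift b i j x) σ z / M with hΨ
  have hΨm : Measurable Ψ := (measurable_idealStat _ _ _ _ _ _).div_const _
  have hΨb : ∀ z, |Ψ z| ≤ 1 + |z.1| + |z.2.2| := by
    intro z
    rw [hΨ, abs_div, abs_of_pos hM, div_le_iff₀ hM]
    refine (abs_idealStat_le hσ hsi z).trans ?_
    have h1 : s i / σ * (|z.1| + |z.2.2|) ≤ M * (|z.1| + |z.2.2|) :=
      mul_le_mul_of_nonneg_right hsM (by positivity)
    linarith
  have hΨe := lintegral_exp_le hΨm hΨb hθ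
  have hint : ∫ z, Ψ z ∂(gaussianReal 0 1).prod ((gaussianReal 0 1).prod (gaussianReal 0 1)) =
      (∫ z, idealStat (b i j) (b j i) (s i) (s j) (drift b i j x) σ z
        ∂(gaussianReal 0 1).prod ((gaussianReal 0 1).prod (gaussianReal 0 1))) / M :=
    integral_div _ _
  rw [hint] at hΨe
  set μ := ∫ z, idealStat (b i j) (b j i) (s i) (s j) (drift b i j x) σ z
        ∂(gaussianReal 0 1).prod ((gaussianReal 0 1).prod (gaussianReal 0 1))
  -- Three cases: on `N` the statistic is a function of Gaussian noises, on `A \ N` it lies in [-1,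
  -- 1], and off `A` it is 0.
  set A := {ω : ℕ → ℝ × Fin p × ℝ | Pattern i j ∅ r 0 ω} with hA
  set N := {ω : ℕ → ℝ × Fin p × ℝ | Pattern i j V r 0 ω} with hN
  have hAm : MeasurableSet A := measurableSet_pattern _ _ _ _ _
  have hNm : MeasurableSet N := measurableSet_pattern _ _ _ _ _
  have hNA : N ⊆ A := fun ω h => Pattern.mono h (Finset.empty_subset _)
  have hQA : Q A = ENNReal.ofReal q := driveLaw_pattern hij (by simp) (by simp) hr
  have hQN : Q N = ENNReal.ofReal q' := driveLaw_pattern hij hi hj hr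
  have hq' : 0 ≤ q' := patternProb_nonneg hr _
  have hq : 0 ≤ q := patternProb_nonneg hr _
  have hqq : q' ≤ q := by
    have := measure_mono (μ := Q) hNA
    rw [hQA, hQN] at this
    exact (ENNReal.ofReal_le_ofReal_iff hq).1 this
  have hq1 : q ≤ 1 := by
    have : Q A ≤ 1 := prob_le_one
    rw [hQA] at this
    exact ENNReal.ofReal_le_one.1 this
  set F : (ℕ → ℝ × Fin p × ℝ) → ℝ≥0∞ := fun ω =>
    ENNReal.ofReal (Real.exp (θ * windowStat b s i j V σ M r 0 x ω)) with hF
  have hFm : Measurable F := by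
    have := (measurable_windowStat (b := b) (s := s) (i := i) (j := j) (V := V) (σ := σ) (M := M)
      (r := r) 0).comp (measurable_prodMk_left (x := x))
    exact (Real.measurable_exp.comp (this.const_mul θ)).ennreal_ofReal
  have hN1 : ∫⁻ ω in N, F ω ∂Q = ENNReal.ofReal q' * ∫⁻ z, ENNReal.ofReal (Real.exp (θ * Ψ z))
      ∂(gaussianReal 0 1).prod ((gaussianReal 0 1).prod (gaussianReal 0 1)) := by
    refine lintegral_pattern hij hi hj hr hFm (by fun_prop) ?_
    intro ω ω' ω'' h h' h'' hS hS' hS''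
    have hpat := (pattern_stitch_stitch h h' h'' hr i j V).2 ⟨hS, hS', hS''⟩
    have hj := jumpRatio_eq_idealStat (s := s) hVi hVj hσ hr x h h' h'' hS hS' hS''
    simp only [hF, windowStat, if_pos hpat, hj, hΨ]
  have hAN : ∫⁻ ω in A \ N, F ω ∂Q ≤ ENNReal.ofReal ((1 + 2 * |θ|) * (q - q')) := by
    have hle : ∀ ω ∈ A \ N, F ω ≤ ENNReal.ofReal (1 + 2 * |θ|) := by
      rintro ω ⟨h1, h2⟩
      refine ENNReal.ofReal_le_ofReal ?_
      have h3 : |windowStat b s i j V σ M r 0 x ω| ≤ 1 := by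
        rw [windowStat, if_neg (by exact h2), if_pos (by exact h1), abs_le]
        exact ⟨le_max_left _ _, max_le (by norm_num) (min_le_left _ _)⟩
      have h4 : |θ * windowStat b s i j V σ M r 0 x ω| ≤ |θ| := by
        rw [abs_mul]; exact mul_le_of_le_one_right (abs_nonneg _) h3
      have h5 := Real.abs_exp_sub_one_le (h4.trans hθ)
      linarith [(abs_le.1 h5).2]
    refine (setLIntegral_mono measurable_const hle).trans ?_
    rw [setLIntegral_const, measure_sdiff hNA hNm.nullMeasurableSet (measure_ne_top _ _), hQA, hQN,
      ← ENNReal.ofReal_sub _ hq', ← ENNReal.ofReal_mul (by positivity)]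
  have hAc : ∫⁻ ω in Aᶜ, F ω ∂Q = ENNReal.ofReal (1 - q) := by
    have hone : ∀ ω ∈ Aᶜ, F ω = 1 := by
      intro ω h
      have h1 : ¬ Pattern i j ∅ r 0 ω := h
      have h2 : ¬ Pattern i j V r 0 ω := fun h2 => h1 (h2.mono (Finset.empty_subset _))
      simp [hF, windowStat, if_neg h1, if_neg h2]
    rw [setLIntegral_congr_fun hAm.compl hone, setLIntegral_const, prob_compl_eq_one_sub hAm, hQA,
      one_mul, ← ENNReal.ofReal_one, ← ENNReal.ofReal_sub _ hq]
  -- The bound dominates the integral of a positive function; nonnegativity is needed to combine the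
  -- `ENNReal.ofReal` terms.
  have hB0 : 0 ≤ 1 + θ * (μ / M) + θ ^ 2 * expConst := by
    by_contra hneg
    have : ∫⁻ z, ENNReal.ofReal (Real.exp (θ * Ψ z))
      ∂(gaussianReal 0 1).prod ((gaussianReal 0 1).prod (gaussianReal 0 1)) = 0 :=
      le_antisymm (hΨe.trans (ENNReal.ofReal_eq_zero.2 (not_le.1 hneg).le).le) zero_le
    rw [lintegral_eq_zero_iff (by fun_prop)] at this
    have h2 := this.exists
    obtain ⟨z, hz⟩ := h2
    simp only [Pi.zero_apply, ENNReal.ofReal_eq_zero] at hz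
    exact absurd hz (not_le.2 (Real.exp_pos _))
  calc ∫⁻ ω, F ω ∂Q = ∫⁻ ω in N, F ω ∂Q + ∫⁻ ω in A \ N, F ω ∂Q + ∫⁻ ω in Aᶜ, F ω ∂Q := by
        rw [← lintegral_add_compl F hAm, ← lintegral_inter_add_sdiff F A hNm,
          Set.inter_eq_self_of_subset_right hNA]
    _ ≤ ENNReal.ofReal q' * ENNReal.ofReal (1 + θ * (μ / M) + θ ^ 2 * expConst) +
          ENNReal.ofReal ((1 + 2 * |θ|) * (q - q')) + ENNReal.ofReal (1 - q) := by
        rw [hN1, hAc]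
        gcongr
    _ = ENNReal.ofReal (q' * (1 + θ * (μ / M) + θ ^ 2 * expConst) +
          (1 + 2 * |θ|) * (q - q') + (1 - q)) := by
        have h1 : 0 ≤ (1 + 2 * |θ|) * (q - q') := mul_nonneg (by positivity) (by linarith)
        rw [← ENNReal.ofReal_mul hq', ← ENNReal.ofReal_add (mul_nonneg hq' hB0) h1,
          ← ENNReal.ofReal_add (add_nonneg (mul_nonneg hq' hB0) h1) (by linarith)]
    _ ≤ _ := by
        refine ENNReal.ofReal_le_ofReal ?_
        have h1 : q' * (θ ^ 2 * expConst) ≤ q * (θ ^ 2 * expConst) := by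
          have := two_le_expConst
          gcongr
        have h2 : q' * (θ * (μ / M)) = θ / M * (q' * μ) := by ring
        nlinarith

end Stat

end

section

variable {p : ℕ}

/-! ### Concentration over consecutive windows -/

section Window

variable {b : Fin p → Fin p → ℝ} {s : Fin p → ℝ}

/-- `g t x ω` depends on the path from `x` driven by `ω` only through its restriction to
`[t, t + τ]`, and homogeneously in time. -/
structure IsWindow (b : Fin p → Fin p → ℝ) (s : Fin p → ℝ) (τ : ℝ)
    (g : ℝ → (Fin p → ℝ) → (ℕ → ℝ × Fin p × ℝ) → ℝ) : Prop where
  measurable : ∀ t, Measurable fun y : (Fin p → ℝ) × (ℕ → ℝ × Fin p × ℝ) => g t y.1 y.2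
  shift : ∀ ω ω', Regular ω → Regular ω' → ∀ t a, 0 ≤ t → 0 ≤ a → ∀ x,
    g (t + a) x (fun n => stitch n t ω ω') = g a (stateAt b s t x ω) ω'
  past : ∀ ω ω', Regular ω → Regular ω' → ∀ t a, 0 ≤ t → a + τ ≤ t → ∀ x,
    g a x (fun n => stitch n t ω ω') = g a x ω

theorem IsWindow.measurable_right {τ : ℝ} {g : ℝ → (Fin p → ℝ) → (ℕ → ℝ × Fin p × ℝ) → ℝ}
    (hg : IsWindow b s τ g) (t : ℝ) (x : Fin p → ℝ) : Measurable (g t x) :=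
  (hg.measurable t).comp (measurable_prodMk_left (x := x))

/-- Restart at τ: the first window belongs to the past, the others form the same sum started from
the state at τ. Uniformity of the bound in the starting state replaces independence of the windows.
-/
theorem IsWindow.lintegral_exp_sum_le [NeZero p] {τ : ℝ} (hτ : 0 ≤ τ)
    {g : ℝ → (Fin p → ℝ) → (ℕ → ℝ × Fin p × ℝ) → ℝ} (hg : IsWindow b s τ g) {C : ℝ≥0∞}
    (hC : ∀ x, ∫⁻ ω, ENNReal.ofReal (Real.exp (g 0 x ω)) ∂driveLaw p ≤ C) (K : ℕ) (x : Fin p → ℝ) :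
    ∫⁻ ω, ENNReal.ofReal (Real.exp (∑ k ∈ Finset.range K, g (k * τ) x ω)) ∂driveLaw p ≤ C ^ K := by
  induction K generalizing x with
  | zero => simp
  | succ K ih =>
    have hm : Measurable fun ω => ENNReal.ofReal (Real.exp (∑ k ∈ Finset.range (K + 1),
        g (k * τ) x ω)) :=
      (Real.measurable_exp.comp (Finset.measurable_sum _ fun k _ =>
        hg.measurable_right _ x)).ennreal_ofReal
    have hm0 : Measurable fun ω => ENNReal.ofReal (Real.exp (g 0 x ω)) :=
      (Real.measurable_exp.comp (hg.measurable_right _ x)).ennreal_ofReal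
    rw [lintegral_stitch hτ hm]
    calc _ ≤ ∫⁻ ω, ENNReal.ofReal (Real.exp (g 0 x ω)) * C ^ K ∂driveLaw p := by
          refine lintegral_mono_ae ?_
          filter_upwards [ae_regular (p := p)] with ω hω
          calc _ = ∫⁻ ω', ENNReal.ofReal (Real.exp (g 0 x ω)) * ENNReal.ofReal (Real.exp
                (∑ k ∈ Finset.range K, g (k * τ) (stateAt b s τ x ω) ω')) ∂driveLaw p := by
                refine lintegral_congr_ae ?_
                filter_upwards [ae_regular (p := p)] with ω' hω'
                rw [← ENNReal.ofReal_mul (Real.exp_nonneg _), ← Real.exp_add,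
                  Finset.sum_range_succ', add_comm]
                congr 3
                · rw [Nat.cast_zero, zero_mul]
                  exact hg.past ω ω' hω hω' τ 0 hτ (by simp) x
                · refine Finset.sum_congr rfl fun k _ => ?_
                  rw [← hg.shift ω ω' hω hω' τ (k * τ) hτ (by positivity) x]
                  congr 1
                  push_cast
                  ring
            _ ≤ _ := by
                rw [lintegral_const_mul' _ _ ENNReal.ofReal_ne_top]
                gcongr
                exact ih _
      _ = (∫⁻ ω, ENNReal.ofReal (Real.exp (g 0 x ω)) ∂driveLaw p) * C ^ K :=
          lintegral_mul_const _ hm0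
      _ ≤ C ^ (K + 1) := by
          rw [pow_succ']
          gcongr
          exact hC x

/-- Chernoff's bound for the sum of a statistic over consecutive windows. -/
theorem IsWindow.driveLaw_le_sum [NeZero p] {τ : ℝ} (hτ : 0 ≤ τ)
    {g : ℝ → (Fin p → ℝ) → (ℕ → ℝ × Fin p × ℝ) → ℝ} (hg : IsWindow b s τ g) {c : ℝ}
    (hc : ∀ x, ∫⁻ ω, ENNReal.ofReal (Real.exp (g 0 x ω)) ∂driveLaw p ≤ ENNReal.ofReal (Real.exp c))
    (K : ℕ) (x : Fin p → ℝ) (a : ℝ) :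
    driveLaw p {ω | a ≤ ∑ k ∈ Finset.range K, g (k * τ) x ω} ≤
      ENNReal.ofReal (Real.exp (c * K - a)) := by
  have hm : Measurable fun ω => ENNReal.ofReal (Real.exp (∑ k ∈ Finset.range K, g (k * τ) x ω)) :=
    (Real.measurable_exp.comp (Finset.measurable_sum _ fun k _ =>
      hg.measurable_right _ x)).ennreal_ofReal
  have h1 := hg.lintegral_exp_sum_le hτ hc K x
  have h2 := mul_meas_ge_le_lintegral₀ (μ := driveLaw p) hm.aemeasurable
    (ENNReal.ofReal (Real.exp a))
  have h3 : {ω | a ≤ ∑ k ∈ Finset.range K, g (k * τ) x ω} ⊆ {ω | ENNReal.ofReal (Real.exp a) ≤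
      ENNReal.ofReal (Real.exp (∑ k ∈ Finset.range K, g (k * τ) x ω))} := fun ω hω =>
    ENNReal.ofReal_le_ofReal (Real.exp_le_exp.2 hω)
  have h4 : ENNReal.ofReal (Real.exp a) * driveLaw p {ω | a ≤ ∑ k ∈ Finset.range K, g (k * τ) x ω} ≤
      ENNReal.ofReal (Real.exp (c * K)) := by
    refine (mul_le_mul_right (measure_mono h3) _).trans (h2.trans (h1.trans ?_))
    rw [← ENNReal.ofReal_pow (Real.exp_nonneg _), ← Real.exp_nat_mul, mul_comm]
  rw [Real.exp_sub, ENNReal.ofReal_div_of_pos (Real.exp_pos _)]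
  rw [ENNReal.le_div_iff_mul_le (Or.inl (by simp [Real.exp_pos])) (Or.inl ENNReal.ofReal_ne_top),
    mul_comm]
  exact h4

theorem IsWindow.comp_stateAt {τ : ℝ} (hτ : 0 ≤ τ) {f : (Fin p → ℝ) → ℝ} (hf : Measurable f) :
    IsWindow b s τ fun t x ω => f (stateAt b s t x ω) where
  measurable t := hf.comp (measurable_stateAt t)
  shift ω ω' h h' t a ht ha x := by rw [stateAt_stitch_add h h' ht ha]
  past ω ω' h h' t a ht ha x := by rw [stateAt_stitch_of_le h h' ht (by linarith)]

theorem IsWindow.add {τ : ℝ} {f g : ℝ → (Fin p → ℝ) → (ℕ → ℝ × Fin p × ℝ) → ℝ}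
    (hf : IsWindow b s τ f) (hg : IsWindow b s τ g) :
    IsWindow b s τ fun t x ω => f t x ω + g t x ω where
  measurable t := (hf.measurable t).add (hg.measurable t)
  shift ω ω' h h' t a ht ha x := by rw [hf.shift ω ω' h h' t a ht ha, hg.shift ω ω' h h' t a ht ha]
  past ω ω' h h' t a ht ha x := by rw [hf.past ω ω' h h' t a ht ha, hg.past ω ω' h h' t a ht ha]

theorem IsWindow.const_mul {τ : ℝ} {f : ℝ → (Fin p → ℝ) → (ℕ → ℝ × Fin p × ℝ) → ℝ}
    (hf : IsWindow b s τ f) (c : ℝ) : IsWindow b s τ fun t x ω => c * f t x ω where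
  measurable t := (hf.measurable t).const_mul c
  shift ω ω' h h' t a ht ha x := by rw [hf.shift ω ω' h h' t a ht ha]
  past ω ω' h h' t a ht ha x := by rw [hf.past ω ω' h h' t a ht ha]

theorem IsWindow.sum_range {τ : ℝ} (hτ : 0 ≤ τ)
    {f : ℝ → (Fin p → ℝ) → (ℕ → ℝ × Fin p × ℝ) → ℝ} (hf : IsWindow b s τ f) (m : ℕ) :
    IsWindow b s (m * τ) fun t x ω => ∑ k ∈ Finset.range m, f (t + k * τ) x ω where
  measurable t := Finset.measurable_sum _ fun k _ => hf.measurable _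
  shift ω ω' h h' t a ht ha x := Finset.sum_congr rfl fun k _ => by
    rw [add_assoc, hf.shift ω ω' h h' t _ ht (by positivity)]
  past ω ω' h h' t a ht ha x := Finset.sum_congr rfl fun k hk => by
    refine hf.past ω ω' h h' t _ ht ?_ x
    have : ((k : ℝ) + 1) * τ ≤ m * τ := by
      gcongr
      exact_mod_cast Finset.mem_range.1 hk
    linarith

theorem isWindow_windowStat {i j : Fin p} {V : Finset (Fin p)} {σ M r : ℝ} (hr : 0 ≤ r) :
    IsWindow b s (3 * r) (windowStat b s i j V σ M r) where
  measurable t := measurable_windowStat t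
  shift _ _ h h' _ _ ht ha x := windowStat_stitch_add h h' ht ha hr x
  past _ _ h h' _ _ ht ha x := windowStat_stitch_of_le h h' ht hr ha x

/-- A set of states that is likely from time `1` on is visited by a positive proportion of windows. -/
theorem driveLaw_visits_le [NeZero p] {A : Set (Fin p → ℝ)} (hA : MeasurableSet A)
    (hA1 : ∀ t, 1 ≤ t → ∀ x, ENNReal.ofReal (1 / 4) ≤ driveLaw p {ω | stateAt b s t x ω ∈ A})
    {τ : ℝ} (hτ : 0 ≤ τ) {n : ℕ} (hn : 0 < n) (hnτ : 1 ≤ n * τ) (B : ℕ) (x : Fin p → ℝ) :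
    driveLaw p {ω | ∑ k ∈ Finset.range (B * (2 * n)),
      A.indicator (1 : (Fin p → ℝ) → ℝ) (stateAt b s (k * τ) x ω) ≤ B * (2 * n) / 32} ≤
      ENNReal.ofReal (Real.exp (-(B / 32))) := by
  set f : (Fin p → ℝ) → ℝ := A.indicator 1 with hf
  have hfm : Measurable f := measurable_one.indicator hA
  have hf0 : ∀ y, 0 ≤ f y := fun y => Set.indicator_nonneg (fun _ _ => zero_le_one) y
  have hf1 : ∀ y, f y ≤ 1 := fun y => Set.indicator_le_self' (fun _ _ => zero_le_one) y
  have hn' : (0 : ℝ) < n := Nat.cast_pos.2 hn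
  -- Group 2n windows into a block. Those of its second half start at time at least nτ ≥ 1 after the
  -- beginning of the block, so the mean proportion of visits per block is at least 1/8 whatever the
  -- initial state.
  have hw := ((IsWindow.comp_stateAt (b := b) (s := s) hτ hfm).sum_range hτ (2 * n)).const_mul
    (-(2 * n : ℝ)⁻¹)
  have hsm : ∀ t y, Measurable fun ω => stateAt b s t y ω := fun t y =>
    (measurable_stateAt (b := b) (s := s) t).comp (measurable_prodMk_left (x := y))
  have hexp : ∀ y, ∫⁻ ω, ENNReal.ofReal (Real.exp (-(2 * n : ℝ)⁻¹ *
      ∑ k ∈ Finset.range (2 * n), f (stateAt b s (0 + k * τ) y ω))) ∂driveLaw p ≤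
      ENNReal.ofReal (Real.exp (-(1 / 16))) := by
    intro y
    set G : (ℕ → ℝ × Fin p × ℝ) → ℝ := fun ω => (2 * n : ℝ)⁻¹ *
      ∑ k ∈ Finset.range (2 * n), f (stateAt b s (0 + k * τ) y ω) with hG
    have hGm : Measurable G := (Finset.measurable_sum _ fun k _ => hfm.comp (hsm _ y)).const_mul _
    have hG0 : ∀ ω, 0 ≤ G ω := fun ω =>
      mul_nonneg (by positivity) (Finset.sum_nonneg fun k _ => hf0 _)
    have hG1 : ∀ ω, G ω ≤ 1 := by
      intro ω
      have : ∑ k ∈ Finset.range (2 * n), f (stateAt b s (0 + k * τ) y ω) ≤ 2 * n := by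
        refine (Finset.sum_le_card_nsmul _ _ 1 fun k _ => hf1 _).trans ?_
        simp
      rw [hG]
      calc _ ≤ (2 * n : ℝ)⁻¹ * (2 * n) := mul_le_mul_of_nonneg_left this (by positivity)
        _ = 1 := by field_simp
    have hGi : Integrable G (driveLaw p) := by
      refine Integrable.of_bound hGm.aestronglyMeasurable 1 (Filter.Eventually.of_forall fun ω => ?_)
      rw [Real.norm_eq_abs, abs_of_nonneg (hG0 ω)]
      exact hG1 ω
    have hfi : ∀ t, Integrable (fun ω => f (stateAt b s t y ω)) (driveLaw p) := fun t => by
      refine Integrable.of_bound (hfm.comp (hsm t y)).aestronglyMeasurable 1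
        (Filter.Eventually.of_forall fun ω => ?_)
      rw [Real.norm_eq_abs, abs_of_nonneg (hf0 _)]
      exact hf1 _
    have hEG : 1 / 8 ≤ ∫ ω, G ω ∂driveLaw p := by
      rw [hG, integral_const_mul, integral_finsetSum _ fun k _ => hfi _]
      have hE : ∀ k ∈ Finset.range n, (1 / 4 : ℝ) ≤
          ∫ ω, f (stateAt b s (0 + (n + k : ℕ) * τ) y ω) ∂driveLaw p := by
        intro k _
        have h1 : (1 : ℝ) ≤ 0 + (n + k : ℕ) * τ := by
          push_cast
          nlinarith [mul_nonneg (Nat.cast_nonneg (α := ℝ) k) hτ]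
        have h2 := hA1 _ h1 y
        have h3 : ∫ ω, f (stateAt b s (0 + (n + k : ℕ) * τ) y ω) ∂driveLaw p =
            (driveLaw p).real {ω | stateAt b s (0 + (n + k : ℕ) * τ) y ω ∈ A} :=
          integral_indicator_one (hsm _ y hA)
        rw [h3, Measure.real, ← ENNReal.toReal_ofReal (by norm_num : (0 : ℝ) ≤ 1 / 4)]
        exact ENNReal.toReal_mono (measure_ne_top _ _) h2
      have h4 : (n : ℝ) * (1 / 4) ≤ ∑ k ∈ Finset.range (2 * n),
          ∫ ω, f (stateAt b s (0 + k * τ) y ω) ∂driveLaw p := by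
        rw [two_mul, Finset.sum_range_add]
        have h5 := Finset.card_nsmul_le_sum _ _ _ hE
        rw [Finset.card_range, nsmul_eq_mul] at h5
        refine h5.trans (le_add_of_nonneg_left (Finset.sum_nonneg fun k _ =>
          integral_nonneg fun ω => hf0 _))
      calc (1 / 8 : ℝ) = (2 * n : ℝ)⁻¹ * (n * (1 / 4)) := by field_simp; norm_num
        _ ≤ _ := by gcongr
    -- Convexity on [-1, 0] together with e^{-1} ≤ 1/2.
    have hexpG : ∀ ω, Real.exp (-G ω) ≤ 1 - G ω / 2 := by
      intro ω
      have h1 := convexOn_exp.2 (Set.mem_univ (-1)) (Set.mem_univ 0) (hG0 ω)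
        (sub_nonneg.2 (hG1 ω)) (by ring)
      simp only [smul_eq_mul, mul_neg, mul_one, mul_zero, add_zero, Real.exp_zero] at h1
      have h2 : Real.exp (-1) ≤ 1 / 2 := by
        rw [Real.exp_neg, inv_eq_one_div]
        exact one_div_le_one_div_of_le (by norm_num) (by linarith [Real.add_one_le_exp 1])
      nlinarith [hG0 ω]
    calc _ = ∫⁻ ω, ENNReal.ofReal (Real.exp (-G ω)) ∂driveLaw p := by simp only [hG, neg_mul]
      _ ≤ ∫⁻ ω, ENNReal.ofReal (1 - G ω / 2) ∂driveLaw p :=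
          lintegral_mono fun ω => ENNReal.ofReal_le_ofReal (hexpG ω)
      _ = ENNReal.ofReal (∫ ω, (1 - G ω / 2) ∂driveLaw p) :=
          (ofReal_integral_eq_lintegral_ofReal ((integrable_const 1).sub (hGi.div_const 2))
            (Filter.Eventually.of_forall fun ω => by
              have := hG1 ω
              simp only [Pi.zero_apply, Pi.sub_apply]
              linarith)).symm
      _ ≤ _ := by
          refine ENNReal.ofReal_le_ofReal ?_
          rw [integral_sub (integrable_const 1) (hGi.div_const 2), integral_div]
          simp only [integral_const, probReal_univ, smul_eq_mul, mul_one]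
          linarith [Real.add_one_le_exp (-(1 / 16) : ℝ)]
  -- Each block contributes -1/16 to the exponent and the level gives back 1/32.
  have h := hw.driveLaw_le_sum (by positivity) hexp B x (-(B / 32))
  refine (measure_mono ?_).trans (h.trans (ENNReal.ofReal_le_ofReal (Real.exp_le_exp.2 ?_)))
  · intro ω hω
    simp only [Set.mem_ofPred_eq] at hω ⊢
    rw [← Finset.mul_sum]
    have h1 : ∑ l ∈ Finset.range B, ∑ k ∈ Finset.range (2 * n),
        f (stateAt b s (l * ((2 * n : ℕ) * τ) + k * τ) x ω) =
        ∑ k ∈ Finset.range (B * (2 * n)), f (stateAt b s (k * τ) x ω) := by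
      clear hω h
      induction B with
      | zero => simp
      | succ B ih =>
        rw [Finset.sum_range_succ, ih, show (B + 1) * (2 * n) = B * (2 * n) + 2 * n by ring,
          Finset.sum_range_add]
        congr 1
        refine Finset.sum_congr rfl fun k _ => ?_
        congr 2
        push_cast
        ring
    rw [h1, neg_mul, neg_le_neg_iff]
    calc _ ≤ (2 * n : ℝ)⁻¹ * (B * (2 * n) / 32) := by gcongr
      _ = B / 32 := by field_simp
  · linarith

end Window

end

section

variable {p : ℕ}

/-! ### Concentration of the test statistic -/

/-- The update rule of the Glauber dynamics of a Gaussian vector with diagonally dominant precision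
matrix: regression coefficients `b` and conditional standard deviations `s`. -/
structure IsContractive (b : Fin p → Fin p → ℝ) (s : Fin p → ℝ) (γ : ℝ) : Prop where
  diag : ∀ i, b i i = 0
  row : ∀ i, ∑ l, |b i l| ≤ γ
  pos : ∀ i, 0 < s i
  symm : ∀ i j, b j i * s i ^ 2 = b i j * s j ^ 2

open Classical in
/-- The neighbours of `i` or `j`, other than `i` and `j`. -/
noncomputable def pairNeighbors (b : Fin p → Fin p → ℝ) (i j : Fin p) : Finset (Fin p) :=
  {l | l ≠ i ∧ l ≠ j ∧ (b i l ≠ 0 ∨ b j l ≠ 0)}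

/-- Keeping m further nodes at rest for a time 3r costs the factor e^{-3rm} ≥ 1 - 3rm. -/
theorem patternProb_sub_le {r : ℝ} (hr : 0 ≤ r) (m : ℕ) :
    patternProb r 0 - patternProb r m ≤ m * (3 * r) * patternProb r 0 := by
  have h : patternProb r m = patternProb r 0 * Real.exp (-(m * (3 * r))) := by
    unfold patternProb
    rw [mul_pow, mul_pow, ← Real.exp_nat_mul, ← Real.exp_nat_mul, mul_assoc, ← Real.exp_add]
    congr 2
    push_cast
    ring
  have h0 := patternProb_nonneg hr 0
  have h1 := Real.add_one_le_exp (-(m * (3 * r)))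
  rw [h]
  nlinarith

section

variable {b : Fin p → Fin p → ℝ} {s : Fin p → ℝ} {γ : ℝ}

theorem IsContractive.abs_le (hc : IsContractive b s γ) (i j : Fin p) : |b i j| ≤ γ :=
  (Finset.single_le_sum (f := fun l => |b i l|) (fun _ _ => abs_nonneg _)
    (Finset.mem_univ j)).trans (hc.row i)

theorem IsContractive.mul_swap_nonneg (hc : IsContractive b s γ) (i j : Fin p) : 0 ≤ b i j * b j i := by
  have h := hc.symm i j
  have h1 : 0 ≤ b i j * b j i * s i ^ 2 := by
    rw [mul_assoc, h, ← mul_assoc]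
    exact mul_nonneg (mul_self_nonneg _) (sq_nonneg _)
  exact nonneg_of_mul_nonneg_left h1 (pow_pos (hc.pos i) 2)

/-- The mean of the statistic of an ideal window. -/
noncomputable def idealMean (b : Fin p → Fin p → ℝ) (s : Fin p → ℝ) (i j : Fin p) (σ : ℝ)
    (x : Fin p → ℝ) : ℝ :=
  ∫ z, idealStat (b i j) (b j i) (s i) (s j) (drift b i j x) σ z
    ∂(gaussianReal 0 1).prod ((gaussianReal 0 1).prod (gaussianReal 0 1))

theorem IsContractive.idealMean_eq_zero (hc : IsContractive b s γ) {i j : Fin p} {σ : ℝ}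
    (hσ : 0 < σ) (hb : b i j = 0) (x : Fin p → ℝ) : idealMean b s i j σ x = 0 := by
  obtain ⟨P, -, h⟩ := integral_idealStat (a := drift b i j x) hσ (hc.pos j) (hc.symm i j)
  rw [idealMean, h, hb, zero_div, zero_mul]

/-- In the mean formula 1 + b_ij b_ji lies in [1, 2] and the first summand is nonnegative. The mean
ratio is always nonnegative, and it is bounded below when the drift is large. -/
theorem IsContractive.le_idealMean (hc : IsContractive b s γ) (hγ0 : 0 ≤ γ) (hγ : γ < 1)
    {i j : Fin p} {σ : ℝ} (hσ : 0 < σ) (hσj : σ ≤ s j) (x : Fin p → ℝ) :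
    |b i j| / 2 * ({y | (1 - γ ^ 2) / 2 * s j ≤ |drift b i j y|}.indicator
      (fun _ => ratioConst ((1 - γ ^ 2) / 2)) x) ≤ SignType.sign (b i j) * idealMean b s i j σ x := by
  obtain ⟨P, hP, h⟩ := integral_idealStat (a := drift b i j x) hσ (hc.pos j) (hc.symm i j)
  have hb0 := hc.mul_swap_nonneg i j
  have hb1 : b i j * b j i ≤ 1 := by
    refine (le_abs_self _).trans ?_
    rw [abs_mul]
    exact mul_le_one₀ ((hc.abs_le i j).trans hγ.le) (abs_nonneg _) ((hc.abs_le j i).trans hγ.le)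
  have hsj := hc.pos j
  have hv : 0 < s j * √(1 + b i j * b j i) := by positivity
  have hv2 : (s j * √(1 + b i j * b j i)) ^ 2 = s j ^ 2 * (1 + b i j * b j i) := by
    rw [mul_pow, Real.sq_sqrt (by positivity)]
  have hs2 := pow_pos hsj 2
  rw [idealMean, h]
  set R := meanRatio σ (s j * √(1 + b i j * b j i)) (drift b i j x)
  have hR0 : 0 ≤ R := meanRatio_nonneg hσ hv _
  have hR : {y | (1 - γ ^ 2) / 2 * s j ≤ |drift b i j y|}.indicator
      (fun _ => ratioConst ((1 - γ ^ 2) / 2)) x ≤ R := by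
    by_cases hx : x ∈ {y | (1 - γ ^ 2) / 2 * s j ≤ |drift b i j y|}
    · rw [Set.indicator_of_mem hx]
      exact le_meanRatio hσ hσj hv (by rw [hv2]; nlinarith) (by rw [hv2]; nlinarith) (by nlinarith)
        (by nlinarith) hx
    · rw [Set.indicator_of_notMem hx]
      exact hR0
  have e : (SignType.sign (b i j) : ℝ) * (b i j / (1 + b i j * b j i) * (b i j * b j i * P + R)) =
      |b i j| / (1 + b i j * b j i) * (b i j * b j i * P + R) := by
    rw [← mul_assoc, ← mul_div_assoc, sign_mul_self]
  rw [e]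
  have h1 : |b i j| / 2 ≤ |b i j| / (1 + b i j * b j i) := by
    gcongr
    linarith
  have h2 : 0 ≤ b i j * b j i * P := mul_nonneg hb0 hP
  calc _ ≤ |b i j| / 2 * R := by gcongr
    _ ≤ _ := by gcongr; linarith

/-- The neighbours of the pair are the nodes to be kept at rest. By `hD`, losing the ideal pattern
has probability at most 2D relative to A_ij. -/
theorem IsContractive.lintegral_exp_windowStat_le [NeZero p] (hc : IsContractive b s γ) {i j : Fin p}
    (hij : i ≠ j) {σ r M D : ℝ} (hσ : 0 < σ) (hr : 0 ≤ r) (hM : 0 < M) (hbM : |b i j| ≤ M)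
    (hsM : s i / σ ≤ M) (hD : (pairNeighbors b i j).card * (3 * r) ≤ 2 * D) {θ : ℝ} (hθ : |θ| ≤ 1)
    (x : Fin p → ℝ) :
    ∫⁻ ω, ENNReal.ofReal (Real.exp (θ * windowStat b s i j (pairNeighbors b i j) σ M r 0 x ω))
      ∂driveLaw p ≤ ENNReal.ofReal (Real.exp (θ / M *
        (patternProb r (pairNeighbors b i j).card * idealMean b s i j σ x) +
        (θ ^ 2 * expConst + 4 * |θ| * D) * patternProb r 0)) := by
  classical
  have hVi : ∀ l, b i l ≠ 0 → l ∈ insert j (pairNeighbors b i j) := fun l hl => by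
    have : l ≠ i := fun h => hl (h ▸ hc.diag i)
    by_cases h : l = j <;> simp [pairNeighbors, h, this, hl]
  have hVj : ∀ l, b j l ≠ 0 → l ∈ insert i (pairNeighbors b i j) := fun l hl => by
    have : l ≠ j := fun h => hl (h ▸ hc.diag j)
    by_cases h : l = i <;> simp [pairNeighbors, h, this, hl]
  refine (GaussGlauber.lintegral_exp_windowStat_le hij hVi hVj (by simp [pairNeighbors])
    (by simp [pairNeighbors]) hσ hr hM (hc.pos i).le hbM hsM hθ x).trans
    (ENNReal.ofReal_le_ofReal ?_)
  have h1 := patternProb_sub_le hr (pairNeighbors b i j).card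
  have h0 := patternProb_nonneg hr 0
  have h2 : patternProb r 0 - patternProb r (pairNeighbors b i j).card ≤
      2 * D * patternProb r 0 := h1.trans (by gcongr)
  have h3 := mul_le_mul_of_nonneg_left h2 (by positivity : 0 ≤ 2 * |θ|)
  refine le_trans ?_ (Real.add_one_le_exp _)
  unfold idealMean
  linarith

/-- There is no signal, so the exponential moment contains only variance and bias. With |θ| = 2D/C
these amount to 4 + 8, and the level to 16, in units of KqD²/C; the difference is the exponent -4.
-/
theorem IsContractive.driveLaw_sum_windowStat_of_eq_zero [NeZero p] (hc : IsContractive b s γ)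
    {i j : Fin p} (hij : i ≠ j) (hb : b i j = 0) {σ r M D : ℝ} (hσ : 0 < σ) (hr : 0 ≤ r) (hM : 0 < M)
    (hsM : s i / σ ≤ M) (hD : (pairNeighbors b i j).card * (3 * r) ≤ 2 * D) (hD0 : 0 ≤ D)
    (hD1 : D ≤ 1) (K : ℕ) (x : Fin p → ℝ) :
    driveLaw p {ω | 8 * K * patternProb r 0 * D ≤ |∑ k ∈ Finset.range K,
      windowStat b s i j (pairNeighbors b i j) σ M r (k * (3 * r)) x ω|} ≤
      ENNReal.ofReal (2 * Real.exp (-(4 * K * patternProb r 0 * D ^ 2 / expConst))) := by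
  set q := patternProb r 0
  have hC := two_le_expConst
  set C := expConst
  have hκ0 : 0 ≤ 2 * D / C := by positivity
  have hκ1 : 2 * D / C ≤ 1 := by
    rw [div_le_one (by linarith)]
    linarith
  have key : ∀ ζ : ℝ, |ζ| = 1 → driveLaw p {ω | 2 * D / C * (8 * K * q * D) ≤
      ∑ k ∈ Finset.range K, ζ * (2 * D / C) *
        windowStat b s i j (pairNeighbors b i j) σ M r (k * (3 * r)) x ω} ≤
      ENNReal.ofReal (Real.exp (-(4 * K * q * D ^ 2 / C))) := by
    intro ζ hζ
    have hθ : |ζ * (2 * D / C)| = 2 * D / C := by rw [abs_mul, hζ, one_mul, abs_of_nonneg hκ0]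
    have hw := (isWindow_windowStat (b := b) (s := s) (i := i) (j := j)
      (V := pairNeighbors b i j) (σ := σ) (M := M) hr).const_mul (ζ * (2 * D / C))
    have hmgf : ∀ y, ∫⁻ ω, ENNReal.ofReal (Real.exp (ζ * (2 * D / C) *
        windowStat b s i j (pairNeighbors b i j) σ M r 0 y ω)) ∂driveLaw p ≤
        ENNReal.ofReal (Real.exp (((2 * D / C) ^ 2 * C + 4 * (2 * D / C) * D) * q)) := by
      intro y
      refine (hc.lintegral_exp_windowStat_le hij hσ hr hM
        (by rw [hb, abs_zero]; exact hM.le) hsM hD (hθ.trans_le hκ1) y).trans_eq ?_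
      rw [hc.idealMean_eq_zero hσ hb, mul_zero, mul_zero, zero_add, hθ, ← sq_abs, hθ]
    refine (hw.driveLaw_le_sum (by positivity) hmgf K x _).trans
        (ENNReal.ofReal_le_ofReal (Real.exp_le_exp.2 (le_of_eq ?_)))
    field_simp
    ring
  have hsub : {ω | 8 * K * q * D ≤ |∑ k ∈ Finset.range K,
      windowStat b s i j (pairNeighbors b i j) σ M r (k * (3 * r)) x ω|} ⊆
      {ω | 2 * D / C * (8 * K * q * D) ≤ ∑ k ∈ Finset.range K, 1 * (2 * D / C) *
        windowStat b s i j (pairNeighbors b i j) σ M r (k * (3 * r)) x ω} ∪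
      {ω | 2 * D / C * (8 * K * q * D) ≤ ∑ k ∈ Finset.range K, (-1) * (2 * D / C) *
        windowStat b s i j (pairNeighbors b i j) σ M r (k * (3 * r)) x ω} := by
    intro ω hω
    simp only [Set.mem_union, Set.mem_ofPred_eq, ← Finset.mul_sum] at hω ⊢
    rcases le_abs.1 hω with h | h
    · left
      rw [one_mul]
      gcongr
    · right
      have := mul_le_mul_of_nonneg_left h hκ0
      linarith
  refine (measure_mono hsub).trans ((measure_union_le _ _).trans ?_)
  rw [two_mul (Real.exp _), ENNReal.ofReal_add (Real.exp_nonneg _) (Real.exp_nonneg _)]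
  exact add_le_add (key 1 (by simp)) (key (-1) (by simp))

/-- The signal depends on the state at the start of the window, so it is compensated inside the
exponential: the signed statistic minus g times the indicator of a large drift has the same
one-sided exponential bound as for a non-edge, uniformly in the state. Many visits then force a
large sum. -/
theorem IsContractive.driveLaw_sum_windowStat_inter_visits [NeZero p] (hc : IsContractive b s γ)
    (hγ0 : 0 ≤ γ) (hγ : γ < 1) {i j : Fin p} (hij : i ≠ j) {σ r M D β : ℝ} (hσ : 0 < σ)
    (hσj : σ ≤ s j) (hr : 0 ≤ r) (hM : 1 ≤ M) (hβ : 0 < β) (hbβ : β ≤ |b i j|)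
    (hsM : s i / σ ≤ M) (hD : (pairNeighbors b i j).card * (3 * r) ≤ 2 * D) (hD0 : 0 ≤ D)
    (hD1 : D ≤ 1 / 4) (hDM : 4096 * M * D ≤ β * ratioConst ((1 - γ ^ 2) / 2)) (K : ℕ)
    (x : Fin p → ℝ) :
    driveLaw p {ω | |∑ k ∈ Finset.range K,
        windowStat b s i j (pairNeighbors b i j) σ M r (k * (3 * r)) x ω| < 8 * K * patternProb r 0 * D ∧
      (K : ℝ) / 64 ≤ ∑ k ∈ Finset.range K,
        {y | (1 - γ ^ 2) / 2 * s j ≤ |drift b i j y|}.indicator (1 : (Fin p → ℝ) → ℝ)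
          (stateAt b s (k * (3 * r)) x ω)} ≤
      ENNReal.ofReal (Real.exp (-(4 * K * patternProb r 0 * D ^ 2 / expConst))) := by
  set q := patternProb r 0 with hq
  have hq0 : 0 ≤ q := patternProb_nonneg hr 0
  have hC := two_le_expConst
  set C := expConst
  have hM0 : 0 < M := by linarith
  have hκ0 : 0 ≤ 2 * D / C := by positivity
  have hκ1 : 2 * D / C ≤ 1 := by
    rw [div_le_one (by linarith)]
    linarith
  set κ := 2 * D / C with hκ
  set A := {y | (1 - γ ^ 2) / 2 * s j ≤ |drift b i j y|} with hA
  have hAm : MeasurableSet A := measurableSet_le measurable_const (measurable_drift i j).abs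
  set c₁ := ratioConst ((1 - γ ^ 2) / 2) with hc₁
  have hcpos : 0 < c₁ := ratioConst_pos (by nlinarith)
  set m := (pairNeighbors b i j).card
  set ζ : ℝ := ((SignType.sign (b i j) : SignType) : ℝ) with hζ
  have hζ1 : |ζ| = 1 := by
    have hne : b i j ≠ 0 := fun h => by rw [h, abs_zero] at hbβ; linarith
    rcases lt_or_gt_of_ne hne with h | h <;> simp [hζ, h]
  -- A lower bound for the mean signal of a window starting with large drift: the ideal pattern has
  -- probability at least q/2, and the ideal mean is at least β c₁/2 before division by M.
  set g := q * β * c₁ / (4 * M) with hg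
  have hθ : |-κ * ζ| = κ := by rw [abs_mul, hζ1, mul_one, abs_neg, abs_of_nonneg hκ0]
  have hw := ((isWindow_windowStat (b := b) (s := s) (i := i) (j := j)
      (V := pairNeighbors b i j) (σ := σ) (M := M) hr).const_mul (-κ * ζ)).add
    ((IsWindow.comp_stateAt (b := b) (s := s) (by positivity : 0 ≤ 3 * r)
      (measurable_one.indicator hAm : Measurable (A.indicator (1 : (Fin p → ℝ) → ℝ)))).const_mul
      (κ * g))
  have hmean : ∀ y, g * A.indicator (1 : (Fin p → ℝ) → ℝ) y ≤
      ζ * idealMean b s i j σ y * patternProb r m / M := by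
    intro y
    have h1 := hc.le_idealMean hγ0 hγ hσ hσj y (i := i) (j := j)
    have h2 : q / 2 ≤ patternProb r m := by
      have := patternProb_sub_le hr m
      have h3 : m * (3 * r) * q ≤ (1 / 2) * q := by gcongr; linarith
      linarith
    have h4 : A.indicator (fun _ => c₁) y = c₁ * A.indicator (1 : (Fin p → ℝ) → ℝ) y := by
      by_cases hy : y ∈ A <;> simp [hy]
    have h5 : 0 ≤ A.indicator (1 : (Fin p → ℝ) → ℝ) y :=
      Set.indicator_nonneg (fun _ _ => zero_le_one) y
    rw [h4] at h1
    rw [hg, le_div_iff₀ hM0]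
    calc _ = β / 2 * (c₁ * A.indicator (1 : (Fin p → ℝ) → ℝ) y) * (q / 2) := by
          field_simp; ring
      _ ≤ |b i j| / 2 * (c₁ * A.indicator (1 : (Fin p → ℝ) → ℝ) y) * (q / 2) := by gcongr
      _ ≤ ζ * idealMean b s i j σ y * (q / 2) := by gcongr
      _ ≤ _ := by
          have : 0 ≤ ζ * idealMean b s i j σ y := le_trans (by positivity) h1
          gcongr
  have hmgf : ∀ y, ∫⁻ ω, ENNReal.ofReal (Real.exp (-κ * ζ *
      windowStat b s i j (pairNeighbors b i j) σ M r 0 y ω +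
      κ * g * A.indicator (1 : (Fin p → ℝ) → ℝ) (stateAt b s 0 y ω))) ∂driveLaw p ≤
      ENNReal.ofReal (Real.exp ((κ ^ 2 * C + 4 * κ * D) * q)) := by
    intro y
    have h1 := hc.lintegral_exp_windowStat_le hij hσ hr hM0 ((hc.abs_le i j).trans (by linarith)) hsM
      hD (hθ.trans_le hκ1) y
    calc _ = ∫⁻ ω, ENNReal.ofReal (Real.exp (-κ * ζ *
          windowStat b s i j (pairNeighbors b i j) σ M r 0 y ω)) * ENNReal.ofReal (Real.exp
          (κ * g * A.indicator (1 : (Fin p → ℝ) → ℝ) y)) ∂driveLaw p := by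
          refine lintegral_congr_ae ?_
          filter_upwards [ae_regular (p := p)] with ω hω
          rw [hω.stateAt_zero, Real.exp_add, ENNReal.ofReal_mul (Real.exp_nonneg _)]
      _ = _ * _ := lintegral_mul_const' _ _ ENNReal.ofReal_ne_top
      _ ≤ _ := mul_le_mul_left h1 _
      _ ≤ _ := by
          rw [← ENNReal.ofReal_mul (Real.exp_nonneg _), ← Real.exp_add]
          refine ENNReal.ofReal_le_ofReal (Real.exp_le_exp.2 ?_)
          rw [← sq_abs, hθ]
          have h2 := mul_le_mul_of_nonneg_left (hmean y) hκ0
          have h3 : -κ * ζ / M * (patternProb r m * idealMean b s i j σ y) =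
            -(κ * (ζ * idealMean b s i j σ y * patternProb r m / M)) := by ring
          rw [h3]
          linarith
  refine (measure_mono ?_).trans ((hw.driveLaw_le_sum (by positivity) hmgf K x
    (κ * (8 * K * q * D))).trans (ENNReal.ofReal_le_ofReal (Real.exp_le_exp.2 ?_)))
  · rintro ω ⟨h1, h2⟩
    simp only [Set.mem_ofPred_eq, Finset.sum_add_distrib, ← Finset.mul_sum]
    set U := ∑ k ∈ Finset.range K,
        windowStat b s i j (pairNeighbors b i j) σ M r (k * (3 * r)) x ω
    set N := ∑ k ∈ Finset.range K, A.indicator (1 : (Fin p → ℝ) → ℝ)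
      (stateAt b s (k * (3 * r)) x ω)
    have h3 : ζ * U ≤ 8 * K * q * D := by
      refine (le_abs_self _).trans ?_
      rw [abs_mul, hζ1, one_mul]
      exact h1.le
    have hg0 : 0 ≤ g := by positivity
    -- By `hDM`, K/64 visits give at least twice the level 8KqD.
    have h4 : 16 * K * q * D ≤ g * N := by
      refine le_trans ?_ (mul_le_mul_of_nonneg_left h2 hg0)
      rw [hg, div_mul_div_comm, le_div_iff₀ (by positivity)]
      have := mul_le_mul_of_nonneg_left hDM (mul_nonneg hq0 (Nat.cast_nonneg (α := ℝ) K))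
      linarith
    have h5 : 8 * K * q * D ≤ -(ζ * U) + g * N := by linarith
    have h6 := mul_le_mul_of_nonneg_left h5 hκ0
    linarith
  · apply le_of_eq
    rw [hκ]
    field_simp
    ring

/-- Either fewer than K/64 windows start with a large drift, which is unlikely by
`driveLaw_visits_le`, or the preceding bound applies. -/
theorem IsContractive.driveLaw_sum_windowStat_lt [NeZero p] (hc : IsContractive b s γ)
    (hγ0 : 0 ≤ γ) (hγ : γ < 1) {i j : Fin p} (hij : i ≠ j) {σ r M D β : ℝ} (hσ : 0 < σ)
    (hσj : σ ≤ s j) (hr : 0 < r) (hr1 : 3 * r ≤ 1) (hM : 1 ≤ M) (hβ : 0 < β) (hbβ : β ≤ |b i j|)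
    (hsM : s i / σ ≤ M) (hD : (pairNeighbors b i j).card * (3 * r) ≤ 2 * D) (hD0 : 0 ≤ D)
    (hD1 : D ≤ 1 / 4) (hDM : 4096 * M * D ≤ β * ratioConst ((1 - γ ^ 2) / 2)) {K : ℕ}
    (hK : 4 ≤ K * (3 * r)) (x : Fin p → ℝ) :
    driveLaw p {ω | |∑ k ∈ Finset.range K,
        windowStat b s i j (pairNeighbors b i j) σ M r (k * (3 * r)) x ω| <
          8 * K * patternProb r 0 * D} ≤
      ENNReal.ofReal (Real.exp (-(4 * K * patternProb r 0 * D ^ 2 / expConst)) +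
        Real.exp (-(K * (3 * r) / 256))) := by
  set A := {y | (1 - γ ^ 2) / 2 * s j ≤ |drift b i j y|} with hA
  have hAm : MeasurableSet A := measurableSet_le measurable_const (measurable_drift i j).abs
  set τ := 3 * r with hτ
  have hτ0 : 0 < τ := by positivity
  -- n windows last between 1 and 2 units of time, and the full blocks of 2n windows cover at least
  -- half of the K windows.
  set n := ⌈1 / τ⌉₊ with hn
  have hn0 : 0 < n := Nat.ceil_pos.2 (by positivity)
  have hn0' : (0 : ℝ) < n := Nat.cast_pos.2 hn0
  have hnτ : 1 ≤ n * τ := by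
    have := Nat.le_ceil (1 / τ)
    rwa [div_le_iff₀ hτ0] at this
  have hnτ' : n * τ ≤ 2 := by
    have := (Nat.ceil_lt_add_one (by positivity : 0 ≤ 1 / τ)).le
    have h2 := mul_le_mul_of_nonneg_right this hτ0.le
    rw [add_mul, div_mul_cancel₀ _ hτ0.ne'] at h2
    linarith
  set B := K / (2 * n) with hB
  have hBK : B * (2 * n) ≤ K := Nat.div_mul_le_self _ _
  have hK2n : 2 * n ≤ K := by
    have h1 : (2 * n : ℝ) * τ ≤ K * τ := by linarith
    exact_mod_cast le_of_mul_le_mul_right h1 hτ0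
  have hBK2 : (K : ℝ) / 2 ≤ B * (2 * n) := by
    have h1 : K < B * (2 * n) + 2 * n := by
      have := Nat.lt_div_mul_add (a := K) (b := 2 * n) (by omega)
      exact this
    have h2 : 1 ≤ B := (Nat.one_le_div_iff (by omega)).2 hK2n
    have h3 : 2 * n ≤ B * (2 * n) := Nat.le_mul_of_pos_left _ h2
    have h4 : K ≤ 2 * (B * (2 * n)) := by omega
    have h5 : (K : ℝ) ≤ 2 * (B * (2 * n)) := by exact_mod_cast h4
    linarith
  have hBτ : K * τ / 256 ≤ (B : ℝ) / 32 := by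
    have h1 := mul_le_mul_of_nonneg_right hBK2 hτ0.le
    have h2 := mul_le_mul_of_nonneg_left hnτ' (Nat.cast_nonneg (α := ℝ) B)
    linarith
  have hvis := driveLaw_visits_le (b := b) (s := s) hAm (fun t ht y => ?_) hτ0.le hn0 hnτ B x
  · refine (measure_mono ?_).trans ((measure_union_le _ _).trans
      ((add_le_add (hc.driveLaw_sum_windowStat_inter_visits hγ0 hγ hij hσ hσj hr.le hM hβ hbβ hsM hD
        hD0 hD1 hDM K x) hvis).trans ?_))
    · intro ω hω
      by_cases h : (K : ℝ) / 64 ≤ ∑ k ∈ Finset.range K,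
          A.indicator (1 : (Fin p → ℝ) → ℝ) (stateAt b s (k * (3 * r)) x ω)
      · exact Or.inl ⟨hω, h⟩
      · right
        simp only [Set.mem_ofPred_eq]
        have h1 : ∑ k ∈ Finset.range (B * (2 * n)),
            A.indicator (1 : (Fin p → ℝ) → ℝ) (stateAt b s (k * τ) x ω) ≤
            ∑ k ∈ Finset.range K, A.indicator (1 : (Fin p → ℝ) → ℝ) (stateAt b s (k * τ) x ω) :=
          Finset.sum_le_sum_of_subset_of_nonneg (Finset.range_subset_range.2 hBK) fun _ _ _ =>
            Set.indicator_nonneg (fun _ _ => zero_le_one) _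
        push Not at h
        linarith
    · rw [← ENNReal.ofReal_add (Real.exp_nonneg _) (Real.exp_nonneg _)]
      refine ENNReal.ofReal_le_ofReal (add_le_add_right (Real.exp_le_exp.2 ?_) _)
      linarith
  · refine le_trans (ENNReal.ofReal_le_ofReal ?_)
      (driveLaw_le_abs_drift hc.row hγ hc.diag (hc.pos j) (zero_le_one.trans ht) y)
    have h2 : Real.exp (-t) ≤ 1 / 2 := by
      rw [Real.exp_neg, inv_eq_one_div]
      exact one_div_le_one_div_of_le (by norm_num) (by linarith [Real.add_one_le_exp t])
    linarith

end

end

section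

variable {p : ℕ}

/-! ### Boundedness of the dynamics -/

theorem gaussianReal_abs_gt_le {c : ℝ} (hc : 0 ≤ c) :
    gaussianReal 0 1 {z | c < |z|} ≤ ENNReal.ofReal (2 * Real.exp (-(c ^ 2 / 2))) := by
  have hint : ∀ t : ℝ, Integrable (fun z => Real.exp (t * id z)) (gaussianReal 0 1) := fun t =>
    integrable_exp_mul_gaussianReal t
  have h1 := measure_ge_le_exp_mul_mgf (μ := gaussianReal 0 1) (X := id) c hc (hint c)
  have h2 := measure_le_le_exp_mul_mgf (μ := gaussianReal 0 1) (X := id) (-c) (neg_nonpos.2 hc)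
    (hint (-c))
  rw [mgf_id_gaussianReal, ← Real.exp_add] at h1 h2
  have e : -(c ^ 2 / 2) = -c * c + (0 * c + ((1 : NNReal) : ℝ) * c ^ 2 / 2) := by
    push_cast; ring
  have e' : -(c ^ 2 / 2) = -(-c) * (-c) + (0 * (-c) + ((1 : NNReal) : ℝ) * (-c) ^ 2 / 2) := by
    push_cast; ring
  rw [← e] at h1
  rw [← e'] at h2
  have hsub : {z : ℝ | c < |z|} ⊆ {z | c ≤ id z} ∪ {z | id z ≤ -c} := by
    intro z hz
    rcases lt_abs.1 (show c < |z| from hz) with h | h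
    · exact Or.inl h.le
    · exact Or.inr (by simp only [Set.mem_ofPred_eq, id]; linarith)
  refine (measure_mono hsub).trans ((measure_union_le _ _).trans ?_)
  rw [two_mul, ENNReal.ofReal_add (Real.exp_nonneg _) (Real.exp_nonneg _)]
  refine add_le_add ?_ ?_
  · exact (ENNReal.le_ofReal_iff_toReal_le (measure_ne_top _ _) (Real.exp_nonneg _)).2 h1
  · exact (ENNReal.le_ofReal_iff_toReal_le (measure_ne_top _ _) (Real.exp_nonneg _)).2 h2

theorem driveLaw_noise [NeZero p] (m : ℕ) {A : Set ℝ} (hA : MeasurableSet A) :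
    driveLaw p {ω | (ω m).2.2 ∈ A} = gaussianReal 0 1 A := by
  have h1 : (driveLaw p).map (fun ω => ω m) = stepLaw p := Measure.infinitePi_map_eval _ m
  have h2 : (stepLaw p).map (fun e => e.2.2) = gaussianReal 0 1 := by
    have : (fun e : ℝ × Fin p × ℝ => e.2.2) = Prod.snd ∘ Prod.snd := rfl
    rw [this, ← Measure.map_map measurable_snd measurable_snd, stepLaw, Measure.map_snd_prod,
      measure_univ, one_smul, Measure.map_snd_prod, measure_univ, one_smul]
  rw [← h2, ← h1, Measure.map_map (by fun_prop) (by fun_prop), Measure.map_apply (by fun_prop) hA]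
  rfl

theorem driveLaw_large_noise_le [NeZero p] (N : ℕ) (T : ℝ) {c : ℝ} (hc : 0 ≤ c) :
    driveLaw p {ω | arr ω (N + 1) ≤ T ∨ ∃ m < N, c < |(ω m).2.2|} ≤
      ENNReal.ofReal (Real.exp (p * T) * 2⁻¹ ^ (N + 1) + N * (2 * Real.exp (-(c ^ 2 / 2)))) := by
  have h1 : driveLaw p {ω | ∃ m < N, c < |(ω m).2.2|} ≤
      ENNReal.ofReal (N * (2 * Real.exp (-(c ^ 2 / 2)))) := by
    have hsub : {ω : ℕ → ℝ × Fin p × ℝ | ∃ m < N, c < |(ω m).2.2|} ⊆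
        ⋃ m ∈ Finset.range N, {ω | (ω m).2.2 ∈ {z : ℝ | c < |z|}} := by
      rintro ω ⟨m, hm, h⟩
      simp only [Set.mem_iUnion]
      exact ⟨m, Finset.mem_range.2 hm, h⟩
    refine (measure_mono hsub).trans ((measure_biUnion_finset_le _ _).trans ?_)
    have hm : MeasurableSet {z : ℝ | c < |z|} := measurableSet_lt measurable_const (by fun_prop)
    simp only [driveLaw_noise _ hm, Finset.sum_const, Finset.card_range, nsmul_eq_mul]
    rw [ENNReal.ofReal_mul (Nat.cast_nonneg _), ENNReal.ofReal_natCast]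
    gcongr
    exact gaussianReal_abs_gt_le hc
  have h2 := driveLaw_arr_le (p := p) (N + 1) T
  rw [ENNReal.ofReal_add (by positivity) (by positivity), ENNReal.ofReal_mul (Real.exp_nonneg _),
    ENNReal.ofReal_pow (by norm_num), ENNReal.ofReal_inv_of_pos (by norm_num), ENNReal.ofReal_ofNat]
  exact (measure_union_le _ _).trans (add_le_add h2 h1)

/-- Over a polynomially long time, all the noises are of order `√(log (p / δ))`. -/
theorem exists_noise_const {C a : ℝ} (hC : 0 < C) (ha : 0 < a) :
    ∃ c : ℝ, 1 < c ∧ ∀ (p : ℕ) [NeZero p] (δ : ℝ), 0 < δ → δ < 1 / 2 → ∃ N : ℕ,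
      driveLaw p {ω | arr ω (N + 1) ≤ C * (p : ℝ) ^ a ∨
        ∃ m < N, c * √(Real.log (p / δ)) < |(ω m).2.2|} ≤ ENNReal.ofReal (δ / 4) := by
  set A := 2 * C + 17 with hA
  have hA0 : 0 < A := by positivity
  set e := a + 1 + 1 + 16 * A with he
  have he1 : 1 < e := by rw [he]; linarith
  refine ⟨√(2 * e), Real.lt_sqrt_of_sq_lt (by linarith), fun p _ δ hδ hδ2 => ?_⟩
  have hp : (1 : ℝ) ≤ p := Nat.one_le_cast.2 (NeZero.pos p)
  set T := C * (p : ℝ) ^ a with hT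
  have hT0 : 0 ≤ T := by positivity
  set R := p / δ with hR
  have hδR : 1 / δ ≤ R := by rw [hR]; gcongr
  have hR2 : 2 ≤ R := by
    refine le_trans ?_ hδR
    rw [le_div_iff₀ hδ]
    linarith
  have hpR : (p : ℝ) ≤ R := by
    rw [hR, le_div_iff₀ hδ]
    nlinarith
  have hR0 : 0 < R := by linarith
  have hL0 : 0 ≤ Real.log R := Real.log_nonneg (by linarith)
  -- Chosen so that e^{pT} 2^{-N} ≤ e^{pT - N/2} ≤ δ/8.
  set N := ⌈2 * (p * T + Real.log (8 / δ))⌉₊ with hN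
  have h8 : 1 ≤ 8 / δ := by rw [le_div_iff₀ hδ]; linarith
  have hlog8 : 0 ≤ Real.log (8 / δ) := Real.log_nonneg h8
  refine ⟨N, (driveLaw_large_noise_le N T (by positivity)).trans (ENNReal.ofReal_le_ofReal ?_)⟩
  have h1 : Real.exp (p * T) * 2⁻¹ ^ (N + 1) ≤ δ / 8 := by
    have h2 : (2⁻¹ : ℝ) ≤ Real.exp (-(1 / 2)) := by
      have := Real.add_one_le_exp (-(1 / 2) : ℝ)
      linarith
    have h3 : (2⁻¹ : ℝ) ^ (N + 1) ≤ Real.exp (-(1 / 2)) ^ N :=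
      (pow_le_pow_of_le_one (by norm_num) (by norm_num) (Nat.le_succ N)).trans
        (pow_le_pow_left₀ (by norm_num) h2 N)
    have h4 := Nat.le_ceil (2 * (p * T + Real.log (8 / δ)))
    calc _ ≤ Real.exp (p * T) * Real.exp (-(1 / 2)) ^ N := by gcongr
      _ = Real.exp (p * T + N * (-(1 / 2))) := by rw [← Real.exp_nat_mul, ← Real.exp_add]
      _ ≤ Real.exp (-Real.log (8 / δ)) := Real.exp_le_exp.2 (by linarith)
      _ = δ / 8 := by rw [Real.exp_neg, Real.exp_log (by positivity), inv_div]
  have hN1 : (N : ℝ) ≤ A * R ^ (a + 1) := by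
    have h2 := (Nat.ceil_lt_add_one (by positivity : 0 ≤ 2 * (p * T + Real.log (8 / δ)))).le
    have h3 : Real.log (8 / δ) ≤ 8 * R := by
      have := Real.log_le_self (by positivity : 0 ≤ 8 / δ)
      refine this.trans ?_
      rw [div_eq_mul_one_div]
      gcongr
    have h4 : p * T ≤ C * R ^ (a + 1) := by
      rw [hT, Real.rpow_add hR0, Real.rpow_one]
      calc _ = C * ((p : ℝ) ^ a * p) := by ring
        _ ≤ _ := by gcongr
    have h5 : R ≤ R ^ (a + 1) := Real.self_le_rpow_of_one_le (by linarith) (by linarith)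
    rw [hA]
    linarith
  have h2 : Real.exp (-((√(2 * e) * √(Real.log R)) ^ 2 / 2)) = (R ^ e)⁻¹ := by
    rw [mul_pow, Real.sq_sqrt (by positivity), Real.sq_sqrt hL0, Real.rpow_def_of_pos hR0,
      ← Real.exp_neg]
    congr 1
    ring
  rw [h2]
  have h3 : R ^ e = R ^ (a + 1) * (R * R ^ (16 * A)) := by
    rw [← Real.rpow_one_add' (by linarith) (by positivity), ← Real.rpow_add hR0]
    congr 1
    rw [he]; ring
  have h4 : 16 * A ≤ R ^ (16 * A) := by
    have h5 : (2 : ℝ) ^ (16 * A) ≤ R ^ (16 * A) := Real.rpow_le_rpow (by norm_num) hR2 (by positivity)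
    have h6 := one_add_mul_self_le_rpow_one_add (s := 1) (by norm_num) (p := 16 * A) (by linarith)
    norm_num at h6
    linarith
  have h7 : (N : ℝ) * (2 * (R ^ e)⁻¹) ≤ δ / 8 := by
    have h8 : 0 < R ^ (a + 1) := by positivity
    have h9 : R⁻¹ ≤ δ := by
      rw [inv_le_comm₀ hR0 hδ, ← one_div]
      exact hδR
    rw [h3]
    calc _ ≤ A * R ^ (a + 1) * (2 * (R ^ (a + 1) * (R * (16 * A)))⁻¹) := by gcongr
      _ = R⁻¹ / 8 := by field_simp; norm_num
      _ ≤ _ := by gcongr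
  linarith

/-- The cube of radius Y is invariant, since an updated value is at most γY + Sc ≤ Y. -/
theorem IsContractive.abs_chain_le {b : Fin p → Fin p → ℝ} {s : Fin p → ℝ} {γ S c Y : ℝ}
    (hc : IsContractive b s γ) (hs : ∀ i, s i ≤ S) (hY : S * c ≤ (1 - γ) * Y)
    {x : Fin p → ℝ} (hx : ∀ i, |x i| ≤ Y) {ω : ℕ → ℝ × Fin p × ℝ} {N : ℕ}
    (hω : ∀ m < N, |(ω m).2.2| ≤ c) {n : ℕ} (hn : n ≤ N) (i : Fin p) :
    |chain b s x ω n i| ≤ Y := by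
  induction n generalizing i with
  | zero => exact hx i
  | succ n ih =>
    have ih := ih (by omega)
    rw [chain]
    by_cases h : i = (ω n).2.1
    · subst h
      rw [Function.update_self]
      have hY0 : 0 ≤ Y := (abs_nonneg _).trans (hx (ω n).2.1)
      have h1 : |∑ l, b (ω n).2.1 l * chain b s x ω n l| ≤ γ * Y := by
        refine (Finset.abs_sum_le_sum_abs _ _).trans ?_
        calc _ ≤ ∑ l, |b (ω n).2.1 l| * Y := Finset.sum_le_sum fun l _ => by
              rw [abs_mul]
              exact mul_le_mul_of_nonneg_left (ih l) (abs_nonneg _)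
          _ = (∑ l, |b (ω n).2.1 l|) * Y := (Finset.sum_mul _ _ _).symm
          _ ≤ _ := mul_le_mul_of_nonneg_right (hc.row _) hY0
      have h2 : |s (ω n).2.1 * (ω n).2.2| ≤ S * c := by
        rw [abs_mul, abs_of_pos (hc.pos _)]
        exact mul_le_mul (hs _) (hω n (by omega)) (abs_nonneg _) ((hc.pos (ω n).2.1).le.trans (hs _))
      have h3 := abs_add_le (∑ l, b (ω n).2.1 l * chain b s x ω n l) (s (ω n).2.1 * (ω n).2.2)
      linarith
    · rw [Function.update_of_ne h]
      exact ih i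

/-! ### Gaussian graphical models -/

section Model

variable {G : SimpleGraph (Fin p)} {Cov : Matrix (Fin p) (Fin p) ℝ}

open Classical in
/-- The regression coefficients of the update rule. -/
noncomputable def edgeCoeff (G : SimpleGraph (Fin p)) (Cov : Matrix (Fin p) (Fin p) ℝ)
    (i j : Fin p) : ℝ := if G.Adj i j then beta Cov i j else 0

/-- The conditional standard deviations. -/
noncomputable def condStd (Cov : Matrix (Fin p) (Fin p) ℝ) (i : Fin p) : ℝ := √(condVar Cov i)

theorem updateValue_eq (x : Fin p → ℝ) (i : Fin p) (z : ℝ) :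
    updateValue G Cov x i z = (∑ l, edgeCoeff G Cov i l * x l) + condStd Cov i * z := by
  classical
  unfold updateValue edgeCoeff condStd
  rw [Finset.sum_filter]
  simp only [ite_mul, zero_mul]

theorem inv_diag_pos (h : Cov.PosDef) (i : Fin p) : 0 < Cov⁻¹ i i := h.inv.diag_pos

/-- With t = 1/Θ_ii, the quadratic form of Σ at e_i - tΘe_i equals Σ_ii - t. This turns the bound on
marginal variances into one on noise levels. -/
theorem condVar_le_diag (h : Cov.PosDef) (i : Fin p) : condVar Cov i ≤ Cov i i := by
  have hθ := inv_diag_pos h i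
  have hdet : IsUnit Cov.det := (Matrix.isUnit_iff_isUnit_det _).1 h.isUnit
  set t := (Cov⁻¹ i i)⁻¹ with ht
  set e : Fin p → ℝ := Pi.single i 1 with he
  have h1 := h.posSemidef.dotProduct_mulVec_nonneg (e - t • (Cov⁻¹.mulVec e))
  have h2 : Cov.mulVec (e - t • (Cov⁻¹.mulVec e)) = Cov.mulVec e - t • e := by
    rw [Matrix.mulVec_sub, Matrix.mulVec_smul, Matrix.mulVec_mulVec, Matrix.mul_nonsing_inv _ hdet,
      Matrix.one_mulVec]
  have hsymm : Cov⁻¹.transpose = Cov⁻¹ := by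
    have := h.inv.isHermitian
    rwa [Matrix.IsHermitian, Matrix.conjTranspose_eq_transpose_of_trivial] at this
  have h3 : dotProduct (Cov⁻¹.mulVec e) (Cov.mulVec e) = 1 := by
    rw [← Matrix.vecMul_transpose, hsymm, ← Matrix.dotProduct_mulVec, Matrix.mulVec_mulVec,
      Matrix.nonsing_inv_mul _ hdet, Matrix.one_mulVec, he]
    simp
  have h4 : dotProduct e (Cov.mulVec e) = Cov i i := by
    rw [he]; simp
  have h5 : dotProduct (Cov⁻¹.mulVec e) e = Cov⁻¹ i i := by
    rw [he]; simp
  have h6 : dotProduct e e = 1 := by rw [he]; simp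
  rw [star_trivial, h2, sub_dotProduct, dotProduct_sub, dotProduct_sub, smul_dotProduct,
    dotProduct_smul, smul_dotProduct, dotProduct_smul, h3, h4, h5, h6] at h1
  simp only [smul_eq_mul, mul_one] at h1
  have h7 : t * Cov⁻¹ i i = 1 := inv_mul_cancel₀ hθ.ne'
  rw [h7] at h1
  unfold condVar
  linarith

theorem inv_symm (h : Cov.PosDef) (i j : Fin p) : Cov⁻¹ i j = Cov⁻¹ j i := by
  have := h.inv.isHermitian.apply i j
  rwa [star_trivial, eq_comm] at this

theorem condVar_pos (h : Cov.PosDef) (i : Fin p) : 0 < condVar Cov i :=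
  inv_pos.2 (inv_diag_pos h i)

/-- A row has at most d nonzero entries, each of size at most β_max. The symmetry is that of Θ: on
an edge both sides are -Θ_ij / (Θ_ii Θ_jj). -/
theorem isContractive_edgeCoeff (hG : IsGGM G Cov) {d : ℕ} (hd : DegreeBound G d)
    {βmin βmax γ : ℝ} (hβ : BoundedEdgeStrength G Cov βmin βmax) (hβ0 : 0 ≤ βmax)
    (hγ : d * βmax ≤ γ) : IsContractive (edgeCoeff G Cov) (condStd Cov) γ where
  diag i := by simp [edgeCoeff]
  row i := by
    classical
    refine le_trans ?_ hγ
    have h1 : ∀ l, |edgeCoeff G Cov i l| ≤ if l ∈ G.neighborFinset i then βmax else 0 := by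
      intro l
      unfold edgeCoeff
      by_cases h : G.Adj i l
      · simpa [h] using (hβ i l h).2
      · simp [h]
    refine (Finset.sum_le_sum fun l _ => h1 l).trans ?_
    rw [Finset.sum_ite_mem, Finset.univ_inter, Finset.sum_const, nsmul_eq_mul]
    have h2 := hd i
    rw [Set.ncard_eq_toFinset_card'] at h2
    gcongr
    exact h2
  pos i := Real.sqrt_pos.2 (condVar_pos hG.posDef i)
  symm i j := by
    have h1 := inv_symm hG.posDef i j
    have hi := inv_diag_pos hG.posDef i
    have hj := inv_diag_pos hG.posDef j
    unfold edgeCoeff condStd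
    rw [Real.sq_sqrt (condVar_pos hG.posDef i).le, Real.sq_sqrt (condVar_pos hG.posDef j).le,
      G.adj_comm j i]
    split_ifs
    · unfold beta condVar
      rw [h1]
      field_simp
    · simp

theorem condStd_le (hG : Cov.PosDef) {σmin σmax : ℝ} (h : BoundedVariance Cov σmin σmax)
    (hσ : 0 ≤ σmax) (i : Fin p) : condStd Cov i ≤ σmax :=
  Real.sqrt_le_iff.2 ⟨hσ, (condVar_le_diag hG i).trans (h i).1⟩

theorem le_condStd {σmin σmax : ℝ} (h : BoundedVariance Cov σmin σmax) (i : Fin p) :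
    σmin ≤ condStd Cov i :=
  Real.le_sqrt_of_sq_le (h i).2

theorem card_pairNeighbors_le {d : ℕ} (hd : DegreeBound G d) (i j : Fin p) :
    (pairNeighbors (edgeCoeff G Cov) i j).card ≤ 2 * d := by
  classical
  have h : pairNeighbors (edgeCoeff G Cov) i j ⊆ G.neighborFinset i ∪ G.neighborFinset j := by
    intro l hl
    simp only [pairNeighbors, Finset.mem_filter] at hl
    simp only [Finset.mem_union, SimpleGraph.mem_neighborFinset]
    refine hl.2.2.2.imp (fun h => ?_) (fun h => ?_)
    all_goals
      by_contra hn
      exact h (if_neg hn)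
  have h2 : ∀ i, (G.neighborFinset i).card ≤ d := fun i => by
    have h2 := hd i
    rwa [Set.ncard_eq_toFinset_card'] at h2
  have := (Finset.card_le_card h).trans (Finset.card_union_le _ _)
  have := h2 i
  have := h2 j
  omega

end Model

end

section

variable {p : ℕ}

/-! ### Glauber dynamics and the driving sequence -/

/-- Given the later holding times, the first one would have to hit a single point. It is used to
exclude updates exactly at the boundaries of the thirds. -/
theorem driveLaw_arr_eq [NeZero p] (n : ℕ) (t : ℝ) : driveLaw p {ω | arr ω (n + 1) = t} = 0 := by
  have hm : MeasurableSet {ω : ℕ → ℝ × Fin p × ℝ | arr ω (n + 1) = t} :=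
    measurableSet_eq_fun (measurable_arr _) measurable_const
  have hatom : ∀ a : ℝ, stepLaw p {e | e.1 = a} = 0 := by
    intro a
    have h1 : expMeasure (p : ℝ) {a} = 0 :=
      (withDensity_absolutelyContinuous volume (exponentialPDF (p : ℝ))) (by simp)
    have h2 : {e : ℝ × Fin p × ℝ | e.1 = a} = {a} ×ˢ Set.univ := by ext; simp
    rw [h2, stepLaw, Measure.prod_prod, h1, zero_mul]
  rw [← lintegral_indicator_one hm, driveLaw, lintegral_infinitePi_split _
    (measurable_one.indicator hm), lintegral_lintegral_swap]
  · refine (lintegral_congr fun ω => ?_).trans lintegral_zero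
    have h2 : ∀ e, {ω : ℕ → ℝ × Fin p × ℝ | arr ω (n + 1) = t}.indicator (fun _ => (1 : ℝ≥0∞))
        (consSeq e ω) = {e : ℝ × Fin p × ℝ | e.1 = t - arr ω n}.indicator (fun _ => 1) e := by
      intro e
      have h3 : arr (consSeq e ω) (n + 1) = e.1 + arr ω n := arr_succ_tailSeq _ _
      have hiff : consSeq e ω ∈ {ω : ℕ → ℝ × Fin p × ℝ | arr ω (n + 1) = t} ↔
          e ∈ {e : ℝ × Fin p × ℝ | e.1 = t - arr ω n} := by
        simp only [Set.mem_ofPred_eq, h3, eq_sub_iff_add_eq]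
      by_cases he : e ∈ {e : ℝ × Fin p × ℝ | e.1 = t - arr ω n}
      · rw [Set.indicator_of_mem (hiff.2 he), Set.indicator_of_mem he]
      · rw [Set.indicator_of_notMem (mt hiff.1 he), Set.indicator_of_notMem he]
    refine (lintegral_congr h2).trans ?_
    rw [lintegral_indicator_const (measurableSet_eq_fun measurable_fst measurable_const), hatom,
      mul_zero]
  · exact ((measurable_one.indicator hm).comp (by fun_prop)).aemeasurable

section Link

variable {G : SimpleGraph (Fin p)} {Cov : Matrix (Fin p) (Fin p) ℝ} {Ω : Type*} [MeasurableSpace Ω]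
  {P : Measure Ω} {X : ℕ → Ω → Fin p → ℝ} {S : ℕ → Ω → ℝ} {I : ℕ → Ω → Fin p} {Z : ℕ → Ω → ℝ}

/-- The driving sequence of Glauber dynamics. -/
def driving (S : ℕ → Ω → ℝ) (I : ℕ → Ω → Fin p) (Z : ℕ → Ω → ℝ) (ω : Ω) : ℕ → ℝ × Fin p × ℝ :=
  fun n => (S (n + 1) ω - S n ω, I (n + 1) ω, Z (n + 1) ω)

theorem IsGlauberDynamics.measurable_driving (h : IsGlauberDynamics G Cov P X S I Z) :
    Measurable (driving S I Z) :=
  measurable_pi_lambda _ fun n => ((h.measurable_S (n + 1)).sub (h.measurable_S n)).prodMk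
    ((h.measurable_I (n + 1)).prodMk (h.measurable_Z (n + 1)))

theorem IsGlauberDynamics.map_driving [NeZero p] [IsProbabilityMeasure P]
    (h : IsGlauberDynamics G Cov P X S I Z) : P.map (driving S I Z) = driveLaw p := by
  have h1 : ∀ n, Measurable fun ω => driving S I Z ω n := fun n =>
    (measurable_pi_apply n).comp h.measurable_driving
  have h2 := (iIndepFun_iff_map_fun_eq_infinitePi_map h1).1 h.indep
  rw [show driving S I Z = fun ω n => driving S I Z ω n from rfl, h2, driveLaw]
  congr 1
  ext1 n
  exact h.law n

theorem IsGlauberDynamics.map_init_driving [NeZero p] [IsProbabilityMeasure P]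
    (h : IsGlauberDynamics G Cov P X S I Z) :
    P.map (fun ω => (X 0 ω, driving S I Z ω)) = (P.map (X 0)).prod (driveLaw p) := by
  rw [← h.map_driving]
  exact (indepFun_iff_map_prod_eq_prod_map_map (h.measurable_X 0).aemeasurable
    h.measurable_driving.aemeasurable).1 h.indep_init

theorem IsGlauberDynamics.measure_driving_le [NeZero p] [IsProbabilityMeasure P]
    (h : IsGlauberDynamics G Cov P X S I Z) (A : Set (ℕ → ℝ × Fin p × ℝ)) :
    P {ω | driving S I Z ω ∈ A} ≤ driveLaw p A := by
  rw [← h.map_driving]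
  exact Measure.le_map_apply h.measurable_driving.aemeasurable A

theorem IsGlauberDynamics.ae_driving [NeZero p] [IsProbabilityMeasure P]
    (h : IsGlauberDynamics G Cov P X S I Z) {q : (ℕ → ℝ × Fin p × ℝ) → Prop}
    (hq : ∀ᵐ ω ∂driveLaw p, q ω) : ∀ᵐ ω ∂P, q (driving S I Z ω) := by
  rw [← h.map_driving] at hq
  exact ae_of_ae_map h.measurable_driving.aemeasurable hq

/-- The initial state is independent of the driving sequence, so bounds uniform over deterministic
starts carry over to a random one. -/
theorem IsGlauberDynamics.measure_init_driving_le [NeZero p] [IsProbabilityMeasure P]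
    (h : IsGlauberDynamics G Cov P X S I Z) {A : Set ((Fin p → ℝ) × (ℕ → ℝ × Fin p × ℝ))}
    (hA : MeasurableSet A) {c : ℝ≥0∞} (hc : ∀ x, driveLaw p {ω | (x, ω) ∈ A} ≤ c) :
    P {ω | (X 0 ω, driving S I Z ω) ∈ A} ≤ c := by
  have hm : Measurable fun ω => (X 0 ω, driving S I Z ω) :=
    (h.measurable_X 0).prodMk h.measurable_driving
  have := Measure.isProbabilityMeasure_map (μ := P) (h.measurable_X 0).aemeasurable
  rw [show {ω | (X 0 ω, driving S I Z ω) ∈ A} = (fun ω => (X 0 ω, driving S I Z ω)) ⁻¹' A from rfl,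
    ← Measure.map_apply hm hA, h.map_init_driving, Measure.prod_apply hA]
  refine (lintegral_mono fun x => hc x).trans ?_
  rw [lintegral_const, measure_univ, mul_one]

theorem IsGlauberDynamics.ae_eq_chain (h : IsGlauberDynamics G Cov P X S I Z) :
    ∀ᵐ ω ∂P, (∀ n, S n ω = arr (driving S I Z ω) n) ∧
      ∀ n, X n ω = chain (edgeCoeff G Cov) (condStd Cov) (X 0 ω) (driving S I Z ω) n := by
  filter_upwards [h.start, h.step] with ω h0 h1
  refine ⟨fun n => ?_, fun n => ?_⟩
  · induction n with
    | zero => rw [h0, arr_zero]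
    | succ n ih => rw [arr_succ, ← ih]; simp [driving]
  · induction n with
    | zero => rfl
    | succ n ih =>
      rw [h1, chain, updateValue_eq, ← ih]
      rfl

end Link

/-! ### The data set read along the driving sequence -/

theorem Regular.lt_ncard_iff {ω : ℕ → ℝ × Fin p × ℝ} (h : Regular ω) {t : ℝ} {n : ℕ} :
    n < {n : ℕ | arr ω (n + 1) ≤ t}.ncard ↔ arr ω (n + 1) ≤ t := by
  have hex : ∃ n, t < arr ω (n + 1) := by
    refine ⟨cnt (t + 1) ω, ?_⟩
    have := mt (h.lt_cnt_iff (t := t + 1)).2 (lt_irrefl _)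
    linarith
  classical
  have hset : {n : ℕ | arr ω (n + 1) ≤ t} = Set.Iio (Nat.find hex) := by
    ext m
    rw [Set.mem_Iio, Nat.lt_find_iff]
    refine ⟨fun hm k hk => not_lt.2 (le_trans ?_ hm), fun hm => not_lt.1 (hm m le_rfl)⟩
    exact h.strictMono_arr.monotone (by omega)
  rw [hset, Set.ncard_eq_toFinset_card', Set.toFinset_Iio, Nat.card_Iio, ← Set.mem_Iio, ← hset]
  rfl

section Data

variable {b : Fin p → Fin p → ℝ} {s : Fin p → ℝ} {Ω : Type*} {X : ℕ → Ω → Fin p → ℝ}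
  {S : ℕ → Ω → ℝ} {I : ℕ → Ω → Fin p} {Z : ℕ → Ω → ℝ} {ω : Ω} {T : ℝ}

theorem numUpdates_eq (hS : ∀ n, S n ω = arr (driving S I Z ω) n) (t : ℝ) :
    numUpdates S t ω = {n : ℕ | arr (driving S I Z ω) (n + 1) ≤ t}.ncard := by
  unfold numUpdates
  simp only [hS]

theorem lt_numUpdates_iff (hr : Regular (driving S I Z ω))
    (hS : ∀ n, S n ω = arr (driving S I Z ω) n) {t : ℝ} {n : ℕ} :
    n < numUpdates S t ω ↔ arr (driving S I Z ω) (n + 1) ≤ t := by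
  rw [numUpdates_eq hS, hr.lt_ncard_iff]

theorem card_time_lt (hr : Regular (driving S I Z ω)) (hS : ∀ n, S n ω = arr (driving S I Z ω) n)
    {t : ℝ} (ht : t ≤ T) [DecidablePred fun n : Fin (observe X S I T ω).N =>
      (observe X S I T ω).time n.succ < t] :
    (Finset.univ.filter fun n : Fin (observe X S I T ω).N =>
      (observe X S I T ω).time n.succ < t).card = cnt t (driving S I Z ω) := by
  have hN : cnt t (driving S I Z ω) ≤ numUpdates S T ω := by
    by_contra hlt
    have h1 := (hr.lt_cnt_iff).1 (not_le.1 hlt)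
    exact lt_irrefl _ ((lt_numUpdates_iff hr hS).2 (h1.le.trans ht))
  have h1 : (Finset.univ.filter fun n : Fin (observe X S I T ω).N =>
      (observe X S I T ω).time n.succ < t) =
      Finset.univ.filter fun n : Fin (observe X S I T ω).N => (n : ℕ) < cnt t (driving S I Z ω) := by
    ext n
    simp only [Finset.mem_filter, Finset.mem_univ, true_and]
    rw [hr.lt_cnt_iff, ← hS]
    rfl
  rw [h1, Fin.card_filter_val_lt]
  exact min_eq_right hN

theorem valueBefore_observe (hr : Regular (driving S I Z ω))
    (hS : ∀ n, S n ω = arr (driving S I Z ω) n)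
    (hX : ∀ n, X n ω = chain b s (X 0 ω) (driving S I Z ω) n) {t : ℝ} (ht : t ≤ T) :
    (observe X S I T ω).valueBefore t = stateAt b s t (X 0 ω) (driving S I Z ω) := by
  classical
  rw [stateAt, ← hX]
  unfold Dataset.valueBefore
  exact congrArg (fun n => X n ω) (card_time_lt hr hS ht)

/-- `stateAt` is a left limit; it agrees with the right-continuous value because no update happens
at `t`. -/
theorem valueAt_observe (hr : Regular (driving S I Z ω))
    (hS : ∀ n, S n ω = arr (driving S I Z ω) n)
    (hX : ∀ n, X n ω = chain b s (X 0 ω) (driving S I Z ω) n) {t : ℝ} (ht : t ≤ T)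
    (hne : ∀ n, arr (driving S I Z ω) (n + 1) ≠ t) :
    (observe X S I T ω).valueAt t = stateAt b s t (X 0 ω) (driving S I Z ω) := by
  classical
  rw [← valueBefore_observe hr hS hX ht]
  unfold Dataset.valueBefore Dataset.valueAt
  have h : (fun n : Fin (observe X S I T ω).N => (observe X S I T ω).time n.succ ≤ t) =
      fun n => (observe X S I T ω).time n.succ < t := by
    ext n
    refine (lt_iff_le_and_ne.trans (and_iff_left ?_)).symm
    exact fun he => hne n ((hS _).symm.trans he)
  congr 2
  simp only [h]

theorem updatedIn_observe (hr : Regular (driving S I Z ω))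
    (hS : ∀ n, S n ω = arr (driving S I Z ω) n) {a c : ℝ} (hc : c ≤ T) (i : Fin p) :
    (observe X S I T ω).UpdatedIn i a c ↔ Updated i a c (driving S I Z ω) := by
  constructor
  · rintro ⟨n, h1, h2, h3⟩
    refine ⟨n, ?_, ?_, h1⟩
    · rw [← not_lt, hr.lt_cnt_iff, ← hS, not_lt]
      exact h2
    · rw [hr.lt_cnt_iff, ← hS]
      exact h3
  · rintro ⟨n, h1, h2, h3⟩
    rw [← not_lt, hr.lt_cnt_iff, not_lt] at h1
    rw [hr.lt_cnt_iff] at h2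
    refine ⟨⟨n, (lt_numUpdates_iff hr hS).2 (h2.le.trans hc)⟩, h3, ?_, ?_⟩
    · exact h1.trans_eq (hS _).symm
    · exact (hS _).trans_lt h2

theorem eventA_observe (hr : Regular (driving S I Z ω))
    (hS : ∀ n, S n ω = arr (driving S I Z ω) n) {τ : ℝ} (hτ : 0 ≤ τ) {k : ℕ}
    (hk : (k + 1 : ℕ) * τ ≤ T) (i j : Fin p) :
    (observe X S I T ω).EventA τ (k + 1) i j ↔
      Pattern i j ∅ (τ / 3) (k * τ) (driving S I Z ω) := by
  -- The algorithm numbers its windows from 1; window k + 1 starts at kτ.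
  have e0 : (((k + 1 : ℕ) : ℝ) - 1) * τ = k * τ := by push_cast; ring
  have e1 : (((k + 1 : ℕ) : ℝ) - 2 / 3) * τ = k * τ + τ / 3 := by push_cast; ring
  have e2 : (((k + 1 : ℕ) : ℝ) - 1 / 3) * τ = k * τ + 2 * (τ / 3) := by push_cast; ring
  have e3 : ((k + 1 : ℕ) : ℝ) * τ = k * τ + 3 * (τ / 3) := by push_cast; ring
  rw [e3] at hk
  unfold Dataset.EventA Pattern Solo
  rw [e0, e1, e2, e3]
  simp only [updatedIn_observe hr hS (show k * τ + τ / 3 ≤ T by linarith),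
    updatedIn_observe hr hS (show k * τ + 2 * (τ / 3) ≤ T by linarith),
    updatedIn_observe hr hS hk, Finset.mem_insert, Finset.notMem_empty, or_false, forall_eq]

/-- On bounded data the numerator is at most 2Y and a counted denominator at least σ, so the ratio
is at most M and the truncation in `windowStat` does nothing. -/
theorem testTerm_observe (hr : Regular (driving S I Z ω))
    (hS : ∀ n, S n ω = arr (driving S I Z ω) n)
    (hX : ∀ n, X n ω = chain b s (X 0 ω) (driving S I Z ω) n) {τ : ℝ} (hτ : 0 ≤ τ)
    (hne : ∀ m n : ℕ, arr (driving S I Z ω) (n + 1) ≠ m * (τ / 3)) {k : ℕ}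
    (hk : (k + 1 : ℕ) * τ ≤ T) {σ M Y : ℝ} (hσ : 0 < σ) (hM : M = 2 * Y / σ) (hY : 0 < Y)
    (hB : (observe X S I T ω).Bounded Y) (i j : Fin p) (V : Finset (Fin p)) :
    (observe X S I T ω).testTerm σ τ (k + 1) i j =
      M * windowStat b s i j V σ M (τ / 3) (k * τ) (X 0 ω) (driving S I Z ω) := by
  classical
  have e0 : (((k + 1 : ℕ) : ℝ) - 1) * τ = k * τ := by push_cast; ring
  have e1 : (((k + 1 : ℕ) : ℝ) - 2 / 3) * τ = k * τ + τ / 3 := by push_cast; ring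
  have e2 : (((k + 1 : ℕ) : ℝ) - 1 / 3) * τ = k * τ + 2 * (τ / 3) := by push_cast; ring
  have e3 : ((k + 1 : ℕ) : ℝ) * τ = k * τ + 3 * (τ / 3) := by push_cast; ring
  have hk' := hk
  rw [e3] at hk'
  have hM0 : 0 < M := by rw [hM]; positivity
  have hden : (observe X S I T ω).denom τ (k + 1) j =
      jumpDenom b s j (τ / 3) (k * τ) (X 0 ω) (driving S I Z ω) := by
    unfold Dataset.denom jumpDenom
    rw [e0, e2, valueAt_observe hr hS hX (by linarith), valueAt_observe hr hS hX (by linarith)]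
    · intro n h
      refine hne (3 * k) n (h.trans ?_)
      push_cast; ring
    · intro n h
      refine hne (3 * k + 2) n (h.trans ?_)
      push_cast; ring
  have hnum : (observe X S I T ω).numer τ (k + 1) i =
      jumpNumer b s i (τ / 3) (k * τ) (X 0 ω) (driving S I Z ω) := by
    unfold Dataset.numer jumpNumer
    rw [e1, e3, valueBefore_observe hr hS hX hk', valueBefore_observe hr hS hX (by linarith)]
  have hnumY : |jumpNumer b s i (τ / 3) (k * τ) (X 0 ω) (driving S I Z ω)| ≤ 2 * Y := by
    rw [← hnum]
    unfold Dataset.numer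
    refine (abs_sub _ _).trans ?_
    have h1 : ∀ t, |(observe X S I T ω).valueBefore t i| ≤ Y := fun t => hB _ _
    have := h1 (((k + 1 : ℕ) : ℝ) * τ)
    have := h1 ((((k + 1 : ℕ) : ℝ) - 2 / 3) * τ)
    linarith
  have hJ : |jumpRatio b s i j σ (τ / 3) (k * τ) (X 0 ω) (driving S I Z ω)| ≤ M := by
    unfold jumpRatio
    split_ifs with h
    · rw [abs_div, hM]
      gcongr
    · rw [abs_zero]
      exact hM0.le
  have hterm : (observe X S I T ω).testTerm σ τ (k + 1) i j =
      if Pattern i j ∅ (τ / 3) (k * τ) (driving S I Z ω) then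
        jumpRatio b s i j σ (τ / 3) (k * τ) (X 0 ω) (driving S I Z ω) else 0 := by
    unfold Dataset.testTerm Dataset.EventB jumpRatio
    rw [hden, hnum, eventA_observe hr hS hτ hk]
    by_cases h1 : Pattern i j ∅ (τ / 3) (k * τ) (driving S I Z ω) <;> simp [h1]
  rw [hterm, windowStat]
  by_cases h1 : Pattern i j ∅ (τ / 3) (k * τ) (driving S I Z ω)
  · rw [if_pos h1]
    by_cases h2 : Pattern i j V (τ / 3) (k * τ) (driving S I Z ω)
    · rw [if_pos h2, mul_div_cancel₀ _ hM0.ne']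
    · rw [if_neg h2, if_pos h1, min_eq_right, max_eq_right, mul_div_cancel₀ _ hM0.ne']
      · rw [le_div_iff₀ hM0]
        linarith [(abs_le.1 hJ).1]
      · rw [div_le_one hM0]
        exact (abs_le.1 hJ).2
  · rw [if_neg h1, if_neg (fun h2 => h1 (Pattern.mono h2 (Finset.empty_subset _))), if_neg h1,
      mul_zero]

theorem avgStat_observe (hr : Regular (driving S I Z ω))
    (hS : ∀ n, S n ω = arr (driving S I Z ω) n)
    (hX : ∀ n, X n ω = chain b s (X 0 ω) (driving S I Z ω) n) {τ : ℝ} (hτ : 0 < τ) (hT : 0 ≤ T)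
    (hne : ∀ m n : ℕ, arr (driving S I Z ω) (n + 1) ≠ m * (τ / 3)) {σ M Y : ℝ} (hσ : 0 < σ)
    (hM : M = 2 * Y / σ) (hY : 0 < Y) (hB : (observe X S I T ω).Bounded Y) (i j : Fin p)
    (V : Finset (Fin p)) :
    (observe X S I T ω).avgStat σ T τ i j = M / ⌊T / τ⌋₊ * ∑ k ∈ Finset.range ⌊T / τ⌋₊,
      windowStat b s i j V σ M (τ / 3) (k * (3 * (τ / 3))) (X 0 ω) (driving S I Z ω) := by
  have h1 : ∑ k ∈ Finset.Icc 1 ⌊T / τ⌋₊, (observe X S I T ω).testTerm σ τ k i j =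
      ∑ k ∈ Finset.range ⌊T / τ⌋₊, (observe X S I T ω).testTerm σ τ (k + 1) i j := by
    rw [Finset.range_eq_Ico,
      Finset.sum_Ico_add' (fun k => (observe X S I T ω).testTerm σ τ k i j) 0 _ 1]
    rfl
  unfold Dataset.avgStat
  rw [h1, Finset.sum_congr rfl fun k hk => testTerm_observe (V := V) hr hS hX hτ.le hne ?_ hσ hM hY
    hB i j, ← Finset.mul_sum, ← mul_assoc, one_div_mul_eq_div]
  · simp only [mul_div_cancel₀ τ (three_ne_zero' ℝ)]
  · rw [← le_div_iff₀ hτ]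
    exact (Nat.cast_le.2 (Finset.mem_range.1 hk)).trans (Nat.floor_le (by positivity))

end Data

end

section

variable {p : ℕ}

/-! ### The choice of the constants -/

/-- From 1 - e^{-r} ≥ r e^{-r} and e^{-r} ≥ 2/3, with 4/9 ≥ 1/3. -/
theorem cube_le_patternProb {r : ℝ} (hr : 0 ≤ r) (hr1 : r ≤ 1 / 3) :
    (r / 3) ^ 3 ≤ patternProb r 0 := by
  have h1 : 2 / 3 ≤ Real.exp (-r) := by linarith [Real.add_one_le_exp (-r)]
  have h2 : r * Real.exp (-r) ≤ 1 - Real.exp (-r) := by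
    have h3 : (r + 1) * Real.exp (-r) ≤ 1 := by
      calc _ ≤ Real.exp r * Real.exp (-r) := by gcongr; exact Real.add_one_le_exp r
        _ = 1 := by rw [← Real.exp_add, add_neg_cancel, Real.exp_zero]
    linarith
  unfold patternProb
  simp only [zero_add, Nat.cast_one, one_mul]
  refine pow_le_pow_left₀ (by positivity) ?_ 3
  calc r / 3 ≤ r * (2 / 3) * (2 / 3) := by linarith
    _ ≤ r * Real.exp (-r) * Real.exp (-r) := by gcongr
    _ ≤ _ := by gcongr

theorem qOf_eq (τ : ℝ) : qOf τ = patternProb (τ / 3) 0 := by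
  simp only [qOf, patternProb, zero_add, Nat.cast_one, one_mul, neg_div]

theorem quarter_le_log {R : ℝ} (hR : 2 ≤ R) : 1 / 4 ≤ Real.log R := by
  have h1 := Real.one_sub_inv_le_log_of_pos (by linarith : 0 < R)
  have h2 : R⁻¹ ≤ 2⁻¹ := inv_anti₀ (by norm_num) hR
  linarith

section Constants

variable {A S c C C₂ C₃ L β σ T D τ M d : ℝ}

theorem half_le_sqrt (hL : 1 / 4 ≤ L) : 1 / 2 ≤ √L :=
  Real.le_sqrt_of_sq_le (by linarith)

/-- Since q ≥ (τ/9)³ and Kτ ≥ T/2, the exponent is at least of order TD⁴/d², where D is at least of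
order σβ/√L; this dictates T. The first summand of `C₂` secures T ≥ 1536L for the visits, the second
one the exponent. -/
theorem duration_bounds (hS : 0 < S) (hC : 0 < C) (hC₃ : 0 < C₃)
    (hC₂ : C₂ = 24576 * S ^ 4 + 1100 * C * (C₃ + 2 * S) ^ 4) (hL : 1 / 4 ≤ L) (hβ : 0 < β)
    (hβ1 : β ≤ 1) (hσ : 0 < σ) (hσS : σ ≤ S) (hd : 1 ≤ d)
    (hD : D = (C₃ * √L / (σ * β) + 1)⁻¹) (hτ : τ = d⁻¹ * D)
    (hT : C₂ / (β * σ) ^ 4 * d ^ 2 * L ^ 3 ≤ T) :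
    0 < D ∧ 0 < τ ∧ τ ≤ 1 ∧ 1536 * L ≤ T ∧ T / 2 ≤ ⌊T / τ⌋₊ * τ ∧
      3 * L ≤ 4 * ⌊T / τ⌋₊ * patternProb (τ / 3) 0 * D ^ 2 / C := by
  have hl := half_le_sqrt hL
  have hl2 : √L ^ 2 = L := Real.sq_sqrt (by linarith)
  set l := √L
  have hD0 : 0 < D := by rw [hD]; positivity
  have hD1 : D ≤ 1 := by
    rw [hD]
    refine inv_le_one_of_one_le₀ ?_
    have : 0 ≤ C₃ * l / (σ * β) := by positivity
    linarith
  have hτ0 : 0 < τ := by rw [hτ]; positivity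
  have hτ1 : τ ≤ 1 := by
    rw [hτ]
    exact mul_le_one₀ (inv_le_one_of_one_le₀ hd) hD0.le hD1
  have hβσ : 0 < β * σ := by positivity
  have hβσS : β * σ ≤ S := by
    calc β * σ ≤ 1 * S := by gcongr
      _ = S := one_mul S
  have hT1 : 1536 * L ≤ T := by
    refine le_trans ?_ hT
    have h1 : 24576 * S ^ 4 / S ^ 4 ≤ C₂ / (β * σ) ^ 4 := by
      rw [hC₂]
      gcongr
      have : 0 ≤ 1100 * C * (C₃ + 2 * S) ^ 4 := by positivity
      linarith
    rw [mul_div_cancel_right₀ _ (by positivity)] at h1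
    have h2 : 1 ≤ d ^ 2 := one_le_pow₀ hd
    calc 1536 * L = 24576 * 1 * ((1 / 4) ^ 2 * L) := by ring
      _ ≤ 24576 * d ^ 2 * (L ^ 2 * L) := by gcongr
      _ = 24576 * d ^ 2 * L ^ 3 := by ring
      _ ≤ _ := by gcongr
  have hK : T / 2 ≤ ⌊T / τ⌋₊ * τ := by
    have h1 := (Nat.lt_floor_add_one (T / τ)).le
    rw [div_le_iff₀ hτ0] at h1
    linarith
  refine ⟨hD0, hτ0, hτ1, hT1, hK, ?_⟩
  -- The summand 1 is absorbed using σβ ≤ S and 1 ≤ 2√L.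
  have hDlow : σ * β / ((C₃ + 2 * S) * l) ≤ D := by
    rw [hD, ← one_div, div_le_div_iff₀ (by positivity) (by positivity)]
    have h1 : σ * β * (C₃ * l / (σ * β) + 1) = C₃ * l + σ * β := by field_simp
    rw [h1]
    have h2 : S * (1 / 2) ≤ S * l := by gcongr
    linarith
  have hq := cube_le_patternProb (r := τ / 3) (by positivity) (by linarith)
  rw [le_div_iff₀ hC]
  set E := C₃ + 2 * S
  have hE : 0 < E := by positivity
  have h3 : 1100 * C * E ^ 4 ≤ C₂ := by
    rw [hC₂]
    have : 0 ≤ 24576 * S ^ 4 := by positivity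
    linarith
  have h4 : (σ * β / (E * l)) ^ 4 ≤ D ^ 4 := by gcongr
  have h5 : T / 2 * (4 / 729 * d⁻¹ ^ 2) * D ^ 4 ≤
      4 * ⌊T / τ⌋₊ * patternProb (τ / 3) 0 * D ^ 2 := by
    calc _ ≤ ⌊T / τ⌋₊ * τ * (4 / 729 * d⁻¹ ^ 2) * D ^ 4 := by gcongr
      _ = 4 * ⌊T / τ⌋₊ * (τ / 3 / 3) ^ 3 * D ^ 2 := by rw [hτ]; ring
      _ ≤ _ := by gcongr
  refine le_trans ?_ h5
  have h6 : 1100 * C * E ^ 4 / (β * σ) ^ 4 * d ^ 2 * L ^ 3 ≤ T := by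
    refine le_trans ?_ hT
    gcongr
  -- The constant 1100 is chosen so that 1100 · (1/2) · (4/729) exceeds 3.
  calc 3 * L * C ≤ 2200 / 729 * C * L := by nlinarith [mul_pos hC (by linarith : 0 < L)]
    _ = 1100 * C * E ^ 4 / (β * σ) ^ 4 * d ^ 2 * (l ^ 2) ^ 3 / 2 * (4 / 729 * d⁻¹ ^ 2) *
        (σ * β / (E * l)) ^ 4 := by
        rw [← hl2]
        field_simp
        norm_num
    _ ≤ T / 2 * (4 / 729 * d⁻¹ ^ 2) * D ^ 4 := by
        have hT0 : 0 ≤ T := by linarith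
        rw [hl2]
        gcongr

/-- The factor √L in M cancels the one in D. The summand 6S of `C₃` gives D ≤ 1/4, the other one
makes the bias small against the signal. -/
theorem threshold_bounds (hS : 0 < S) (hA : 1 ≤ A) (hc : 0 < c)
    (hC₃ : C₃ = 6 * S + 8192 * A * S / c) (hL : 1 / 4 ≤ L) (hβ : 0 < β)
    (hβ1 : β ≤ 1) (hσ : 0 < σ) (hσS : σ ≤ S) (hD : D = (C₃ * √L / (σ * β) + 1)⁻¹)
    (hM : M = 2 * (A * S * √L) / σ) :
    D ≤ 1 / 4 ∧ 4096 * M * D ≤ β * c ∧ 1 ≤ M ∧ S / σ ≤ M := by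
  have hl := half_le_sqrt hL
  set l := √L
  have hSM : S / σ ≤ M := by
    rw [hM]
    gcongr
    have : S * (1 / 2) ≤ A * S * l := by
      calc S * (1 / 2) = 1 * S * (1 / 2) := by ring
        _ ≤ _ := by gcongr
    linarith
  have h1S : 1 ≤ S / σ := by rwa [one_le_div hσ]
  have hβσS : σ * β ≤ S := by
    calc σ * β ≤ S * 1 := by gcongr
      _ = S := mul_one S
  have hc3 : 8192 * A * S / c ≤ C₃ := by rw [hC₃]; linarith
  have hc3' : 6 * S ≤ C₃ := by
    have : 0 ≤ 8192 * A * S / c := by positivity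
    rw [hC₃]; linarith
  have hC30 : 0 < C₃ := by linarith
  refine ⟨?_, ?_, h1S.trans hSM, hSM⟩
  · rw [hD, show (1 : ℝ) / 4 = 4⁻¹ by norm_num]
    refine inv_anti₀ (by norm_num) ?_
    have : 3 ≤ C₃ * l / (σ * β) := by
      rw [le_div_iff₀ (by positivity)]
      have : 6 * S * (1 / 2) ≤ C₃ * l := by gcongr
      linarith
    linarith
  · have h1 : D ≤ (C₃ * l / (σ * β))⁻¹ := by
      rw [hD]
      exact inv_anti₀ (by positivity) (by linarith)
    have hM0 : 0 ≤ M := by linarith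
    calc 4096 * M * D ≤ 4096 * M * (C₃ * l / (σ * β))⁻¹ := by gcongr
      _ = β * (8192 * A * S / C₃) := by
          rw [hM]
          field_simp
          norm_num
      _ ≤ β * c := by
          gcongr
          rw [div_le_iff₀ hC30]
          rw [div_le_iff₀ hc] at hc3
          linarith

end Constants

/-! ### Correctness of the algorithm -/

theorem one_sub_le_measureReal {Ω : Type*} [MeasurableSpace Ω] {P : Measure Ω}
    [IsProbabilityMeasure P] {G B : Set Ω} {ε : ℝ} (hε : 0 ≤ ε) (h : Gᶜ ⊆ B)
    (hB : P B ≤ ENNReal.ofReal ε) : 1 - ε ≤ P.real G := by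
  have h1 : P.real B ≤ ε := ENNReal.toReal_le_of_le_ofReal hε hB
  have h2 : (1 : ℝ) ≤ P.real G + P.real Gᶜ := by
    rw [← probReal_univ (μ := P), ← Set.union_compl_self G]
    exact measureReal_union_le _ _
  have h3 : P.real Gᶜ ≤ P.real B := measureReal_mono h
  linarith

section Main

variable {G : SimpleGraph (Fin p)} {Cov : Matrix (Fin p) (Fin p) ℝ} {Ω : Type*} {X : ℕ → Ω → Fin p → ℝ} {S : ℕ → Ω → ℝ} {I : ℕ → Ω → Fin p} {Z : ℕ → Ω → ℝ}

/-- The outcome follows the driving sequence, and its states up to time `T` are bounded by `Y`. -/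
structure IsTame (G : SimpleGraph (Fin p)) (Cov : Matrix (Fin p) (Fin p) ℝ)
    (X : ℕ → Ω → Fin p → ℝ) (S : ℕ → Ω → ℝ) (I : ℕ → Ω → Fin p) (Z : ℕ → Ω → ℝ) (T Y : ℝ) (ω : Ω) :
    Prop where
  regular : Regular (driving S I Z ω)
  time_eq : ∀ n, S n ω = arr (driving S I Z ω) n
  state_eq : ∀ n, X n ω = chain (edgeCoeff G Cov) (condStd Cov) (X 0 ω) (driving S I Z ω) n
  abs_le : ∀ n, S n ω ≤ T → ∀ i, |X n ω i| ≤ Y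

theorem IsTame.abs_path_le {T Y : ℝ} {ω : Ω} (h : IsTame G Cov X S I Z T Y ω) {t : ℝ} (ht : 0 ≤ t)
    (htT : t ≤ T) {n : ℕ} (hn : n ≤ numUpdates S t ω) (i : Fin p) : |X n ω i| ≤ Y := by
  refine h.abs_le n (le_trans ?_ htT) i
  cases n with
  | zero => rwa [h.time_eq, arr_zero]
  | succ n =>
    rw [h.time_eq]
    exact (lt_numUpdates_iff h.regular h.time_eq).1 hn

/-- Apart from a null set there are two ways to fail: a large initial state, or too many rounds or a
large noise among the first N. Otherwise the invariant cube confines the path. -/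
theorem IsGlauberDynamics.measure_not_isTame_le [NeZero p] [MeasurableSpace Ω] {P : Measure Ω}
    [IsProbabilityMeasure P]
    (h : IsGlauberDynamics G Cov P X S I Z) {γ σmax c Y₀ Y T ε ε' : ℝ} {N : ℕ}
    (hc : IsContractive (edgeCoeff G Cov) (condStd Cov) γ) (hs : ∀ i, condStd Cov i ≤ σmax)
    (hY₀ : Y₀ ≤ Y) (hY : σmax * c ≤ (1 - γ) * Y) (hε : 0 ≤ ε) (hε' : 0 ≤ ε')
    (hX : P {ω | ∃ i, Y₀ < |X 0 ω i|} ≤ ENNReal.ofReal ε)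
    (hN : driveLaw p {ω | arr ω (N + 1) ≤ T ∨ ∃ m < N, c < |(ω m).2.2|} ≤ ENNReal.ofReal ε') :
    P {ω | ¬ IsTame G Cov X S I Z T Y ω} ≤ ENNReal.ofReal (ε + ε') := by
  set N₁ := {ω | ∃ i, Y₀ < |X 0 ω i|}
  set N₂ := {ω | driving S I Z ω ∈ {ω : ℕ → ℝ × Fin p × ℝ | arr ω (N + 1) ≤ T ∨
    ∃ m < N, c < |(ω m).2.2|}}
  have hnull := (h.ae_eq_chain.and (h.ae_driving ae_regular))
  rw [Filter.Eventually, mem_ae_iff] at hnull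
  set N₃ := {ω | ((∀ n, S n ω = arr (driving S I Z ω) n) ∧
    ∀ n, X n ω = chain (edgeCoeff G Cov) (condStd Cov) (X 0 ω) (driving S I Z ω) n) ∧
      Regular (driving S I Z ω)}ᶜ
  have hsub : {ω | ¬ IsTame G Cov X S I Z T Y ω} ⊆ N₁ ∪ N₂ ∪ N₃ := by
    intro ω hω
    by_contra hn
    simp only [Set.mem_union, not_or] at hn
    obtain ⟨⟨h1, h2⟩, h3⟩ := hn
    obtain ⟨⟨hS, hX⟩, hr⟩ := not_not.1 h3
    refine hω ⟨hr, hS, hX, fun n hnT i => ?_⟩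
    have h1' : ∀ i, |X 0 ω i| ≤ Y := fun i => by
      by_contra hi
      exact h1 ⟨i, hY₀.trans_lt (not_le.1 hi)⟩
    have h2' := not_or.1 h2
    rw [hX]
    refine hc.abs_chain_le hs hY h1' (N := N) (fun m hm => ?_) ?_ i
    · by_contra hlt
      exact h2'.2 ⟨m, hm, not_le.1 hlt⟩
    · by_contra hlt
      rw [hS] at hnT
      exact h2'.1 ((hr.strictMono_arr.monotone (by omega)).trans hnT)
  calc _ ≤ P (N₁ ∪ N₂) + P N₃ := (measure_mono hsub).trans (measure_union_le _ _)
    _ ≤ P N₁ + P N₂ + P N₃ := add_le_add_left (measure_union_le _ _) _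
    _ ≤ ENNReal.ofReal ε + ENNReal.ofReal ε' + 0 := by
        refine add_le_add (add_le_add hX ((h.measure_driving_le _).trans hN)) hnull.le
    _ = _ := by rw [add_zero, ENNReal.ofReal_add hε hε']

/-- A tame outcome passes the boundedness check, and the threshold on the average is the level 8KqD
for the sum, multiplied by M/K. -/
theorem IsTame.algorithm_eq {Tmax T Y τ σ M D : ℝ} {ω : Ω} (h : IsTame G Cov X S I Z Tmax Y ω)
    (hT : 0 ≤ T) (hTm : T ≤ Tmax) (hτ : 0 < τ) (hσ : 0 < σ) (hY : 0 < Y) (hM : M = 2 * Y / σ)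
    (hK : 0 < ⌊T / τ⌋₊) (hne : ∀ m n : ℕ, arr (driving S I Z ω) (n + 1) ≠ m * (τ / 3))
    (htest : ∀ i j, i ≠ j → (G.Adj i j ↔ 8 * ⌊T / τ⌋₊ * patternProb (τ / 3) 0 * D ≤
      |∑ k ∈ Finset.range ⌊T / τ⌋₊, windowStat (edgeCoeff G Cov) (condStd Cov) i j
        (pairNeighbors (edgeCoeff G Cov) i j) σ M (τ / 3) (k * (3 * (τ / 3))) (X 0 ω)
        (driving S I Z ω)|)) :
    (observe X S I T ω).algorithm σ Y T τ (8 * patternProb (τ / 3) 0 * D * M) = G.edgeSet := by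
  have hB : (observe X S I T ω).Bounded Y := fun n i =>
    h.abs_path_le hT hTm (Nat.lt_succ_iff.1 n.isLt) i
  have hM0 : 0 < M := by rw [hM]; positivity
  have hK0 : (0 : ℝ) < ⌊T / τ⌋₊ := Nat.cast_pos.2 hK
  have hiff : ∀ i j, i ≠ j → (8 * patternProb (τ / 3) 0 * D * M ≤
      |(observe X S I T ω).avgStat σ T τ i j| ↔ G.Adj i j) := by
    intro i j hij
    rw [htest i j hij, avgStat_observe h.regular h.time_eq h.state_eq hτ hT hne hσ hM hY hB i j
      (pairNeighbors (edgeCoeff G Cov) i j), abs_mul, abs_of_pos (by positivity : 0 < M / ⌊T / τ⌋₊),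
      div_mul_eq_mul_div, le_div_iff₀ hK0,
      show 8 * patternProb (τ / 3) 0 * D * M * ⌊T / τ⌋₊ =
        M * (8 * ⌊T / τ⌋₊ * patternProb (τ / 3) 0 * D) by ring, mul_le_mul_iff_right₀ hM0]
  unfold Dataset.algorithm
  rw [if_pos hB]
  ext e
  simp only [Set.mem_ofPred_eq]
  constructor
  · rintro ⟨i, j, hij, rfl, hρ⟩
    exact (hiff i j hij.ne).1 hρ
  · induction e with | _ i j
    intro hadj
    have hadj' : G.Adj i j := hadj
    -- The statistic is not symmetric in the pair, but the tests are correct for both orders, so the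
    -- increasing one may be taken.
    rcases lt_or_gt_of_ne hadj'.ne with hlt | hlt
    · exact ⟨i, j, hlt, rfl, (hiff i j hlt.ne).2 hadj'⟩
    · exact ⟨j, i, hlt, Sym2.eq_swap, (hiff j i hlt.ne).2 hadj'.symm⟩

end Main

end

section

variable {p : ℕ}

/-- All the tests of pairs of nodes are probably correct. -/
theorem IsGlauberDynamics.measure_wrong_test_le [NeZero p] {G : SimpleGraph (Fin p)}
    {Cov : Matrix (Fin p) (Fin p) ℝ} {Ω : Type*} [MeasurableSpace Ω] {P : Measure Ω}
    [IsProbabilityMeasure P] {X : ℕ → Ω → Fin p → ℝ} {S : ℕ → Ω → ℝ} {I : ℕ → Ω → Fin p}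
    {Z : ℕ → Ω → ℝ} (h : IsGlauberDynamics G Cov P X S I Z) {γ β σ M D τ l : ℝ} {K : ℕ}
    (hc : IsContractive (edgeCoeff G Cov) (condStd Cov) γ) (hγ0 : 0 ≤ γ) (hγ : γ < 1)
    (hβ0 : 0 < β) (hβ : ∀ i j, G.Adj i j → β ≤ |edgeCoeff G Cov i j|) (hσ : 0 < σ)
    (hσs : ∀ i, σ ≤ condStd Cov i) (hM : 1 ≤ M) (hs : ∀ i, condStd Cov i / σ ≤ M)
    (hD : ∀ i j, (pairNeighbors (edgeCoeff G Cov) i j).card * τ ≤ 2 * D)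
    (hD0 : 0 ≤ D) (hD1 : D ≤ 1 / 4) (hDM : 4096 * M * D ≤ β * ratioConst ((1 - γ ^ 2) / 2))
    (hτ : 0 < τ) (hτ1 : τ ≤ 1) (hK : 4 ≤ K * τ)
    (hl : l ≤ 4 * K * patternProb (τ / 3) 0 * D ^ 2 / expConst) (hl' : l ≤ K * τ / 256) :
    P {ω | ¬ ∀ i j, i ≠ j → (G.Adj i j ↔ 8 * K * patternProb (τ / 3) 0 * D ≤
      |∑ k ∈ Finset.range K, windowStat (edgeCoeff G Cov) (condStd Cov) i j
        (pairNeighbors (edgeCoeff G Cov) i j) σ M (τ / 3) (k * (3 * (τ / 3))) (X 0 ω)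
        (driving S I Z ω)|)} ≤ ENNReal.ofReal (p ^ 2 * (2 * Real.exp (-l))) := by
  set b := edgeCoeff G Cov
  set s := condStd Cov
  have hM0 : 0 < M := by linarith
  have h3 : 3 * (τ / 3) = τ := mul_div_cancel₀ τ (three_ne_zero' ℝ)
  set q := patternProb (τ / 3) 0
  set A : Fin p → Fin p → (Fin p → ℝ) × (ℕ → ℝ × Fin p × ℝ) → ℝ := fun i j y =>
    |∑ k ∈ Finset.range K, windowStat b s i j (pairNeighbors b i j) σ M (τ / 3)
      (k * (3 * (τ / 3))) y.1 y.2| with hA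
  have hAm : ∀ i j, Measurable (A i j) := fun i j =>
    (Finset.measurable_sum _ fun k _ => measurable_windowStat _).abs
  have hpair : ∀ i j, P {ω | i ≠ j ∧ ¬ (G.Adj i j ↔ 8 * K * q * D ≤
      A i j (X 0 ω, driving S I Z ω))} ≤ ENNReal.ofReal (2 * Real.exp (-l)) := by
    intro i j
    by_cases hij : i = j
    · simp [hij]
    by_cases hadj : G.Adj i j
    · have h1 := h.measure_init_driving_le
        (A := {y | A i j y < 8 * K * q * D}) (measurableSet_lt (hAm i j) measurable_const)
        (fun x => hc.driveLaw_sum_windowStat_lt hγ0 hγ hij hσ (hσs j) (by positivity)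
          (h3.trans_le hτ1) hM hβ0 (hβ i j hadj) (hs i) (by rw [h3]; exact hD i j) hD0 hD1 hDM
          (by rwa [h3]) x)
      refine (measure_mono ?_).trans (h1.trans (ENNReal.ofReal_le_ofReal ?_))
      · rintro ω ⟨-, h2⟩
        by_contra hn
        exact h2 (iff_of_true hadj (not_lt.1 hn))
      · rw [h3, two_mul]
        exact add_le_add (Real.exp_le_exp.2 (neg_le_neg hl)) (Real.exp_le_exp.2 (neg_le_neg hl'))
    · have h1 := h.measure_init_driving_le
        (A := {y | 8 * K * q * D ≤ A i j y}) (measurableSet_le measurable_const (hAm i j))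
        (fun x => hc.driveLaw_sum_windowStat_of_eq_zero hij (if_neg hadj) hσ (by positivity) hM0
          (hs i) (by rw [h3]; exact hD i j) hD0 (by linarith) K x)
      refine (measure_mono ?_).trans (h1.trans (ENNReal.ofReal_le_ofReal ?_))
      · rintro ω ⟨-, h2⟩
        by_contra hn
        exact h2 (iff_of_false hadj hn)
      · gcongr
  have hsub : {ω | ¬ ∀ i j, i ≠ j → (G.Adj i j ↔ 8 * K * q * D ≤
      A i j (X 0 ω, driving S I Z ω))} ⊆ ⋃ ij : Fin p × Fin p, {ω | ij.1 ≠ ij.2 ∧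
        ¬ (G.Adj ij.1 ij.2 ↔ 8 * K * q * D ≤ A ij.1 ij.2 (X 0 ω, driving S I Z ω))} := by
    intro ω hω
    simp only [Set.mem_ofPred_eq, not_forall] at hω
    obtain ⟨i, j, hij, hω⟩ := hω
    exact Set.mem_iUnion.2 ⟨(i, j), hij, hω⟩
  refine (measure_mono hsub).trans ((measure_iUnion_fintype_le _ _).trans
    ((Finset.sum_le_sum fun ij _ => hpair ij.1 ij.2).trans ?_))
  rw [Finset.sum_const, Finset.card_univ, Fintype.card_prod, Fintype.card_fin, nsmul_eq_mul,
    ← ENNReal.ofReal_natCast, ← ENNReal.ofReal_mul (by positivity), Nat.cast_mul, sq]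

end

end GaussGlauber

open GaussGlauber

theorem theorem1
    (σmax γ C₀ C₁' C₁'' : ℝ) (hσmax : 0 < σmax) (hγ₀ : 0 < γ) (hγ₁ : γ < 1) (hC₀ : 0 < C₀)
    (hC₁' : 0 < C₁') (hC₁'' : 0 < C₁'') :
    ∃ (C₁ C₂ C₃ C₄ : ℝ), 0 < C₁ ∧ 0 < C₂ ∧ 0 < C₃ ∧ 0 < C₄ ∧
      ∀ (δ : ℝ), 0 < δ → δ < 1 / 2 →
      ∀ (p d : ℕ), 1 ≤ d →
      ∀ (βmin βmax σmin : ℝ), 0 < βmin → βmin ≤ βmax → 0 < σmin → d * βmax ≤ γ →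
      ∀ (G : SimpleGraph (Fin p)) (Cov : Matrix (Fin p) (Fin p) ℝ),
        GaussGlauber.IsGGM G Cov →
        GaussGlauber.DegreeBound G d →
        GaussGlauber.BoundedEdgeStrength G Cov βmin βmax →
        GaussGlauber.BoundedVariance Cov σmin σmax →
      ∀ (Ω : Type*) [MeasurableSpace Ω] (P : MeasureTheory.Measure Ω)
        [MeasureTheory.IsProbabilityMeasure P]
        (X : ℕ → Ω → Fin p → ℝ) (S : ℕ → Ω → ℝ) (I : ℕ → Ω → Fin p) (Z : ℕ → Ω → ℝ),
        GaussGlauber.IsGlauberDynamics G Cov P X S I Z →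
        P.real {ω | ∃ i, GaussGlauber.yMax C₀ σmax p δ < |X 0 ω i|} ≤ δ / 4 →
        1 - δ / 2 ≤ P.real {ω | ∀ t : ℝ, 0 ≤ t → t < C₁' * (p : ℝ) ^ C₁'' →
          ∀ i, |GaussGlauber.path X S t ω i| ≤ GaussGlauber.yMax C₁ σmax p δ} ∧
        ∀ (T τ ρ : ℝ),
          T ≤ C₁' * (p : ℝ) ^ C₁'' →
          C₂ / (βmin * σmin) ^ 4 * (d : ℝ) ^ 2 * Real.log (p / δ) ^ 3 ≤ T →
          τ = GaussGlauber.tauOf C₃ βmin σmin p d δ →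
          ρ = GaussGlauber.rhoOf C₄ τ σmin p d δ →
          1 - δ ≤ P.real {ω | (GaussGlauber.Dataset.algorithm
            (GaussGlauber.observe X S I T ω) σmin (GaussGlauber.yMax C₁ σmax p δ) T τ ρ)
              = G.edgeSet} := by
  obtain ⟨c, hc1, hnoise⟩ := exists_noise_const hC₁' hC₁''
  have h1γ : 0 < 1 - γ := by linarith
  set c₁ := ratioConst ((1 - γ ^ 2) / 2) with hc₁
  have hc₁0 : 0 < c₁ := ratioConst_pos (by nlinarith)
  have hE : 0 < expConst := by linarith [two_le_expConst]
  -- `C₀` covers the initial state, and c/(1 - γ) makes the cube of radius Y invariant for noises up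
  -- to c√L.
  set A := C₀ + c / (1 - γ) with hA
  have hcγ : c ≤ c / (1 - γ) := by
    rw [le_div_iff₀ h1γ]
    nlinarith
  have hA1 : 1 ≤ A := by linarith
  set C₃ := 6 * σmax + 8192 * A * σmax / c₁ with hC₃
  have hC₃0 : 0 < C₃ := by positivity
  set C₂ := 24576 * σmax ^ 4 + 1100 * expConst * (C₃ + 2 * σmax) ^ 4 with hC₂
  -- `C₄` is forced by ρ = 8qDM with D = dτ and M = 2Aσ_max√L/σ_min.
  refine ⟨A, C₂, C₃, 16 * A * σmax, by linarith, by positivity, hC₃0, by positivity, ?_⟩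
  intro δ hδ hδ2 p d hd βmin βmax σmin hβmin hββ hσmin hdβ G Cov hG hdeg hbeta hvar Ω _ P _ X S I Z
    hdyn hinit
  -- p ≥ 1 follows from the existence of the dynamics, since some outcome yields a node.
  have : Nonempty Ω := MeasureTheory.nonempty_of_isProbabilityMeasure P
  have : NeZero p := ⟨fun h0 => (h0 ▸ I 0 this.some : Fin 0).elim0⟩
  have hp : (1 : ℝ) ≤ p := Nat.one_le_cast.2 (NeZero.pos p)
  have hp0 : (0 : ℝ) < p := by linarith
  have hd1 : (1 : ℝ) ≤ d := Nat.one_le_cast.2 hd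
  obtain ⟨N, hN⟩ := hnoise p δ hδ hδ2
  set L := Real.log (p / δ) with hL
  have hL4 : 1 / 4 ≤ L := quarter_le_log (by rw [le_div_iff₀ hδ]; linarith)
  have hl := half_le_sqrt hL4
  have hβmax0 : 0 < βmax := by linarith
  have hcon := isContractive_edgeCoeff hG hdeg hbeta hβmax0.le hdβ
  set Tmax := C₁' * (p : ℝ) ^ C₁'' with hTmax
  set Y := yMax A σmax p δ with hY
  have hY' : Y = A * σmax * √L := rfl
  have hY0 : 0 < Y := by
    rw [hY']
    positivity
  have hs := condStd_le hG.posDef hvar hσmax.le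
  have htame : P {ω | ¬ IsTame G Cov X S I Z Tmax Y ω} ≤ ENNReal.ofReal (δ / 2) := by
    rw [show δ / 2 = δ / 4 + δ / 4 by ring]
    refine hdyn.measure_not_isTame_le hcon hs (Y₀ := yMax C₀ σmax p δ) ?_ ?_ (by positivity)
      (by positivity) ?_ hN
    · rw [hY', yMax]
      gcongr
      rw [hA]
      have : 0 ≤ c / (1 - γ) := by positivity
      linarith
    · rw [hY']
      have h1 : c ≤ (1 - γ) * A := by
        rw [hA, mul_add, mul_div_cancel₀ _ h1γ.ne']
        have := mul_pos h1γ hC₀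
        linarith
      calc σmax * (c * √L) ≤ σmax * ((1 - γ) * A * √L) := by gcongr
        _ = _ := by ring
    · rw [ENNReal.le_ofReal_iff_toReal_le (MeasureTheory.measure_ne_top _ _) (by positivity)]
      exact hinit
  refine ⟨one_sub_le_measureReal (by positivity) ?_ htame, ?_⟩
  · intro ω hω htm
    exact hω fun t ht htT i => htm.abs_path_le ht htT.le le_rfl i
  · intro T τ ρ hTT hT hτ hρ
    set D := (C₃ * √L / (σmin * βmin) + 1)⁻¹ with hD
    have hτD : τ = (d : ℝ)⁻¹ * D := hτ
    set M := 2 * Y / σmin with hM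
    have hβ1 : βmin ≤ 1 := by
      have : 1 * βmax ≤ d * βmax := by gcongr
      linarith
    have hσS : σmin ≤ σmax := (le_condStd hvar 0).trans (hs 0)
    obtain ⟨hD0, hτ0, hτ1, hTL, hKτ, hexp⟩ := duration_bounds hσmax hE hC₃0 hC₂ hL4 hβmin hβ1 hσmin
      hσS hd1 hD hτD hT
    obtain ⟨hD1, hDM, hM1, hSM⟩ := threshold_bounds hσmax hA1 hc₁0 hC₃ hL4 hβmin hβ1 hσmin hσS hD
      (M := M) rfl
    have hdτ : (d : ℝ) * τ = D := by
      rw [hτD, mul_inv_cancel_left₀ (by linarith)]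
    have hK : 0 < ⌊T / τ⌋₊ := Nat.floor_pos.2 (by rw [one_le_div hτ0]; linarith)
    have hρ' : ρ = 8 * patternProb (τ / 3) 0 * D * M := by
      rw [hρ, rhoOf, qOf_eq, hM, hY', ← hdτ]
      ring
    have hwrong := hdyn.measure_wrong_test_le (σ := σmin) (M := M) (D := D) (K := ⌊T / τ⌋₊)
      (l := 3 * L) hcon hγ₀.le hγ₁ hβmin
      (fun i j hij => by rw [edgeCoeff, if_pos hij]; exact (hbeta i j hij).1) hσmin
      (le_condStd hvar) hM1
      (fun i => (div_le_div_of_nonneg_right (hs i) hσmin.le).trans hSM)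
      (fun i j => by
        have h1 : ((pairNeighbors (edgeCoeff G Cov) i j).card : ℝ) ≤ 2 * d := by
          exact_mod_cast card_pairNeighbors_le hdeg i j
        calc _ ≤ 2 * (d : ℝ) * τ := by gcongr
          _ = 2 * D := by rw [mul_assoc, hdτ])
      hD0.le hD1 hDM hτ0 hτ1 (by linarith) hexp (by linarith)
    -- The exponent 3L gives 2(δ/p)³ per ordered pair, hence 2δ³/p in total, and δ < 1/2.
    have hsmall : (p : ℝ) ^ 2 * (2 * Real.exp (-(3 * L))) ≤ δ / 2 := by
      have h1 : Real.exp (-(3 * L)) = (δ / p) ^ 3 := by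
        rw [show -(3 * L) = (3 : ℕ) * (-L) by push_cast; ring, Real.exp_nat_mul, Real.exp_neg,
          Real.exp_log (by positivity), inv_div]
      have h2 : (p : ℝ) ^ 2 * (2 * (δ / p) ^ 3) = 2 * δ ^ 3 / p := by field_simp
      rw [h1, h2]
      calc 2 * δ ^ 3 / p ≤ 2 * δ ^ 3 / 1 := by gcongr
        _ = δ / 2 * (2 * δ) ^ 2 := by ring
        _ ≤ δ / 2 * 1 := by
            gcongr
            exact pow_le_one₀ (by linarith) (by linarith)
        _ = δ / 2 := mul_one _
    have hne : ∀ᵐ ω ∂P, ∀ m n : ℕ, arr (driving S I Z ω) (n + 1) ≠ m * (τ / 3) := by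
      refine hdyn.ae_driving (q := fun ξ => ∀ m n : ℕ, arr ξ (n + 1) ≠ m * (τ / 3)) ?_
      simp only [MeasureTheory.ae_all_iff]
      intro m n
      rw [MeasureTheory.ae_iff]
      simpa using driveLaw_arr_eq n ((m : ℝ) * (τ / 3))
    rw [MeasureTheory.ae_iff] at hne
    refine one_sub_le_measureReal hδ.le (fun ω hω => ?_)
      ((MeasureTheory.measure_union_le _ _).trans ((add_le_add ((MeasureTheory.measure_union_le _ _).trans
        (add_le_add htame (hwrong.trans (ENNReal.ofReal_le_ofReal hsmall)))) hne.le).trans_eq ?_))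
    · by_contra hn
      simp only [Set.mem_union, not_or] at hn
      obtain ⟨⟨h1, h2⟩, h3⟩ := hn
      refine hω ?_
      simp only [Set.mem_ofPred_eq]
      rw [hρ']
      exact (not_not.1 h1).algorithm_eq (by linarith) hTT hτ0 hσmin hY0 hM hK (not_not.1 h3)
        (not_not.1 h2)
    · rw [add_zero, ← ENNReal.ofReal_add (by positivity) (by positivity), add_halves]
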